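/- \textbf{Theorem.} Let $\beta>0$, $0<\gamma<1$, $k>0$, and let $X=(X_\tau)_{\tau\ge 0}$ be a positive tempered stable subordinator, i.e. a driftless Lévy subordinator (started at $0$, independent stationary increments, a.s. nondecreasing right-continuous paths) with Lévy density $$u(x)=\beta k^{-2\gamma}\frac{\gamma}{\Gamma(\gamma)\Gamma(1-\gamma)}\,x^{-\gamma-1}\exp\left(-\tfrac12k^2x\right),\qquad x>0,$$ so that $\mathbb E[e^{-zX_\tau}]=\exp\left(-\tau\int_0^\infty(1-e^{-zx})u(x)\,dx\right)$ for $z,\tau\ge 0$. For $t>0$ let $T_t=\inf\{\tau>0: X_\tau\ge t\}$, and put $a=\dfrac{\beta\gamma}{2^\gamma\Gamma(\gamma)\Gamma(1-\gamma)}$. For every $t>0$, $T_t$ is a.s. finite and has on $(0,\infty)$ the probability density function $$x\mapsto h(x,t)=\int_0^t p(\tau)\,q(x,t-\tau)\,d\tau ,$$ the integral being absolutely convergent for every $x>0$. Here $p(t)=a\,\Gamma\left(-\gamma,\tfrac{k^2t}{2}\right)$, with $\Gamma(b,y)=\int_y^\infty r^{b-1}e^{-r}\,dr$, and for each $x>0$,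 $q(x,\cdot)$ is the inverse Laplace transform of $$Q(x,s)=\exp\left(-ax\,\Gamma(-\gamma)\left[1-\left(1+\tfrac{2s}{k^2}\right)^{\gamma}\right]\right),$$ that is, the continuous function on $(0,\infty)$ with $\int_0^\infty e^{-st}q(x,t)\,dt=Q(x,s)$, absolutely convergent, for $\operatorname{Re}s>0$. Moreover, if $\gamma=1/m$ with an integer $m\ge2$, then for all $x,t>0$ $$q(x,t)=e^{-xa\Gamma(-\gamma)}\,e^{-k^2t/2}\,\frac{(1/\gamma)^{\frac{\gamma+2}{2\gamma}}}{(2\pi)^{\frac{\gamma+1}{2\gamma}}\left(-xa(\frac2{k^2})^{\gamma}\Gamma(-\gamma)\right)^{1/\gamma}}\sum_{i,-i}\frac1i\,E\left(1,1+\gamma,\dots,2-\gamma::r e^{i\pi}\right),$$ $$r=\frac{\left(-xa(\frac2{k^2})^{\gamma}\Gamma(-\gamma)\right)^{1/\gamma}}{\gamma^{-1/\gamma}\,t}.$$ The list $1,1+\gamma,\dots,2-\gamma$ has the $m$ entries $a_j=1+(j-1)\gamma$; $\sum_{i,-i}$ means that the expression following it is added to the one in which $i$ is replaced by $-i$; and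 $E$ is the MacRobert function $$E(a_1,\dots,a_m::y)=\sum_{l=1}^m\Big(\prod_{j\ne l}\Gamma(a_j-a_l)\Big)\Gamma(a_l)\,y^{a_l}\sum_{n=0}^\infty\frac{(a_l)_n}{\prod_{j\neq l}(a_l-a_j+1)_n}\,\frac{\left((-1)^m y\right)^n}{n!},$$ where $(\cdot)_n$ is the Pochhammer symbol and powers of $y=re^{\pm i\pi}$ are $y^{c}=r^{c}e^{\pm i\pi c}$. -/

import Mathlib

open MeasureTheory ProbabilityTheory Set
open scoped NNReal

noncomputable section

/-! ### Special functions -/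

/-- The upper incomplete gamma function `Γ(a, x) = ∫_x^∞ t^(a-1) e^(-t) dt`. -/
def upperIncGamma (a x : ℝ) : ℝ := ∫ t in Ioi x, t ^ (a - 1) * Real.exp (-t)

/-- The generalized hypergeometric series
`∑ₙ (∏ (aᵢ)ₙ / ∏ (bⱼ)ₙ) zⁿ / n!`, with `(·)ₙ` the Pochhammer symbol. -/
def genHypergeometric {ι κ : Type*} [Fintype ι] [Fintype κ] (a : ι → ℂ) (b : κ → ℂ) (z : ℂ) : ℂ :=
  ∑' n : ℕ, (∏ i, (ascPochhammer ℂ n).eval (a i)) / (∏ j, (ascPochhammer ℂ n).eval (b j))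
    * z ^ n / (n.factorial : ℂ)

/-- The MacRobert function `E(a₁, …, aₘ : b₁, …, bₙ : x)` at the point `x = e^w` of the Riemann
surface of the logarithm: powers are `x ^ c = e^(c w)`, so that for instance `x = r e^(iπ)` and
`x = r e^(-iπ)` are different points. It is given by the first formula if `m > n + 1`, or if
`m = n + 1` and `|x| < 1`, and by the second one otherwise. -/
def macRobertE {m n : ℕ} (a : Fin m → ℂ) (b : Fin n → ℂ) (w : ℂ) : ℂ :=
  open Classical in
  if n + 1 < m ∨ (m = n + 1 ∧ ‖Complex.exp w‖ < 1) then
    ∑ i, (∏ j ∈ Finset.univ.erase i, Complex.Gamma (a j - a i)) * Complex.Gamma (a i)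
        * Complex.exp (a i * w) / (∏ l, Complex.Gamma (b l - a i))
        * genHypergeometric (Fin.cons (a i) (fun l => a i - b l + 1) : Fin (n + 1) → ℂ)
            (fun j : {j : Fin m // j ≠ i} => a i - a j + 1) ((-1) ^ (m + n) * Complex.exp w)
  else
    (∏ i, Complex.Gamma (a i)) / (∏ l, Complex.Gamma (b l))
      * genHypergeometric a b (-1 / Complex.exp w)

/-! ### Laplace transforms and convolutions -/

/-- `f` is the inverse Laplace transform of `F`: `f` is continuous on `(0, ∞)` and
`F(s) = ∫₀^∞ e^(-s t) f(t) dt`, with absolute convergence, whenever `Re s > 0`. These conditions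
determine `f` on `(0, ∞)`. -/
def IsInverseLaplace (f : ℝ → ℝ) (F : ℂ → ℂ) : Prop :=
  ContinuousOn f (Ioi 0) ∧ ∀ s : ℂ, 0 < s.re →
    IntegrableOn (fun t : ℝ => Complex.exp (-s * t) * (f t : ℂ)) (Ioi 0) ∧
    ∫ t in Ioi (0 : ℝ), Complex.exp (-s * t) * (f t : ℂ) = F s

/-- The convolution `(p * q)(t) = ∫₀ᵗ p(τ) q(t - τ) dτ`. -/
def laplaceConv (p q : ℝ → ℝ) (t : ℝ) : ℝ := ∫ τ in (0 : ℝ)..t, p τ * q (t - τ)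

/-! ### Subordinators and first-exit times -/

/-- A (Lévy) subordinator: a real process started at `0` with independent and stationary increments
and almost surely nondecreasing right-continuous paths. -/
structure IsSubordinator {Ω : Type*} [MeasurableSpace Ω] (X : ℝ≥0 → Ω → ℝ) (P : Measure Ω) :
    Prop where
  aemeasurable : ∀ t, AEMeasurable (X t) P
  start_zero : ∀ᵐ ω ∂P, X 0 ω = 0
  indep : HasIndepIncrements X P
  stationary : ∀ s t : ℝ≥0, IdentDistrib (fun ω => X (s + t) ω - X s ω) (X t) P P
  paths : ∀ᵐ ω ∂P, Monotone (fun t => X t ω) ∧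
    ∀ t, ContinuousWithinAt (fun s => X s ω) (Ici t) t

/-- The Laplace exponent `ψ(z) = ∫ (1 - e^(-z u)) π(du)` of a Lévy measure `π` on `(0, ∞)`. -/
def laplaceExponent (π : Measure ℝ) (z : ℝ) : ℝ := ∫ u, (1 - Real.exp (-(z * u))) ∂π

/-- `π` is the Lévy measure of the subordinator `X` (which has no drift), by the Lévy–Khinchin
representation `E[e^(-z Xₜ)] = e^(-t ψ(z))`: it lives on `(0, ∞)`, satisfies
`∫ min(1, u) π(du) < ∞`, and `ψ` is its Laplace exponent. -/
def HasLevyMeasure {Ω : Type*} [MeasurableSpace Ω] (X : ℝ≥0 → Ω → ℝ) (P : Measure Ω)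
    (π : Measure ℝ) : Prop :=
  π (Iic 0) = 0 ∧ Integrable (fun u : ℝ => min 1 u) π ∧
    ∀ (t : ℝ≥0) (z : ℝ), 0 ≤ z →
      ∫ ω, Real.exp (-(z * X t ω)) ∂P = Real.exp (-(t * laplaceExponent π z))

/-- The first-exit time `T_t = inf {τ > 0 : X_τ ≥ t}`. -/
def firstExitTime {Ω : Type*} (X : ℝ≥0 → Ω → ℝ) (t : ℝ) (ω : Ω) : ℝ :=
  sInf ((fun τ : ℝ≥0 => (τ : ℝ)) '' {τ : ℝ≥0 | 0 < τ ∧ t ≤ X τ ω})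

/-- `f` is a probability density function on `(0, ∞)` of the random variable `T`. -/
def HasDensityOnPos {Ω : Type*} [MeasurableSpace Ω] (T : Ω → ℝ) (P : Measure Ω) (f : ℝ → ℝ) :
    Prop :=
  AEMeasurable f (volume.restrict (Ioi 0)) ∧ (∀ x, 0 < x → 0 ≤ f x) ∧
    HasLaw T ((volume.restrict (Ioi 0)).withDensity fun x => ENNReal.ofReal (f x)) P

/-! ### The positive tempered stable case -/

/-- The Lévy density
`u(x) = β k^(-2γ) γ / (Γ(γ) Γ(1-γ)) x^(-γ-1) exp(-k² x / 2)`, for `x > 0`. -/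
def ptsLevyDensity (β γ k x : ℝ) : ℝ :=
  β * k ^ (-2 * γ) * (γ / (Real.Gamma γ * Real.Gamma (1 - γ))) * x ^ (-γ - 1)
    * Real.exp (-(1 / 2) * k ^ 2 * x)

/-- The Lévy measure `u(x) dx` on `(0, ∞)`. -/
def ptsLevyMeasure (β γ k : ℝ) : Measure ℝ :=
  (volume.restrict (Ioi 0)).withDensity fun x => ENNReal.ofReal (ptsLevyDensity β γ k x)

/-- The constant `a = β γ / (2^γ Γ(γ) Γ(1-γ))`. -/
def ptsA (β γ : ℝ) : ℝ := β * γ / (2 ^ γ * Real.Gamma γ * Real.Gamma (1 - γ))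

/-- `p(x, t) = a Γ(-γ, k² t / 2)`; it does not depend on `x`. -/
def ptsP (β γ k t : ℝ) : ℝ := ptsA β γ * upperIncGamma (-γ) (k ^ 2 * t / 2)

/-- `Q(x, s) = exp(-a x Γ(-γ) [1 - (1 + 2 s / k²)^γ])`. -/
def ptsLaplaceQ (β γ k x : ℝ) (s : ℂ) : ℂ :=
  Complex.exp (-((ptsA β γ * x * Real.Gamma (-γ) : ℝ) : ℂ)
    * (1 - (1 + 2 * s / (k : ℂ) ^ 2) ^ (γ : ℂ)))

/-- The modulus of the argument of the `E`-functions in `q(x, t)`. -/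
def ptsModulus (β γ k x t : ℝ) : ℝ :=
  ((2 / k ^ 2) ^ γ * (-(x * ptsA β γ)) * Real.Gamma (-γ)) ^ (1 / γ) / (γ ^ (-1 / γ) * t)

/-- The expression for `q(x, t)` through MacRobert functions, with the `m = 1 / γ` parameters
`1, 1 + γ, …, 2 - γ`. The factor in brackets is the sum `∑_{i,-i} (1/i) E(⋯ :: r e^(iπ))`. -/
def ptsMacRobertQ (β γ k : ℝ) (m : ℕ) (x t : ℝ) : ℂ :=
  ((Real.exp (-(x * ptsA β γ * Real.Gamma (-γ))) * Real.exp (-(k ^ 2) * t / 2)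
      * ((1 / γ) ^ ((γ + 2) / (2 * γ))
        / ((2 * Real.pi) ^ ((γ + 1) / (2 * γ))
          * (-(x * ptsA β γ) * (2 / k ^ 2) ^ γ * Real.Gamma (-γ)) ^ (1 / γ))) : ℝ) : ℂ)
    * (1 / Complex.I
          * macRobertE (fun j : Fin m => 1 + (j : ℂ) * (γ : ℂ)) (Fin.elim0 : Fin 0 → ℂ)
            ((Real.log (ptsModulus β γ k x t) : ℂ) + Complex.I * (Real.pi : ℂ))
      + 1 / (-Complex.I)
          * macRobertE (fun j : Fin m => 1 + (j : ℂ) * (γ : ℂ)) (Fin.elim0 : Fin 0 → ℂ)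
            ((Real.log (ptsModulus β γ k x t) : ℂ) + (-Complex.I) * (Real.pi : ℂ)))

end

/-!
The proof rests on the identity of events `{T_t ≤ x} = {X_x ≥ t}`, which turns the law of the
first-exit time into the distribution function `t ↦ P(X_x ≤ t)`.

*The function `q`.* Integration against the Lévy density gives
`ψ(z) = -a Γ(-γ) ((1 + 2 z / k²)^γ - 1)`, so that `Q(x, s) = e^(-x ψ(s))` is the Laplace transform of
the law of `X_x`. By the identity theorem and a passage to the imaginary axis, the characteristic
function of that law is `θ ↦ Q(x, -iθ)`, which is integrable since its modulus decays like
`exp(-c |θ|^γ)`. Lévy's inversion formula (`eq_withDensity_invFourierDensity_charFun`) then shows that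
`X_x` has the continuous density `q(x, ·) = ptsDensity β γ k x`, the inverse Laplace transform of
`Q(x, ·)` (`isInverseLaplace_ptsDensity`).

*The density of `T_t`.* The function `p` is the tail of the Lévy measure, and its Laplace transform is
`ψ(s) / s` by Tonelli. Hence the convolution `h(y, ·)` of `p` and `q(y, ·)` has Laplace transform
`ψ(s) / s * e^(-y ψ(s))`, and integration over `y ∈ (a, b]` yields
`(e^(-a ψ(s)) - e^(-b ψ(s))) / s`, the Laplace transform of `P(X_a ≤ ·) - P(X_b ≤ ·)`. Uniqueness of
Laplace transforms identifies the two functions almost everywhere, continuity everywhere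
(`setLIntegral_ptsExitDensity_add`), and `a → 0` gives `∫₀^b h(y, t) dy = P(X_b > t) = P(T_t ≤ b)`
(`hasDensityOnPos_firstExitTime`).

*The case `γ = 1/m`.* For `γ ≤ 1/2` the factor `exp(-l z^γ)` of the inversion integrand is bounded on
the closed upper half-plane, so the vertical contour may be moved onto the negative half-line, where
the exponential series can be integrated term by term (`hasSum_ptsDensity`):
`q(x, t) = -(1/π) e^(-x a Γ(-γ)) e^(-k² t / 2) ∑ₙ (-l)ⁿ / n! sin(π n γ) Γ(n γ + 1) t^(-n γ - 1)`.
When `γ = 1/m`, the terms with `n ≡ i` modulo `m` form a hypergeometric series, by the product formula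
for `(j m + i)!`, and Gauss' product of the values `Γ(s/m)` turns the coefficients into those of the
MacRobert functions at `r e^(±iπ)` (`sum_macRobertE_eq`).
-/

/-! ### Fourier inversion for finite measures on the line -/

open Filter Topology FourierTransform SchwartzMap in
/-- Parseval for a finite measure with integrable characteristic function, tested on Schwartz
functions: by Fourier inversion of `f` and Fubini, then by self-adjointness of the Fourier transform. -/
lemma integral_schwartz_eq_integral_mul_fourier_charFun (μ : Measure ℝ) [IsFiniteMeasure μ]
    (hμ : Integrable (fun ξ : ℝ => charFun μ (2 * Real.pi * ξ))) (f : 𝓢(ℝ, ℂ)) :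
    ∫ x, f x ∂μ = ∫ x, f x * 𝓕 (fun ξ : ℝ => charFun μ (2 * Real.pi * ξ)) x := by
  have h1 : ∀ x, f x = ∫ ξ : ℝ, Complex.exp (2 * Real.pi * ξ * x * Complex.I) * 𝓕 (f : ℝ → ℂ) ξ := by
    intro x
    have := f.continuous.fourierInv_fourier_eq f.integrable (𝓕 f : 𝓢(ℝ, ℂ)).integrable
    conv_lhs => rw [← this]
    rw [Real.fourierInv_eq']
    congr 1; ext ξ
    simp only [smul_eq_mul]
    congr 2
    simp; ring
  have hF : Integrable (𝓕 (f : ℝ → ℂ)) := (𝓕 f : 𝓢(ℝ, ℂ)).integrable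
  have h2 : ∫ x, f x ∂μ = ∫ ξ : ℝ, 𝓕 (f : ℝ → ℂ) ξ * charFun μ (2 * Real.pi * ξ) := by
    simp_rw [h1]
    rw [integral_integral_swap]
    · congr 1; ext ξ
      rw [integral_mul_const, charFun_apply_real, mul_comm]
      simp
    · refine Integrable.mono' (g := fun z : ℝ × ℝ => ‖𝓕 (f : ℝ → ℂ) z.2‖) ?_ ?_ ?_
      · exact (Integrable.comp_snd hF μ).norm
      · refine AEStronglyMeasurable.mul (by fun_prop) ?_
        exact hF.aestronglyMeasurable.comp_snd
      · refine Eventually.of_forall fun z => ?_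
        simp only [Function.uncurry, norm_mul]
        rw [show (2 * Real.pi * z.2 * z.1 * Complex.I : ℂ)
          = ((2 * Real.pi * z.2 * z.1 : ℝ) : ℂ) * Complex.I by push_cast; ring,
          Complex.norm_exp_ofReal_mul_I, one_mul]
  rw [h2]
  have := VectorFourier.integral_fourierIntegral_smul_eq_flip (μ := volume) (ν := volume)
    (L := innerₗ ℝ) (f := (f : ℝ → ℂ)) (g := fun ξ : ℝ => charFun μ (2 * Real.pi * ξ))
    Real.continuous_fourierChar continuous_inner f.integrable hμ
  rw [flip_innerₗ] at this
  exact this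

/-- The inverse Fourier transform `t ↦ (1 / 2π) ∫ e^(-iθt) φ(θ) dθ`, the density of the measure with
characteristic function `φ`. The substitution `θ = 2πξ` accounts for the normalisation of Mathlib's
Fourier transform; the real part is taken to obtain a real function. -/
noncomputable def invFourierDensity (φ : ℝ → ℂ) (t : ℝ) : ℝ :=
  (FourierTransform.fourier (fun ξ : ℝ => φ (2 * Real.pi * ξ)) t : ℂ).re

lemma continuous_invFourierDensity {φ : ℝ → ℂ} (h : Integrable φ) :
    Continuous (invFourierDensity φ) := by
  have h' : Integrable (fun ξ : ℝ => φ (2 * Real.pi * ξ)) :=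
    h.comp_mul_left' (by positivity)
  exact Complex.continuous_re.comp
    (VectorFourier.fourierIntegral_continuous Real.continuous_fourierChar continuous_inner h')

/-- Smooth functions supported in `[a, b]` approximating the indicator of `(a, b)`. -/
lemma tendsto_smoothTransition_indicator (a b x : ℝ) :
    Filter.Tendsto (fun n : ℕ => Real.smoothTransition (n * (x - a)) * Real.smoothTransition (n * (b - x)))
      Filter.atTop (nhds ((Ioo a b).indicator (fun _ => (1 : ℝ)) x)) := by
  have key : ∀ y : ℝ, 0 < y → ∀ᶠ n : ℕ in Filter.atTop, Real.smoothTransition (n * y) = 1 := by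
    intro y hy
    filter_upwards [Filter.eventually_ge_atTop ⌈1 / y⌉₊] with n hn
    apply Real.smoothTransition.one_of_one_le
    have := (Nat.le_ceil (1 / y)).trans (Nat.cast_le.mpr hn)
    rwa [div_le_iff₀ hy] at this
  by_cases hx : x ∈ Ioo a b
  · rw [indicator_of_mem hx]
    refine tendsto_const_nhds.congr' ?_
    filter_upwards [key (x - a) (by linarith [hx.1]), key (b - x) (by linarith [hx.2])] with n h1 h2
    rw [h1, h2, one_mul]
  · rw [indicator_of_notMem hx]
    refine tendsto_const_nhds.congr fun n => ?_
    rw [mem_Ioo, not_and_or, not_lt, not_lt] at hx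
    rcases hx with hx | hx
    · rw [Real.smoothTransition.zero_of_nonpos, zero_mul]
      exact mul_nonpos_of_nonneg_of_nonpos (Nat.cast_nonneg _) (by linarith)
    · rw [Real.smoothTransition.zero_of_nonpos (x := n * (b - x)), mul_zero]
      exact mul_nonpos_of_nonneg_of_nonpos (Nat.cast_nonneg _) (by linarith)

open Filter Topology FourierTransform SchwartzMap in
lemma measureReal_Ioo_eq_setIntegral_invFourierDensity (μ : Measure ℝ) [IsFiniteMeasure μ]
    (hμ : Integrable (charFun μ)) (a b : ℝ) :
    μ.real (Ioo a b) = ∫ x in Ioo a b, invFourierDensity (charFun μ) x := by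
  have hμ' : Integrable (fun ξ : ℝ => charFun μ (2 * Real.pi * ξ)) :=
    hμ.comp_mul_left' (by positivity)
  set D := 𝓕 (fun ξ : ℝ => charFun μ (2 * Real.pi * ξ)) with hD
  have hDc : Continuous D :=
    VectorFourier.fourierIntegral_continuous Real.continuous_fourierChar continuous_inner hμ'
  have hdc := continuous_invFourierDensity hμ
  let g : ℕ → ℝ → ℝ := fun n x =>
    Real.smoothTransition (n * (x - a)) * Real.smoothTransition (n * (b - x))
  have gc : ∀ n, Continuous (g n) := fun n => by
    have := Real.smoothTransition.continuous
    fun_prop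
  have g0 : ∀ n x, x ∉ Icc a b → g n x = 0 := by
    intro n x hx
    rw [mem_Icc, not_and_or, not_le, not_le] at hx
    simp only [g]
    rcases hx with hx | hx
    · rw [Real.smoothTransition.zero_of_nonpos, zero_mul]
      exact mul_nonpos_of_nonneg_of_nonpos (Nat.cast_nonneg _) (by linarith)
    · rw [Real.smoothTransition.zero_of_nonpos (x := n * (b - x)), mul_zero]
      exact mul_nonpos_of_nonneg_of_nonpos (Nat.cast_nonneg _) (by linarith)
  have g1 : ∀ n x, ‖g n x‖ ≤ 1 := by
    intro n x
    simp only [g, norm_mul, Real.norm_of_nonneg (Real.smoothTransition.nonneg _)]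
    exact mul_le_one₀ (Real.smoothTransition.le_one _) (Real.smoothTransition.nonneg _) (Real.smoothTransition.le_one _)
  have hsup : ∀ n, HasCompactSupport (fun x => (g n x : ℂ)) := fun n =>
    HasCompactSupport.intro isCompact_Icc (K := Icc a b) (fun x hx => by simp [g0 n x hx])
  have hsm : ∀ n, ContDiff ℝ (⊤ : ℕ∞) (fun x => (g n x : ℂ)) := by
    intro n
    have h := Real.smoothTransition.contDiff (n := (⊤ : ℕ∞))
    refine Complex.ofRealCLM.contDiff.comp (ContDiff.mul ?_ ?_)
    · exact h.comp (contDiff_const.mul (contDiff_id.sub contDiff_const))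
    · exact h.comp (contDiff_const.mul (contDiff_const.sub contDiff_id))
  have key : ∀ n, ∫ x, g n x ∂μ = ∫ x, g n x * invFourierDensity (charFun μ) x := by
    intro n
    have h := integral_schwartz_eq_integral_mul_fourier_charFun μ hμ' ((hsup n).toSchwartzMap (hsm n))
    have h' : ((∫ x, g n x ∂μ : ℝ) : ℂ) = ∫ x, (g n x : ℂ) * D x := by
      rw [← integral_complex_ofReal]; exact h
    have h2 := congrArg Complex.re h'
    rw [Complex.ofReal_re] at h2
    rw [h2]
    have hint : Integrable (fun x => (g n x : ℂ) * D x) :=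
      Continuous.integrable_of_hasCompactSupport ((hsm n).continuous.mul hDc) (hsup n).mul_right
    have := integral_re hint
    simp only [RCLike.re_eq_complex_re] at this
    rw [← this]
    congr 1; ext x
    simp [invFourierDensity, hD]
  have l1 : Tendsto (fun n => ∫ x, g n x ∂μ) atTop (𝓝 (∫ x, (Ioo a b).indicator (fun _ => (1 : ℝ)) x ∂μ)) := by
    refine tendsto_integral_of_dominated_convergence (fun _ => 1) ?_ (integrable_const _) ?_ ?_
    · exact fun n => (gc n).aestronglyMeasurable
    · exact fun n => Eventually.of_forall (g1 n)
    · exact Eventually.of_forall (tendsto_smoothTransition_indicator a b)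
  have l2 : Tendsto (fun n => ∫ x, g n x * invFourierDensity (charFun μ) x) atTop
      (𝓝 (∫ x, (Ioo a b).indicator (fun _ => (1 : ℝ)) x * invFourierDensity (charFun μ) x)) := by
    refine tendsto_integral_of_dominated_convergence
      ((Icc a b).indicator (fun x => ‖invFourierDensity (charFun μ) x‖)) ?_ ?_ ?_ ?_
    · exact fun n => ((gc n).mul hdc).aestronglyMeasurable
    · exact (hdc.norm.integrableOn_Icc).integrable_indicator measurableSet_Icc
    · refine fun n => Eventually.of_forall fun x => ?_
      by_cases hx : x ∈ Icc a b
      · rw [indicator_of_mem hx, norm_mul]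
        exact mul_le_of_le_one_left (norm_nonneg _) (g1 n x)
      · simp [g0 n x hx, indicator_of_notMem hx]
    · exact Eventually.of_forall fun x => (tendsto_smoothTransition_indicator a b x).mul_const _
  simp_rw [key] at l1
  have := tendsto_nhds_unique l1 l2
  rw [integral_indicator measurableSet_Ioo] at this
  simp only [integral_const, measureReal_restrict_apply_univ, smul_eq_mul, mul_one] at this
  rw [this, ← integral_indicator measurableSet_Ioo]
  congr 1; ext x
  by_cases hx : x ∈ Ioo a b <;> simp [hx]

open Filter Topology in
/-- If the continuous density were negative at a point, an interval around it would have negative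
measure. -/
lemma invFourierDensity_charFun_nonneg (μ : Measure ℝ) [IsFiniteMeasure μ]
    (hμ : Integrable (charFun μ)) (t : ℝ) : 0 ≤ invFourierDensity (charFun μ) t := by
  by_contra! hneg
  have hdc := continuous_invFourierDensity hμ
  obtain ⟨ε, hε, hball⟩ := Metric.eventually_nhds_iff_ball.mp
    (hdc.continuousAt.eventually_lt_const hneg)
  rw [Real.ball_eq_Ioo] at hball
  have h := measureReal_Ioo_eq_setIntegral_invFourierDensity μ hμ (t - ε) (t + ε)
  have h2 : 0 < ∫ x in Ioo (t - ε) (t + ε), -invFourierDensity (charFun μ) x := by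
    rw [setIntegral_pos_iff_support_of_nonneg_ae]
    · have : Function.support (fun x => -invFourierDensity (charFun μ) x) ∩ Ioo (t - ε) (t + ε) = Ioo (t - ε) (t + ε) := by
        refine inter_eq_right.mpr fun x hx => ?_
        simp [(hball x hx).ne]
      rw [this]
      simp [hε]
    · refine (ae_restrict_iff' measurableSet_Ioo).mpr (Eventually.of_forall fun x hx => ?_)
      simpa using (hball x hx).le
    · exact (hdc.neg.integrableOn_Icc).mono_set Ioo_subset_Icc_self
  rw [integral_neg, ← h] at h2
  have := measureReal_nonneg (μ := μ) (s := Ioo (t - ε) (t + ε))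
  linarith

/-- Lévy's inversion formula: a finite measure with integrable characteristic function is absolutely
continuous, with the inverse Fourier transform as its density. -/
theorem eq_withDensity_invFourierDensity_charFun (μ : Measure ℝ) [IsFiniteMeasure μ]
    (hμ : Integrable (charFun μ)) :
    μ = volume.withDensity (fun t => ENNReal.ofReal (invFourierDensity (charFun μ) t)) := by
  refine Real.measure_ext_Ioo_rat fun a b => ?_
  rw [withDensity_apply _ measurableSet_Ioo, ← ofReal_integral_eq_lintegral_ofReal,
    ← measureReal_Ioo_eq_setIntegral_invFourierDensity μ hμ, ofReal_measureReal]
  · exact ((continuous_invFourierDensity hμ).integrableOn_Icc).mono_set Ioo_subset_Icc_self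
  · exact Filter.Eventually.of_forall fun x => invFourierDensity_charFun_nonneg μ hμ x

/-! ### Laplace transforms of finite measures on the half-line -/

lemma integrable_exp_neg_mul_of_ae_nonneg {μ : Measure ℝ} [IsFiniteMeasure μ]
    (hμ : ∀ᵐ u ∂μ, 0 ≤ u) {s : ℝ} (hs : 0 ≤ s) : Integrable (fun u => Real.exp (-s * u)) μ := by
  refine Integrable.of_bound (by fun_prop) 1 ?_
  filter_upwards [hμ] with u hu
  rw [Real.norm_of_nonneg (Real.exp_pos _).le, Real.exp_le_one_iff]
  nlinarith

/-- Identity theorem: the Laplace transform on the real half-line determines the one on the complex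
half-plane. -/
lemma eqOn_complexMGF_of_laplace_eq {μ : Measure ℝ} [IsFiniteMeasure μ] (hμ : ∀ᵐ u ∂μ, 0 ≤ u)
    {F : ℂ → ℂ} (hF : DifferentiableOn ℂ F {z | z.re < 0})
    (h : ∀ s : ℝ, 0 < s → ((∫ u, Real.exp (-s * u) ∂μ : ℝ) : ℂ) = F (-s)) :
    EqOn (complexMGF id μ) F {z | z.re < 0} := by
  have hopen : IsOpen {z : ℂ | z.re < 0} := isOpen_lt Complex.continuous_re continuous_const
  have hset : Iio (0 : ℝ) ⊆ interior (integrableExpSet id μ) := by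
    refine interior_maximal (fun s hs => ?_) isOpen_Iio
    have := integrable_exp_neg_mul_of_ae_nonneg hμ (s := -s) (by linarith [mem_Iio.mp hs])
    simpa [integrableExpSet] using this
  have hA : AnalyticOnNhd ℂ (complexMGF id μ) {z | z.re < 0} :=
    fun z hz => analyticAt_complexMGF (hset hz)
  have hconv : Convex ℝ {z : ℂ | z.re < 0} :=
    (convex_Iio (0 : ℝ)).linear_preimage Complex.reLm
  refine AnalyticOnNhd.eqOn_of_preconnected_of_frequently_eq hA (hF.analyticOnNhd hopen)
    hconv.isPreconnected (z₀ := -1) (by simp) ?_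
  rw [Filter.frequently_iff_seq_forall]
  -- the two functions agree at the points `-(1 + 1 / (n + 1))`, which accumulate at `-1`
  refine ⟨fun n : ℕ => ((-(1 + 1 / ((n : ℝ) + 1)) : ℝ) : ℂ), ?_, fun n => ?_⟩
  · rw [tendsto_nhdsWithin_iff]
    constructor
    · have := (tendsto_one_div_add_atTop_nhds_zero_nat (𝕜 := ℝ)).const_add 1 |>.neg
      have h2 := (Complex.continuous_ofReal.tendsto _).comp this
      refine (h2.congr fun n => ?_).trans (le_of_eq ?_) <;> simp
    · refine Filter.Eventually.of_forall fun n => ?_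
      have : (0 : ℝ) < 1 / ((n : ℝ) + 1) := by positivity
      intro h0
      have h1 := congrArg Complex.re (mem_singleton_iff.mp h0)
      rw [Complex.ofReal_re] at h1
      simp at h1
      linarith [h1, this, show ((n : ℝ) + 1)⁻¹ = 1 / ((n : ℝ) + 1) by simp]
  · have hpos : (0 : ℝ) < 1 + 1 / ((n : ℝ) + 1) := by positivity
    rw [complexMGF_ofReal]
    have := h _ hpos
    simp only [mgf, id]
    rw [this]; simp

/-- The characteristic function is the boundary value of the Laplace transform. -/
lemma tendsto_complexMGF_charFun {μ : Measure ℝ} [IsFiniteMeasure μ] (hμ : ∀ᵐ u ∂μ, 0 ≤ u) (θ : ℝ) :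
    Filter.Tendsto (fun n : ℕ => complexMGF id μ ((-(1 / ((n : ℝ) + 1)) : ℝ) + θ * Complex.I))
      Filter.atTop (nhds (charFun μ θ)) := by
  rw [charFun_apply_real]
  refine tendsto_integral_of_dominated_convergence (fun _ => 1) (fun n => by fun_prop)
    (integrable_const _) (fun n => ?_) (Filter.Eventually.of_forall fun u => ?_)
  · filter_upwards [hμ] with u hu
    rw [Complex.norm_exp, Real.exp_le_one_iff]
    have h1 : (0 : ℝ) < 1 / ((n : ℝ) + 1) := by positivity
    simp only [Complex.mul_re, Complex.add_re, Complex.ofReal_re, Complex.ofReal_im, Complex.I_re,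
      Complex.I_im, id]
    nlinarith
  · have := (tendsto_one_div_add_atTop_nhds_zero_nat (𝕜 := ℝ)).neg
    have h2 := (Complex.continuous_ofReal.tendsto _).comp this
    have h3 := ((h2.add_const (θ * Complex.I)).mul_const (u : ℂ))
    have h4 := (Complex.continuous_exp.tendsto _).comp h3
    refine (h4.congr fun n => ?_).trans (le_of_eq ?_)
    · simp
    · congr 2; simp; ring

/-- A finite measure on the half-line is determined by its Laplace transform. -/
theorem ext_of_laplace_eq {μ ν : Measure ℝ} [IsFiniteMeasure μ] [IsFiniteMeasure ν]
    (hμ : ∀ᵐ u ∂μ, 0 ≤ u) (hν : ∀ᵐ u ∂ν, 0 ≤ u)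
    (h : ∀ s : ℝ, 0 < s → ∫ u, Real.exp (-s * u) ∂μ = ∫ u, Real.exp (-s * u) ∂ν) : μ = ν := by
  have hset : Iio (0 : ℝ) ⊆ interior (integrableExpSet id ν) := by
    refine interior_maximal (fun s hs => ?_) isOpen_Iio
    have := integrable_exp_neg_mul_of_ae_nonneg hν (s := -s) (by linarith [mem_Iio.mp hs])
    simpa [integrableExpSet] using this
  have heq : EqOn (complexMGF id μ) (complexMGF id ν) {z | z.re < 0} := by
    refine eqOn_complexMGF_of_laplace_eq hμ (fun z hz => ?_) fun s hs => ?_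
    · exact (differentiableOn_complexMGF (X := id) z (hset hz)).differentiableAt
        ((isOpen_interior.preimage Complex.continuous_re).mem_nhds (hset hz))
        |>.differentiableWithinAt
    · rw [h s hs, ← Complex.ofReal_neg, complexMGF_ofReal]; rfl
  refine Measure.ext_of_charFun (funext fun θ => ?_)
  refine tendsto_nhds_unique (tendsto_complexMGF_charFun hμ θ)
    ((tendsto_complexMGF_charFun hν θ).congr fun n => ?_)
  refine (heq ?_).symm
  have : (0 : ℝ) < 1 / ((n : ℝ) + 1) := by positivity
  simp only [mem_ofPred_eq, Complex.add_re, Complex.ofReal_re, Complex.mul_re, Complex.I_re, Complex.I_im, Complex.ofReal_im]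
  linarith

/-! ### The Laplace exponent and the Lévy tail -/

lemma integral_rpow_neg_mul_exp_neg_mul {γ v : ℝ} (hγ1 : γ < 1) (hv : 0 < v) :
    ∫ x in Ioi (0 : ℝ), x ^ (-γ) * Real.exp (-(v * x)) = Real.Gamma (1 - γ) * v ^ (γ - 1) := by
  have := Real.integral_rpow_mul_exp_neg_mul_Ioi (a := 1 - γ) (r := v) (by linarith) hv
  rw [show (1 - γ - 1 : ℝ) = -γ by ring] at this
  rw [this, mul_comm, one_div, Real.inv_rpow hv.le, ← Real.rpow_neg hv.le]
  congr 2; ring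

lemma integrableOn_rpow_neg_mul_exp_neg_mul {γ v : ℝ} (hγ1 : γ < 1) (hv : 0 < v) :
    IntegrableOn (fun x : ℝ => x ^ (-γ) * Real.exp (-(v * x))) (Ioi 0) := by
  have := integrableOn_rpow_mul_exp_neg_mul_rpow (s := -γ) (p := 1) (b := v) (by linarith) one_pos hv
  simpa using this

lemma setIntegral_exp_neg_mul {γ c z x : ℝ} (hz : 0 ≤ z) (hx : 0 < x) :
    ∫ v in Ioc c (c + z), x ^ (-γ) * Real.exp (-(v * x))
      = (1 - Real.exp (-(z * x))) * (x ^ (-γ - 1) * Real.exp (-(c * x))) := by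
  rw [integral_const_mul, ← intervalIntegral.integral_of_le (by linarith)]
  have : ∫ v in c..(c + z), Real.exp (-(v * x)) = (Real.exp (-(c * x)) - Real.exp (-((c + z) * x))) / x := by
    have h : ∀ v ∈ uIcc c (c + z), HasDerivAt (fun v => -Real.exp (-(v * x)) / x) (Real.exp (-(v * x))) v := by
      intro v _
      have := ((((hasDerivAt_id v).mul_const x).neg).exp.neg).div_const x
      convert! this using 1
      simp; field_simp
    rw [intervalIntegral.integral_eq_sub_of_hasDerivAt h (by apply Continuous.intervalIntegrable; fun_prop)]
    ring
  rw [this, Real.rpow_sub_one hx.ne', show -((c + z) * x) = -(z * x) + -(c * x) by ring, Real.exp_add]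
  field_simp

lemma integrable_prod_rpow_neg_mul_exp {γ c z : ℝ} (hγ1 : γ < 1) (hc : 0 < c) :
    Integrable (fun w : ℝ × ℝ => w.1 ^ (-γ) * Real.exp (-(w.2 * w.1)))
      ((volume.restrict (Ioi 0)).prod (volume.restrict (Ioc c (c + z)))) := by
  have hm : AEStronglyMeasurable (fun w : ℝ × ℝ => w.1 ^ (-γ) * Real.exp (-(w.2 * w.1)))
      ((volume.restrict (Ioi 0)).prod (volume.restrict (Ioc c (c + z)))) :=
    Measurable.aestronglyMeasurable (by fun_prop)
  rw [integrable_prod_iff' hm]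
  constructor
  · refine (ae_restrict_iff' measurableSet_Ioc).mpr (Filter.Eventually.of_forall fun v hv => ?_)
    exact integrableOn_rpow_neg_mul_exp_neg_mul hγ1 (hc.trans hv.1)
  · have : IntegrableOn (fun v : ℝ => Real.Gamma (1 - γ) * v ^ (γ - 1)) (Ioc c (c + z)) := by
      refine (ContinuousOn.integrableOn_Icc ?_).mono_set Ioc_subset_Icc_self
      exact continuousOn_const.mul (continuousOn_id.rpow_const fun x hx => Or.inl (hc.trans_le hx.1).ne')
    refine Integrable.congr this ?_
    refine (ae_restrict_iff' measurableSet_Ioc).mpr (Filter.Eventually.of_forall fun v hv => ?_)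
    beta_reduce
    rw [← integral_rpow_neg_mul_exp_neg_mul hγ1 (hc.trans hv.1)]
    refine setIntegral_congr_fun measurableSet_Ioi fun x hx => ?_
    dsimp only
    rw [Real.norm_of_nonneg]
    exact mul_nonneg (Real.rpow_nonneg (le_of_lt hx) _) (Real.exp_pos _).le

lemma integrableOn_one_sub_exp_mul {γ c z : ℝ} (hγ1 : γ < 1) (hc : 0 < c) (hz : 0 ≤ z) :
    IntegrableOn (fun x : ℝ => (1 - Real.exp (-(z * x))) * (x ^ (-γ - 1) * Real.exp (-(c * x))))
      (Ioi 0) := by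
  refine Integrable.congr (integrable_prod_rpow_neg_mul_exp (z := z) hγ1 hc).integral_prod_left ?_
  exact (ae_restrict_iff' measurableSet_Ioi).mpr
    (Filter.Eventually.of_forall fun x hx => setIntegral_exp_neg_mul hz hx)

/-- The Laplace exponent of the unnormalised density `x^(-γ-1) e^(-c x)`; writing
`(1 - e^(-z x)) e^(-c x) / x` as the integral of `e^(-v x)` over `v ∈ (c, c + z)` reduces it to
the integral of `v^(γ-1)`. -/
lemma integral_one_sub_exp_mul {γ c z : ℝ} (hγ0 : 0 < γ) (hγ1 : γ < 1) (hc : 0 < c) (hz : 0 ≤ z) :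
    ∫ x in Ioi (0 : ℝ), (1 - Real.exp (-(z * x))) * (x ^ (-γ - 1) * Real.exp (-(c * x)))
      = Real.Gamma (1 - γ) / γ * ((c + z) ^ γ - c ^ γ) := by
  have h1 : ∫ x in Ioi (0 : ℝ), (1 - Real.exp (-(z * x))) * (x ^ (-γ - 1) * Real.exp (-(c * x)))
      = ∫ x in Ioi (0 : ℝ), ∫ v in Ioc c (c + z), x ^ (-γ) * Real.exp (-(v * x)) :=
    setIntegral_congr_fun measurableSet_Ioi fun x hx => (setIntegral_exp_neg_mul hz hx).symm
  rw [h1, integral_integral_swap (integrable_prod_rpow_neg_mul_exp hγ1 hc)]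
  have h2 : ∫ v in Ioc c (c + z), ∫ x in Ioi (0 : ℝ), x ^ (-γ) * Real.exp (-(v * x))
      = ∫ v in Ioc c (c + z), Real.Gamma (1 - γ) * v ^ (γ - 1) :=
    setIntegral_congr_fun measurableSet_Ioc fun v hv =>
      integral_rpow_neg_mul_exp_neg_mul hγ1 (hc.trans hv.1)
  rw [h2, integral_const_mul, ← intervalIntegral.integral_of_le (by linarith),
    integral_rpow (Or.inl (by linarith))]
  rw [sub_add_cancel]; ring

lemma gamma_neg_lt_zero {γ : ℝ} (hγ0 : 0 < γ) (hγ1 : γ < 1) : Real.Gamma (-γ) < 0 := by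
  have h := Real.Gamma_add_one (s := -γ) (by linarith)
  have h1 : 0 < Real.Gamma (-γ + 1) := Real.Gamma_pos_of_pos (by linarith)
  rw [h] at h1
  nlinarith

lemma ptsA_pos {β γ : ℝ} (hβ : 0 < β) (hγ0 : 0 < γ) (hγ1 : γ < 1) : 0 < ptsA β γ := by
  have h1 := Real.Gamma_pos_of_pos hγ0
  have h2 : 0 < Real.Gamma (1 - γ) := Real.Gamma_pos_of_pos (by linarith)
  unfold ptsA; positivity

lemma neg_ptsA_mul_gamma_pos {β γ : ℝ} (hβ : 0 < β) (hγ0 : 0 < γ) (hγ1 : γ < 1) :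
    0 < -(ptsA β γ * Real.Gamma (-γ)) := by
  have := mul_neg_of_pos_of_neg (ptsA_pos hβ hγ0 hγ1) (gamma_neg_lt_zero hγ0 hγ1)
  linarith

lemma ptsLevyDensity_eq {β γ k : ℝ} (hk : 0 < k) (x : ℝ) :
    ptsLevyDensity β γ k x
      = ptsA β γ * (k ^ 2 / 2) ^ (-γ) * (x ^ (-γ - 1) * Real.exp (-(k ^ 2 / 2 * x))) := by
  have h : β * k ^ (-2 * γ) * (γ / (Real.Gamma γ * Real.Gamma (1 - γ)))
      = ptsA β γ * (k ^ 2 / 2) ^ (-γ) := by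
    unfold ptsA
    rw [Real.div_rpow (by positivity) (by norm_num), ← Real.rpow_natCast, ← Real.rpow_mul hk.le,
      Real.rpow_neg (by norm_num : (0 : ℝ) ≤ 2)]
    have : (2 : ℝ) ^ γ ≠ 0 := by positivity
    push_cast
    rw [mul_neg, neg_mul]
    field_simp
  unfold ptsLevyDensity
  rw [h, show -(1 / 2) * k ^ 2 * x = -(k ^ 2 / 2 * x) by ring, mul_assoc]

lemma ptsLevyDensity_nonneg {β γ k x : ℝ} (hβ : 0 < β) (hγ0 : 0 < γ) (hγ1 : γ < 1) (hk : 0 < k)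
    (hx : 0 ≤ x) : 0 ≤ ptsLevyDensity β γ k x := by
  have := ptsA_pos hβ hγ0 hγ1
  rw [ptsLevyDensity_eq hk]; positivity

lemma measurable_ptsLevyDensity (β γ k : ℝ) : Measurable (ptsLevyDensity β γ k) := by
  unfold ptsLevyDensity; fun_prop

lemma integral_ptsLevyMeasure {β γ k : ℝ} (hβ : 0 < β) (hγ0 : 0 < γ) (hγ1 : γ < 1) (hk : 0 < k)
    (f : ℝ → ℝ) :
    ∫ x, f x ∂(ptsLevyMeasure β γ k) = ∫ x in Ioi (0 : ℝ), ptsLevyDensity β γ k x * f x := by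
  unfold ptsLevyMeasure
  rw [integral_withDensity_eq_integral_toReal_smul
    (measurable_ptsLevyDensity β γ k).ennreal_ofReal (Filter.Eventually.of_forall fun x => by simp)]
  refine setIntegral_congr_fun measurableSet_Ioi fun x hx => ?_
  simp [ENNReal.toReal_ofReal (ptsLevyDensity_nonneg hβ hγ0 hγ1 hk (le_of_lt hx))]

lemma laplaceExponent_ptsLevyMeasure {β γ k z : ℝ} (hβ : 0 < β) (hγ0 : 0 < γ) (hγ1 : γ < 1)
    (hk : 0 < k) (hz : 0 ≤ z) :
    laplaceExponent (ptsLevyMeasure β γ k) z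
      = -(ptsA β γ * Real.Gamma (-γ)) * ((1 + 2 * z / k ^ 2) ^ γ - 1) := by
  have hc : 0 < k ^ 2 / 2 := by positivity
  unfold laplaceExponent
  rw [integral_ptsLevyMeasure hβ hγ0 hγ1 hk]
  have h1 : ∀ x, ptsLevyDensity β γ k x * (1 - Real.exp (-(z * x)))
      = ptsA β γ * (k ^ 2 / 2) ^ (-γ) *
        ((1 - Real.exp (-(z * x))) * (x ^ (-γ - 1) * Real.exp (-(k ^ 2 / 2 * x)))) := by
    intro x; rw [ptsLevyDensity_eq hk]; ring
  simp_rw [h1]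
  rw [integral_const_mul, integral_one_sub_exp_mul hγ0 hγ1 hc hz]
  have hG : Real.Gamma (1 - γ) = -γ * Real.Gamma (-γ) := by
    rw [← Real.Gamma_add_one (by linarith)]; congr 1; ring
  have h2 : k ^ 2 / 2 + z = (k ^ 2 / 2) * (1 + 2 * z / k ^ 2) := by field_simp
  rw [h2, Real.mul_rpow hc.le (by positivity), hG, Real.rpow_neg hc.le]
  have : (k ^ 2 / 2) ^ γ ≠ 0 := by positivity
  field_simp

lemma integrable_one_sub_exp_ptsLevyMeasure {β γ k z : ℝ} (hβ : 0 < β) (hγ0 : 0 < γ) (hγ1 : γ < 1)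
    (hk : 0 < k) (hz : 0 ≤ z) :
    Integrable (fun u => 1 - Real.exp (-(z * u))) (ptsLevyMeasure β γ k) := by
  unfold ptsLevyMeasure
  rw [integrable_withDensity_iff (measurable_ptsLevyDensity β γ k).ennreal_ofReal
    (Filter.Eventually.of_forall fun x => by simp)]
  have h := (integrableOn_one_sub_exp_mul (γ := γ) hγ1 (c := k ^ 2 / 2) (by positivity) hz).const_mul
    (ptsA β γ * (k ^ 2 / 2) ^ (-γ))
  refine Integrable.congr h ((ae_restrict_iff' measurableSet_Ioi).mpr
    (Filter.Eventually.of_forall fun x hx => ?_))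
  beta_reduce
  rw [ENNReal.toReal_ofReal (ptsLevyDensity_nonneg hβ hγ0 hγ1 hk (le_of_lt hx)),
    ptsLevyDensity_eq hk]
  ring

lemma laplaceExponent_ptsLevyMeasure_pos {β γ k z : ℝ} (hβ : 0 < β) (hγ0 : 0 < γ) (hγ1 : γ < 1)
    (hk : 0 < k) (hz : 0 < z) : 0 < laplaceExponent (ptsLevyMeasure β γ k) z := by
  rw [laplaceExponent_ptsLevyMeasure hβ hγ0 hγ1 hk hz.le]
  refine mul_pos (neg_ptsA_mul_gamma_pos hβ hγ0 hγ1) (sub_pos.mpr (Real.one_lt_rpow ?_ hγ0))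
  have : 0 < 2 * z / k ^ 2 := by positivity
  linarith

/-- `p` is the tail `t ↦ π(t, ∞)` of the Lévy measure. -/
lemma ptsLevyMeasure_Ioi {β γ k t : ℝ} (hβ : 0 < β) (hγ0 : 0 < γ) (hγ1 : γ < 1)
    (hk : 0 < k) (ht : 0 < t) :
    ptsLevyMeasure β γ k (Ioi t) = ENNReal.ofReal (ptsP β γ k t) := by
  have hc : 0 < k ^ 2 / 2 := by positivity
  have hint : IntegrableOn (fun x : ℝ => x ^ (-γ - 1) * Real.exp (-(k ^ 2 / 2 * x))) (Ioi t) := by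
    have h := (exp_neg_integrableOn_Ioi t hc).const_mul (t ^ (-γ - 1))
    refine Integrable.mono' h (by fun_prop) ((ae_restrict_iff' measurableSet_Ioi).mpr
      (Filter.Eventually.of_forall fun x hx => ?_))
    have hx0 : 0 < x := ht.trans hx
    rw [Real.norm_of_nonneg (by positivity), neg_mul]
    exact mul_le_mul_of_nonneg_right
      (Real.rpow_le_rpow_of_nonpos ht (le_of_lt hx) (by linarith)) (Real.exp_pos _).le
  have hp : ptsP β γ k t = ∫ x in Ioi t, ptsLevyDensity β γ k x := by
    simp_rw [ptsLevyDensity_eq hk]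
    rw [integral_const_mul]
    unfold ptsP upperIncGamma
    have := integral_comp_mul_left_Ioi (fun r : ℝ => r ^ (-γ - 1) * Real.exp (-r)) t hc
    have h2 : ∫ x in Ioi t, (k ^ 2 / 2 * x) ^ (-γ - 1) * Real.exp (-(k ^ 2 / 2 * x))
        = (k ^ 2 / 2) ^ (-γ - 1) * ∫ x in Ioi t, x ^ (-γ - 1) * Real.exp (-(k ^ 2 / 2 * x)) := by
      rw [← integral_const_mul]
      refine setIntegral_congr_fun measurableSet_Ioi fun x hx => ?_
      rw [Real.mul_rpow hc.le (ht.trans hx).le]; ring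
    rw [h2, smul_eq_mul, eq_comm, inv_mul_eq_iff_eq_mul₀ hc.ne'] at this
    rw [show k ^ 2 * t / 2 = k ^ 2 / 2 * t by ring, this, Real.rpow_sub_one hc.ne']
    field_simp
  unfold ptsLevyMeasure
  rw [withDensity_apply _ measurableSet_Ioi, Measure.restrict_restrict measurableSet_Ioi,
    Ioi_inter_Ioi, sup_of_le_left ht.le, hp, ofReal_integral_eq_lintegral_ofReal]
  · refine (hint.const_mul (ptsA β γ * (k ^ 2 / 2) ^ (-γ))).congr
      (Filter.Eventually.of_forall fun x => ?_)
    exact (ptsLevyDensity_eq hk x).symm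
  · exact (ae_restrict_iff' measurableSet_Ioi).mpr (Filter.Eventually.of_forall fun x hx =>
      ptsLevyDensity_nonneg hβ hγ0 hγ1 hk (ht.trans hx).le)

lemma ptsP_nonneg {β γ k t : ℝ} (hβ : 0 < β) (hγ0 : 0 < γ) (hγ1 : γ < 1) (ht : 0 ≤ t) :
    0 ≤ ptsP β γ k t := by
  refine mul_nonneg (ptsA_pos hβ hγ0 hγ1).le
    (setIntegral_nonneg measurableSet_Ioi fun r hr => ?_)
  have : 0 ≤ r := le_trans (by positivity) (le_of_lt hr)
  positivity

/-- Tonelli: the Laplace transform of the tail of a Lévy measure is its Laplace exponent divided by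
the variable. -/
lemma lintegral_exp_mul_measure_Ioi (π : Measure ℝ) [SFinite π] (hπ : π (Iic 0) = 0) {s : ℝ}
    (hs : 0 < s) (hint : Integrable (fun u => 1 - Real.exp (-(s * u))) π) :
    ∫⁻ τ in Ioi (0 : ℝ), ENNReal.ofReal (Real.exp (-(s * τ))) * π (Ioi τ)
      = ENNReal.ofReal (laplaceExponent π s / s) := by
  have hae : ∀ᵐ u ∂π, 0 < u := by
    rw [ae_iff]; convert hπ using 2; ext; simp
  have h1 : ∀ τ : ℝ, ENNReal.ofReal (Real.exp (-(s * τ))) * π (Ioi τ)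
      = ∫⁻ u, {w : ℝ × ℝ | w.1 < w.2}.indicator
        (fun w => ENNReal.ofReal (Real.exp (-(s * w.1)))) (τ, u) ∂π := by
    intro τ
    rw [← lintegral_indicator_const measurableSet_Ioi]
    rfl
  simp_rw [h1]
  rw [lintegral_lintegral_swap]
  swap
  · refine (Measurable.indicator (by fun_prop) ?_).aemeasurable
    exact measurableSet_lt measurable_fst measurable_snd
  have h2 : ∀ᵐ u ∂π, ∫⁻ τ in Ioi (0 : ℝ), {w : ℝ × ℝ | w.1 < w.2}.indicator
        (fun w => ENNReal.ofReal (Real.exp (-(s * w.1)))) (τ, u)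
      = ENNReal.ofReal ((1 - Real.exp (-(s * u))) / s) := by
    filter_upwards [hae] with u hu
    have h3 : ∀ τ : ℝ, {w : ℝ × ℝ | w.1 < w.2}.indicator
        (fun w => ENNReal.ofReal (Real.exp (-(s * w.1)))) (τ, u)
        = (Iio u).indicator (fun τ => ENNReal.ofReal (Real.exp (-(s * τ)))) τ := fun τ => rfl
    simp_rw [h3]
    rw [lintegral_indicator measurableSet_Iio, Measure.restrict_restrict measurableSet_Iio,
      Iio_inter_Ioi, ← ofReal_integral_eq_lintegral_ofReal]
    · congr 1
      rw [← integral_Ioc_eq_integral_Ioo, ← intervalIntegral.integral_of_le hu.le]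
      have h : ∀ v ∈ uIcc 0 u, HasDerivAt (fun v => -Real.exp (-(s * v)) / s)
          (Real.exp (-(s * v))) v := by
        intro v _
        have := ((((hasDerivAt_id v).const_mul s).neg).exp.neg).div_const s
        convert! this using 1
        simp; field_simp
      rw [intervalIntegral.integral_eq_sub_of_hasDerivAt h
        (by apply Continuous.intervalIntegrable; fun_prop)]
      simp; ring
    · exact (Continuous.integrableOn_Icc (by fun_prop)).mono_set Ioo_subset_Icc_self
    · exact Filter.Eventually.of_forall fun x => (Real.exp_pos _).le
  rw [lintegral_congr_ae h2, ← ofReal_integral_eq_lintegral_ofReal, integral_div]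
  · rfl
  · exact hint.div_const s
  · filter_upwards [hae] with u hu
    have : Real.exp (-(s * u)) ≤ 1 := Real.exp_le_one_iff.mpr (by nlinarith)
    exact div_nonneg (by linarith) hs.le

/-! ### The transform `Q` -/

/-- On the right half-plane the argument of `w` is at most `π / 2` in modulus. -/
lemma cos_mul_norm_rpow_le_re_cpow {γ : ℝ} (hγ0 : 0 ≤ γ) (hγ1 : γ ≤ 1) {w : ℂ} (hw : 0 ≤ w.re)
    (hw0 : w ≠ 0) : Real.cos (γ * (Real.pi / 2)) * ‖w‖ ^ γ ≤ (w ^ (γ : ℂ)).re := by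
  have harg : |w.arg| ≤ Real.pi / 2 := Complex.abs_arg_le_pi_div_two_iff.mpr hw
  have hpi := Real.pi_pos
  have hcos : Real.cos (γ * (Real.pi / 2)) ≤ Real.cos (γ * w.arg) := by
    rw [← Real.cos_abs (γ * w.arg), abs_mul, abs_of_nonneg hγ0]
    apply Real.cos_le_cos_of_nonneg_of_le_pi
    · positivity
    · nlinarith
    · gcongr
  have h : (w ^ (γ : ℂ)).re = ‖w‖ ^ γ * Real.cos (γ * w.arg) := by
    rw [Complex.cpow_ofReal_re, mul_comm γ]
  rw [h, mul_comm]
  gcongr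

/-- On the real half-line, `Q(x, z) = e^(-x ψ(z))`. -/
lemma ptsLaplaceQ_ofReal {β γ k x z : ℝ} (hβ : 0 < β) (hγ0 : 0 < γ) (hγ1 : γ < 1)
    (hk : 0 < k) (hz : 0 ≤ z) :
    ptsLaplaceQ β γ k x z
      = ((Real.exp (-(x * laplaceExponent (ptsLevyMeasure β γ k) z)) : ℝ) : ℂ) := by
  rw [laplaceExponent_ptsLevyMeasure hβ hγ0 hγ1 hk hz]
  unfold ptsLaplaceQ
  rw [Complex.ofReal_exp]
  congr 1
  push_cast
  rw [Complex.ofReal_cpow (by positivity)]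
  push_cast
  ring

lemma differentiableAt_ptsLaplaceQ {β γ k x : ℝ} {s : ℂ} (hs : 0 ≤ s.re) :
    DifferentiableAt ℂ (ptsLaplaceQ β γ k x) s := by
  unfold ptsLaplaceQ
  have : 1 + 2 * s / (k : ℂ) ^ 2 ∈ Complex.slitPlane := by
    left
    rw [← Complex.ofReal_pow, Complex.add_re, Complex.div_ofReal_re]
    simp
    positivity
  have h : DifferentiableAt ℂ (fun s : ℂ => 1 + 2 * s / (k : ℂ) ^ 2) s := by fun_prop
  have h2 := h.cpow_const (c := (γ : ℂ)) this
  fun_prop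

/-- On the imaginary axis `|Q(x, ·)|` decays like `exp(-c |θ|^γ)` with `c > 0`. -/
lemma norm_ptsLaplaceQ_neg_I_mul_le {β γ k x : ℝ} (hβ : 0 < β) (hγ0 : 0 < γ) (hγ1 : γ < 1)
    (hk : 0 < k) (hx : 0 ≤ x) (θ : ℝ) :
    ‖ptsLaplaceQ β γ k x (-(θ * Complex.I))‖
      ≤ Real.exp (x * -(ptsA β γ * Real.Gamma (-γ)))
        * Real.exp (-(x * -(ptsA β γ * Real.Gamma (-γ)) * Real.cos (γ * (Real.pi / 2))
          * (2 / k ^ 2) ^ γ) * |θ| ^ γ) := by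
  have hb := neg_ptsA_mul_gamma_pos hβ hγ0 hγ1
  set b := -(ptsA β γ * Real.Gamma (-γ)) with hbdef
  set w : ℂ := 1 + 2 * (-(θ * Complex.I)) / (k : ℂ) ^ 2 with hwdef
  have hwre : w.re = 1 := by
    rw [hwdef, ← Complex.ofReal_pow, Complex.add_re, Complex.div_ofReal_re]; simp
  have hwim : w.im = -(2 / k ^ 2 * θ) := by
    rw [hwdef, ← Complex.ofReal_pow, Complex.add_im, Complex.div_ofReal_im]; simp; ring
  have hw0 : w ≠ 0 := by intro h; rw [h] at hwre; simp at hwre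
  have hcos : 0 ≤ Real.cos (γ * (Real.pi / 2)) := by
    apply Real.cos_nonneg_of_neg_pi_div_two_le_of_le <;> nlinarith [Real.pi_pos]
  have h1 := cos_mul_norm_rpow_le_re_cpow hγ0.le hγ1.le (by rw [hwre]; norm_num) hw0
  have h2 : (2 / k ^ 2) ^ γ * |θ| ^ γ ≤ ‖w‖ ^ γ := by
    rw [← Real.mul_rpow (by positivity) (abs_nonneg _)]
    refine Real.rpow_le_rpow (by positivity) ?_ hγ0.le
    have := Complex.abs_im_le_norm w
    rw [hwim, abs_neg, abs_mul, abs_of_pos (by positivity : (0 : ℝ) < 2 / k ^ 2)] at this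
    exact this
  unfold ptsLaplaceQ
  rw [← hwdef, Complex.norm_exp, ← Real.exp_add, Real.exp_le_exp,
    show -((ptsA β γ * x * Real.Gamma (-γ) : ℝ) : ℂ) = ((x * b : ℝ) : ℂ) by
      rw [hbdef]; push_cast; ring, Complex.re_ofReal_mul, Complex.sub_re, Complex.one_re]
  have h3 := mul_le_mul_of_nonneg_left h2 hcos
  have h4 := mul_le_mul_of_nonneg_left (h3.trans h1) (mul_nonneg hx hb.le)
  nlinarith [h4]

lemma integrable_comp_abs_of_integrableOn_Ioi {f : ℝ → ℝ} (hf : IntegrableOn f (Ioi 0)) :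
    Integrable (fun x => f |x|) := by
  have h1 : IntegrableOn (fun x => f |x|) (Ioi 0) :=
    hf.congr_fun (fun x hx => by rw [abs_of_pos hx]) measurableSet_Ioi
  have h2 : IntegrableOn (fun x => f |x|) (Iic 0) := by
    rw [← Measure.map_neg_eq_self (volume : Measure ℝ)]
    let m : MeasurableEmbedding fun x : ℝ => -x := (Homeomorph.neg ℝ).measurableEmbedding
    rw [m.integrableOn_map_iff]
    simp_rw [Function.comp_def, abs_neg, neg_preimage, neg_Iic, neg_zero]
    exact Iff.mpr integrableOn_Ici_iff_integrableOn_Ioi h1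
  rw [← integrableOn_univ, ← Iic_union_Ioi (a := (0 : ℝ))]
  exact h2.union h1

lemma integrable_ptsLaplaceQ_neg_I_mul {β γ k x : ℝ} (hβ : 0 < β) (hγ0 : 0 < γ) (hγ1 : γ < 1)
    (hk : 0 < k) (hx : 0 < x) :
    Integrable (fun θ : ℝ => ptsLaplaceQ β γ k x (-(θ * Complex.I))) := by
  have hcont : Continuous (fun θ : ℝ => ptsLaplaceQ β γ k x (-(θ * Complex.I))) := by
    refine continuous_iff_continuousAt.mpr fun θ => ?_
    have h := (differentiableAt_ptsLaplaceQ (β := β) (γ := γ) (k := k) (x := x)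
      (s := -(θ * Complex.I)) (by simp)).continuousAt
    exact ContinuousAt.comp (f := fun θ : ℝ => -((θ : ℂ) * Complex.I)) h (by fun_prop)
  refine Integrable.mono' ?_ hcont.aestronglyMeasurable (Filter.Eventually.of_forall fun θ =>
    norm_ptsLaplaceQ_neg_I_mul_le hβ hγ0 hγ1 hk hx.le θ)
  refine Integrable.const_mul ?_ _
  have hb := neg_ptsA_mul_gamma_pos hβ hγ0 hγ1
  have hcos : 0 < Real.cos (γ * (Real.pi / 2)) := by
    apply Real.cos_pos_of_mem_Ioo
    constructor <;> nlinarith [Real.pi_pos]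
  have := integrableOn_rpow_mul_exp_neg_mul_rpow (s := 0) (p := γ)
    (b := x * -(ptsA β γ * Real.Gamma (-γ)) * Real.cos (γ * (Real.pi / 2)) * (2 / k ^ 2) ^ γ)
    (by norm_num) hγ0 (by positivity)
  simp only [Real.rpow_zero, one_mul] at this
  exact integrable_comp_abs_of_integrableOn_Ioi this

/-! ### The density of the subordinator -/

/-- The function `q(x, ·)`: the Fourier inversion integral of `θ ↦ Q(x, -iθ)`. -/
noncomputable def ptsDensity (β γ k x : ℝ) : ℝ → ℝ :=
  invFourierDensity fun θ => ptsLaplaceQ β γ k x (-(θ * Complex.I))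

lemma continuous_ptsDensity {β γ k x : ℝ} (hβ : 0 < β) (hγ0 : 0 < γ) (hγ1 : γ < 1)
    (hk : 0 < k) (hx : 0 < x) : Continuous (ptsDensity β γ k x) :=
  continuous_invFourierDensity (integrable_ptsLaplaceQ_neg_I_mul hβ hγ0 hγ1 hk hx)

lemma measurable_ptsDensity_uncurry (β γ k : ℝ) :
    Measurable (fun w : ℝ × ℝ => ptsDensity β γ k w.1 w.2) := by
  unfold ptsDensity invFourierDensity
  simp_rw [Real.fourier_real_eq_integral_exp_smul]
  refine Complex.measurable_re.comp ?_
  refine (StronglyMeasurable.integral_prod_right' (f := fun z : (ℝ × ℝ) × ℝ =>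
    Complex.exp (((-2 * Real.pi * z.2 * z.1.2 : ℝ) : ℂ) * Complex.I) •
      ptsLaplaceQ β γ k z.1.1 (-(((2 * Real.pi * z.2 : ℝ) : ℂ) * Complex.I))) ?_).measurable
  refine Measurable.stronglyMeasurable ?_
  unfold ptsLaplaceQ
  fun_prop

/-- `q(x, ·)` is bounded, uniformly for `x` in a compact subset of `(0, ∞)`. -/
lemma exists_abs_ptsDensity_le {β γ k : ℝ} (hβ : 0 < β) (hγ0 : 0 < γ) (hγ1 : γ < 1)
    (hk : 0 < k) {a : ℝ} (ha : 0 < a) (b : ℝ) :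
    ∃ C : ℝ, ∀ x ∈ Icc a b, ∀ t, |ptsDensity β γ k x t| ≤ C := by
  have hb := neg_ptsA_mul_gamma_pos hβ hγ0 hγ1
  set B := -(ptsA β γ * Real.Gamma (-γ)) with hB
  have hcos : 0 < Real.cos (γ * (Real.pi / 2)) := by
    apply Real.cos_pos_of_mem_Ioo
    constructor <;> nlinarith [Real.pi_pos]
  let g : ℝ → ℝ := fun θ => Real.exp (b * B) *
    Real.exp (-(a * B * Real.cos (γ * (Real.pi / 2)) * (2 / k ^ 2) ^ γ) * |θ| ^ γ)
  have hg : Integrable g := by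
    refine Integrable.const_mul ?_ _
    have := integrableOn_rpow_mul_exp_neg_mul_rpow (s := 0) (p := γ)
      (b := a * B * Real.cos (γ * (Real.pi / 2)) * (2 / k ^ 2) ^ γ) (by norm_num) hγ0 (by positivity)
    simp only [Real.rpow_zero, one_mul] at this
    exact integrable_comp_abs_of_integrableOn_Ioi this
  have hg' : Integrable (fun ξ => g (2 * Real.pi * ξ)) := hg.comp_mul_left' (by positivity)
  refine ⟨∫ ξ, g (2 * Real.pi * ξ), fun x hx t => ?_⟩
  refine (Complex.abs_re_le_norm _).trans ((VectorFourier.norm_fourierIntegral_le_integral_norm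
    _ _ _ _ _).trans ?_)
  have h1 : ∀ θ : ℝ, ‖ptsLaplaceQ β γ k x (-(θ * Complex.I))‖ ≤ g θ := by
    intro θ
    refine (norm_ptsLaplaceQ_neg_I_mul_le hβ hγ0 hγ1 hk (ha.le.trans hx.1) θ).trans ?_
    refine mul_le_mul ?_ ?_ (Real.exp_pos _).le (Real.exp_pos _).le
    · exact Real.exp_le_exp.mpr (mul_le_mul_of_nonneg_right hx.2 hb.le)
    · rw [Real.exp_le_exp, neg_mul, neg_mul, neg_le_neg_iff]
      have h1 := hx.1
      gcongr
  have h2 : Integrable (fun ξ : ℝ => ptsLaplaceQ β γ k x (-(((2 * Real.pi * ξ : ℝ) : ℂ) * Complex.I))) :=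
    (integrable_ptsLaplaceQ_neg_I_mul hβ hγ0 hγ1 hk (ha.trans_le hx.1)).comp_mul_left'
      (g := fun θ : ℝ => ptsLaplaceQ β γ k x (-(θ * Complex.I))) (by positivity)
  exact integral_mono h2.norm hg' fun ξ => h1 _

section Law

variable {β γ k x : ℝ} {μ : Measure ℝ}

/-! In this section `μ` is the law of `X_x`, described by its Laplace transform `e^(-x ψ)`. -/

lemma eqOn_complexMGF_ptsLaplaceQ [IsFiniteMeasure μ] (hβ : 0 < β) (hγ0 : 0 < γ) (hγ1 : γ < 1)
    (hk : 0 < k) (hμ : ∀ᵐ u ∂μ, 0 ≤ u)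
    (hL : ∀ z : ℝ, 0 ≤ z → ∫ u, Real.exp (-(z * u)) ∂μ
      = Real.exp (-(x * laplaceExponent (ptsLevyMeasure β γ k) z))) :
    EqOn (complexMGF id μ) (fun w => ptsLaplaceQ β γ k x (-w)) {w | w.re < 0} := by
  refine eqOn_complexMGF_of_laplace_eq hμ (fun w hw => ?_) fun s hs => ?_
  · have h := differentiableAt_ptsLaplaceQ (β := β) (γ := γ) (k := k) (x := x) (s := -w)
      (by simpa using (le_of_lt hw))
    exact (h.comp w differentiableAt_id.neg).differentiableWithinAt
  · simp_rw [neg_mul]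
    rw [hL s hs.le, neg_neg, ptsLaplaceQ_ofReal hβ hγ0 hγ1 hk hs.le]

lemma charFun_eq_ptsLaplaceQ [IsFiniteMeasure μ] (hβ : 0 < β) (hγ0 : 0 < γ) (hγ1 : γ < 1)
    (hk : 0 < k) (hμ : ∀ᵐ u ∂μ, 0 ≤ u)
    (hL : ∀ z : ℝ, 0 ≤ z → ∫ u, Real.exp (-(z * u)) ∂μ
      = Real.exp (-(x * laplaceExponent (ptsLevyMeasure β γ k) z))) :
    charFun μ = fun θ : ℝ => ptsLaplaceQ β γ k x (-(θ * Complex.I)) := by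
  ext θ
  refine tendsto_nhds_unique (tendsto_complexMGF_charFun hμ θ) ?_
  have hc := (differentiableAt_ptsLaplaceQ (β := β) (γ := γ) (k := k) (x := x)
    (s := -(θ * Complex.I)) (by simp)).continuousAt
  have h1 : Filter.Tendsto (fun n : ℕ => -(((-(1 / ((n : ℝ) + 1)) : ℝ) : ℂ) + θ * Complex.I))
      Filter.atTop (nhds (-(θ * Complex.I))) := by
    have := (tendsto_one_div_add_atTop_nhds_zero_nat (𝕜 := ℝ)).neg
    have h2 := (Complex.continuous_ofReal.tendsto _).comp this
    have h3 := (h2.add_const (θ * Complex.I)).neg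
    simpa using h3
  refine (hc.tendsto.comp h1).congr fun n => ?_
  refine (eqOn_complexMGF_ptsLaplaceQ hβ hγ0 hγ1 hk hμ hL ?_).symm
  have : (0 : ℝ) < 1 / ((n : ℝ) + 1) := by positivity
  simp only [mem_ofPred_eq, Complex.add_re, Complex.ofReal_re, Complex.mul_re, Complex.I_re,
    Complex.I_im, Complex.ofReal_im]
  linarith

lemma ptsDensity_nonneg [IsFiniteMeasure μ] (hβ : 0 < β) (hγ0 : 0 < γ) (hγ1 : γ < 1)
    (hk : 0 < k) (hx : 0 < x) (hμ : ∀ᵐ u ∂μ, 0 ≤ u)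
    (hL : ∀ z : ℝ, 0 ≤ z → ∫ u, Real.exp (-(z * u)) ∂μ
      = Real.exp (-(x * laplaceExponent (ptsLevyMeasure β γ k) z))) (t : ℝ) :
    0 ≤ ptsDensity β γ k x t := by
  have hc := charFun_eq_ptsLaplaceQ hβ hγ0 hγ1 hk hμ hL
  unfold ptsDensity
  rw [← hc]
  exact invFourierDensity_charFun_nonneg μ
    (hc ▸ integrable_ptsLaplaceQ_neg_I_mul hβ hγ0 hγ1 hk hx) t

lemma eq_withDensity_ptsDensity [IsFiniteMeasure μ] (hβ : 0 < β) (hγ0 : 0 < γ) (hγ1 : γ < 1)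
    (hk : 0 < k) (hx : 0 < x) (hμ : ∀ᵐ u ∂μ, 0 ≤ u)
    (hL : ∀ z : ℝ, 0 ≤ z → ∫ u, Real.exp (-(z * u)) ∂μ
      = Real.exp (-(x * laplaceExponent (ptsLevyMeasure β γ k) z))) :
    μ = volume.withDensity fun t => ENNReal.ofReal (ptsDensity β γ k x t) := by
  have hc := charFun_eq_ptsLaplaceQ hβ hγ0 hγ1 hk hμ hL
  unfold ptsDensity
  rw [← hc]
  exact eq_withDensity_invFourierDensity_charFun μ
    (hc ▸ integrable_ptsLaplaceQ_neg_I_mul hβ hγ0 hγ1 hk hx)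

/-- The density vanishes almost everywhere on the negative half-line, hence everywhere there by
continuity. -/
lemma ptsDensity_eq_zero [IsFiniteMeasure μ] (hβ : 0 < β) (hγ0 : 0 < γ) (hγ1 : γ < 1)
    (hk : 0 < k) (hx : 0 < x) (hμ : ∀ᵐ u ∂μ, 0 ≤ u)
    (hL : ∀ z : ℝ, 0 ≤ z → ∫ u, Real.exp (-(z * u)) ∂μ
      = Real.exp (-(x * laplaceExponent (ptsLevyMeasure β γ k) z))) {t : ℝ} (ht : t ≤ 0) :
    ptsDensity β γ k x t = 0 := by
  have hcont := continuous_ptsDensity hβ hγ0 hγ1 hk hx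
  have h0 : μ (Iio 0) = 0 := by
    rw [ae_iff] at hμ; simpa [Iio] using hμ
  rw [eq_withDensity_ptsDensity hβ hγ0 hγ1 hk hx hμ hL, withDensity_apply _ measurableSet_Iio,
    lintegral_eq_zero_iff (by fun_prop)] at h0
  have h1 : ptsDensity β γ k x =ᵐ[volume.restrict (Iio 0)] fun _ => 0 := by
    filter_upwards [h0] with u hu
    exact le_antisymm (by simpa using hu) (ptsDensity_nonneg hβ hγ0 hγ1 hk hx hμ hL u)
  have h2 := Measure.eqOn_open_of_ae_eq h1 isOpen_Iio hcont.continuousOn continuousOn_const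
  have h3 := h2.closure hcont continuous_const
  rw [closure_Iio] at h3
  exact h3 ht

lemma isInverseLaplace_ptsDensity [IsFiniteMeasure μ] (hβ : 0 < β) (hγ0 : 0 < γ) (hγ1 : γ < 1)
    (hk : 0 < k) (hx : 0 < x) (hμ : ∀ᵐ u ∂μ, 0 ≤ u)
    (hL : ∀ z : ℝ, 0 ≤ z → ∫ u, Real.exp (-(z * u)) ∂μ
      = Real.exp (-(x * laplaceExponent (ptsLevyMeasure β γ k) z))) :
    IsInverseLaplace (ptsDensity β γ k x) (ptsLaplaceQ β γ k x) := by
  have hcont := continuous_ptsDensity hβ hγ0 hγ1 hk hx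
  have hnn := ptsDensity_nonneg hβ hγ0 hγ1 hk hx hμ hL
  have hμd := eq_withDensity_ptsDensity hβ hγ0 hγ1 hk hx hμ hL
  refine ⟨hcont.continuousOn, fun s hs => ?_⟩
  have hmeas : Measurable fun t => ENNReal.ofReal (ptsDensity β γ k x t) := by fun_prop
  have hint : Integrable (fun u : ℝ => Complex.exp (-s * u)) μ := by
    refine Integrable.of_bound (by fun_prop) 1 ?_
    filter_upwards [hμ] with u hu
    rw [Complex.norm_exp, Real.exp_le_one_iff]
    simp
    positivity
  have heq : ∀ t : ℝ, (ENNReal.ofReal (ptsDensity β γ k x t)).toReal • Complex.exp (-s * t)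
      = Complex.exp (-s * t) * (ptsDensity β γ k x t : ℂ) := by
    intro t
    rw [ENNReal.toReal_ofReal (hnn t), Complex.real_smul, mul_comm]
  constructor
  · have := hint
    rw [hμd, integrable_withDensity_iff_integrable_smul' hmeas
      (Filter.Eventually.of_forall fun t => by simp)] at this
    simp_rw [heq] at this
    exact this.integrableOn
  · rw [setIntegral_eq_integral_of_forall_compl_eq_zero]
    · have h1 := eqOn_complexMGF_ptsLaplaceQ hβ hγ0 hγ1 hk hμ hL
        (show -s ∈ {w : ℂ | w.re < 0} by simpa using hs)
      beta_reduce at h1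
      rw [neg_neg] at h1
      rw [← h1, complexMGF, hμd, integral_withDensity_eq_integral_toReal_smul hmeas
        (Filter.Eventually.of_forall fun t => by simp)]
      simp only [id, heq]
    · intro t ht
      rw [ptsDensity_eq_zero hβ hγ0 hγ1 hk hx hμ hL (not_lt.mp ht)]
      simp

/-- The Laplace transform of `q(x, ·)`, as a Lebesgue integral over the real line. -/
lemma lintegral_exp_mul_ptsDensity [IsFiniteMeasure μ] (hβ : 0 < β) (hγ0 : 0 < γ) (hγ1 : γ < 1)
    (hk : 0 < k) (hx : 0 < x) (hμ : ∀ᵐ u ∂μ, 0 ≤ u)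
    (hL : ∀ z : ℝ, 0 ≤ z → ∫ u, Real.exp (-(z * u)) ∂μ
      = Real.exp (-(x * laplaceExponent (ptsLevyMeasure β γ k) z))) {s : ℝ} (hs : 0 ≤ s) :
    ∫⁻ t, ENNReal.ofReal (Real.exp (-(s * t))) * ENNReal.ofReal (ptsDensity β γ k x t)
      = ENNReal.ofReal (Real.exp (-(x * laplaceExponent (ptsLevyMeasure β γ k) s))) := by
  have hcont := continuous_ptsDensity hβ hγ0 hγ1 hk hx
  have hmeas : Measurable fun t => ENNReal.ofReal (ptsDensity β γ k x t) := by fun_prop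
  have hint := integrable_exp_neg_mul_of_ae_nonneg hμ hs
  simp_rw [neg_mul] at hint
  rw [← hL s hs, ofReal_integral_eq_lintegral_ofReal hint
    (Filter.Eventually.of_forall fun u => (Real.exp_pos _).le)]
  conv_rhs => rw [eq_withDensity_ptsDensity hβ hγ0 hγ1 hk hx hμ hL]
  rw [lintegral_withDensity_eq_lintegral_mul _ hmeas (by fun_prop)]
  simp only [Pi.mul_apply, mul_comm]

end Law

/-! ### The distribution function of the first-exit time -/

/-- Functions on the half-line with the same finite Laplace transform agree almost everywhere. After
multiplication by `e^(-t)` they are densities of finite measures, to which `ext_of_laplace_eq`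
applies. -/
lemma ae_eq_of_lintegral_exp_mul_eq {f g : ℝ → ENNReal} (hf : Measurable f) (hg : Measurable g)
    (hf0 : ∀ t < 0, f t = 0) (hg0 : ∀ t < 0, g t = 0)
    (hfin : ∀ s : ℝ, 0 < s → ∫⁻ t, ENNReal.ofReal (Real.exp (-(s * t))) * f t ≠ ⊤)
    (h : ∀ s : ℝ, 0 < s → ∫⁻ t, ENNReal.ofReal (Real.exp (-(s * t))) * f t
      = ∫⁻ t, ENNReal.ofReal (Real.exp (-(s * t))) * g t) : f =ᵐ[volume] g := by
  have key : ∀ F : ℝ → ENNReal, Measurable F → (∀ t < 0, F t = 0) →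
      (∀ᵐ u ∂(volume.withDensity fun t => ENNReal.ofReal (Real.exp (-t)) * F t), 0 ≤ u) ∧
      ∀ s : ℝ, 0 < s →
        ∫ u, Real.exp (-s * u) ∂(volume.withDensity fun t => ENNReal.ofReal (Real.exp (-t)) * F t)
        = (∫⁻ t, ENNReal.ofReal (Real.exp (-((1 + s) * t))) * F t).toReal := by
    intro F hF hF0
    have hm : Measurable fun t => ENNReal.ofReal (Real.exp (-t)) * F t := by fun_prop
    constructor
    · rw [ae_withDensity_iff hm]
      refine Filter.Eventually.of_forall fun u hu => ?_
      by_contra! hneg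
      exact hu (by rw [hF0 u hneg, mul_zero])
    · intro s hs
      rw [integral_eq_lintegral_of_nonneg_ae (Filter.Eventually.of_forall fun u => (Real.exp_pos _).le)
        (by fun_prop), lintegral_withDensity_eq_lintegral_mul _ hm (by fun_prop)]
      congr 1
      refine lintegral_congr fun t => ?_
      simp only [Pi.mul_apply]
      rw [mul_right_comm, ← ENNReal.ofReal_mul (Real.exp_pos _).le, ← Real.exp_add]
      congr 3; ring
  have hmf : Measurable fun t => ENNReal.ofReal (Real.exp (-t)) * f t := by fun_prop
  have hmg : Measurable fun t => ENNReal.ofReal (Real.exp (-t)) * g t := by fun_prop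
  have h1 := hfin 1 one_pos
  have h2 := h 1 one_pos
  simp only [one_mul] at h1 h2
  have i1 : IsFiniteMeasure (volume.withDensity fun t => ENNReal.ofReal (Real.exp (-t)) * f t) :=
    isFiniteMeasure_withDensity h1
  have i2 : IsFiniteMeasure (volume.withDensity fun t => ENNReal.ofReal (Real.exp (-t)) * g t) :=
    isFiniteMeasure_withDensity (h2 ▸ h1)
  have heq := ext_of_laplace_eq (key f hf hf0).1 (key g hg hg0).1 fun s hs => by
    rw [(key f hf hf0).2 s hs, (key g hg hg0).2 s hs, h _ (by linarith)]
  rw [withDensity_eq_iff hmf.aemeasurable hmg.aemeasurable h1] at heq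
  filter_upwards [heq] with t ht
  exact (ENNReal.mul_right_inj (by simp [Real.exp_pos]) (by simp)).mp ht

/-- Tonelli: the Laplace transform of a distribution function. -/
lemma lintegral_exp_mul_measure_Iic {μ : Measure ℝ} [IsFiniteMeasure μ] (hμ : ∀ᵐ u ∂μ, 0 ≤ u)
    {s : ℝ} (hs : 0 < s) :
    ∫⁻ t, ENNReal.ofReal (Real.exp (-(s * t))) * μ (Iic t)
      = ENNReal.ofReal ((∫ u, Real.exp (-(s * u)) ∂μ) / s) := by
  have h1 : ∀ t : ℝ, ENNReal.ofReal (Real.exp (-(s * t))) * μ (Iic t)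
      = ∫⁻ u, {w : ℝ × ℝ | w.2 ≤ w.1}.indicator
        (fun w => ENNReal.ofReal (Real.exp (-(s * w.1)))) (t, u) ∂μ := by
    intro t
    rw [← lintegral_indicator_const measurableSet_Iic]
    rfl
  simp_rw [h1]
  rw [lintegral_lintegral_swap]
  swap
  · refine (Measurable.indicator (by fun_prop) ?_).aemeasurable
    exact measurableSet_le measurable_snd measurable_fst
  have h2 : ∀ u : ℝ, ∫⁻ t : ℝ, {w : ℝ × ℝ | w.2 ≤ w.1}.indicator
        (fun w => ENNReal.ofReal (Real.exp (-(s * w.1)))) (t, u)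
      = ENNReal.ofReal (Real.exp (-(s * u)) / s) := by
    intro u
    have h3 : ∀ t : ℝ, {w : ℝ × ℝ | w.2 ≤ w.1}.indicator
        (fun w => ENNReal.ofReal (Real.exp (-(s * w.1)))) (t, u)
        = (Ici u).indicator (fun t => ENNReal.ofReal (Real.exp (-(s * t)))) t := fun t => rfl
    simp_rw [h3]
    have hint : IntegrableOn (fun t => Real.exp (-(s * t))) (Ioi u) := by
      simpa [neg_mul] using exp_neg_integrableOn_Ioi u hs
    rw [lintegral_indicator measurableSet_Ici, setLIntegral_congr Ioi_ae_eq_Ici.symm,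
      ← ofReal_integral_eq_lintegral_ofReal hint
        (Filter.Eventually.of_forall fun x => (Real.exp_pos _).le)]
    congr 1
    have := integral_exp_mul_Ioi (a := -s) (by linarith) u
    simp_rw [neg_mul] at this
    rw [this, div_neg, neg_div, neg_neg]
  simp_rw [h2]
  have hint := integrable_exp_neg_mul_of_ae_nonneg hμ hs.le
  simp_rw [neg_mul] at hint
  rw [← ofReal_integral_eq_lintegral_ofReal (hint.div_const s)
    (Filter.Eventually.of_forall fun x => by positivity), integral_div]

lemma continuous_measure_Iic (μ : Measure ℝ) [IsFiniteMeasure μ] [NullSingletonClass μ] :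
    Continuous fun t => μ (Iic t) := by
  refine continuous_iff_continuousAt.mpr fun t => ?_
  have h : ∀ t, μ (Iic t) = ∫⁻ u, (Iic t).indicator 1 u ∂μ := fun t => by
    rw [lintegral_indicator_one measurableSet_Iic]
  simp_rw [h]
  refine tendsto_lintegral_filter_of_dominated_convergence (fun _ => 1)
    (Filter.Eventually.of_forall fun t => Measurable.indicator measurable_one measurableSet_Iic)
    (Filter.Eventually.of_forall fun t => Filter.Eventually.of_forall fun u =>
      indicator_le_self' (fun _ _ => zero_le_one) u) (by simp) ?_
  have hne : ∀ᵐ u ∂μ, u ≠ t := by simp [ae_iff]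
  filter_upwards [hne] with u hu
  refine tendsto_const_nhds.congr' ?_
  rcases lt_or_gt_of_ne hu with h | h
  · filter_upwards [lt_mem_nhds h] with t' ht'
    simp [indicator, h.le, ht'.le]
  · filter_upwards [gt_mem_nhds h] with t' ht'
    simp [indicator, not_le.mpr h, not_le.mpr ht']

/-- The convolution `∫₀^∞ π(τ, ∞) q(y, t - τ) dτ` in the extended nonnegative reals. -/
noncomputable def ptsExitDensity (β γ k y t : ℝ) : ENNReal :=
  ∫⁻ τ in Ioi (0 : ℝ), ptsLevyMeasure β γ k (Ioi τ) * ENNReal.ofReal (ptsDensity β γ k y (t - τ))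

lemma measurable_measure_Ioi (π : Measure ℝ) : Measurable fun τ => π (Ioi τ) :=
  Antitone.measurable fun _ _ h => measure_mono (Ioi_subset_Ioi h)

lemma measurable_ptsExitDensity_uncurry (β γ k : ℝ) :
    Measurable fun w : ℝ × ℝ => ptsExitDensity β γ k w.1 w.2 := by
  unfold ptsExitDensity
  refine Measurable.lintegral_prod_right' (f := fun z : (ℝ × ℝ) × ℝ =>
    ptsLevyMeasure β γ k (Ioi z.2) * ENNReal.ofReal (ptsDensity β γ k z.1.1 (z.1.2 - z.2))) ?_
  refine Measurable.mul ((measurable_measure_Ioi _).comp measurable_snd) ?_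
  have h := (measurable_ptsDensity_uncurry β γ k).comp
    (show Measurable fun z : (ℝ × ℝ) × ℝ => (z.1.1, z.1.2 - z.2) by fun_prop)
  exact h.ennreal_ofReal

lemma measurable_ptsExitDensity_left (β γ k t : ℝ) :
    Measurable fun y => ptsExitDensity β γ k y t :=
  Measurable.comp (g := fun w : ℝ × ℝ => ptsExitDensity β γ k w.1 w.2) (f := fun y => (y, t))
    (measurable_ptsExitDensity_uncurry β γ k) (by fun_prop)

lemma measurable_ptsExitDensity_swap (β γ k : ℝ) :
    Measurable fun w : ℝ × ℝ => ptsExitDensity β γ k w.2 w.1 := by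
  have h := (measurable_ptsExitDensity_uncurry β γ k).comp measurable_swap
  rw [Function.comp_def] at h
  exact h

/-- The Laplace transform of the tail `p` is `ψ(s) / s`. -/
lemma lintegral_exp_mul_ptsLevyMeasure_Ioi {β γ k s : ℝ} (hβ : 0 < β) (hγ0 : 0 < γ) (hγ1 : γ < 1)
    (hk : 0 < k) (hs : 0 < s) :
    ∫⁻ τ in Ioi (0 : ℝ), ENNReal.ofReal (Real.exp (-(s * τ))) * ptsLevyMeasure β γ k (Ioi τ)
      = ENNReal.ofReal (laplaceExponent (ptsLevyMeasure β γ k) s / s) := by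
  have hsf : SFinite (ptsLevyMeasure β γ k) := by unfold ptsLevyMeasure; infer_instance
  have h0 : ptsLevyMeasure β γ k (Iic 0) = 0 := by
    unfold ptsLevyMeasure
    rw [withDensity_apply _ measurableSet_Iic, Measure.restrict_restrict measurableSet_Iic,
      Iic_inter_Ioi, Ioc_self, Measure.restrict_empty, lintegral_zero_measure]
  exact lintegral_exp_mul_measure_Ioi _ h0 hs
    (integrable_one_sub_exp_ptsLevyMeasure hβ hγ0 hγ1 hk hs.le)

/-- The tail of the Lévy measure is integrable near `0`. -/
lemma setLIntegral_measure_Ioi_ne_top {β γ k : ℝ} (hβ : 0 < β) (hγ0 : 0 < γ) (hγ1 : γ < 1)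
    (hk : 0 < k) (N : ℝ) : ∫⁻ τ in Ioo 0 N, ptsLevyMeasure β γ k (Ioi τ) ≠ ⊤ := by
  have h := lintegral_exp_mul_ptsLevyMeasure_Ioi hβ hγ0 hγ1 hk one_pos
  have hle : ∫⁻ τ in Ioo 0 N, ptsLevyMeasure β γ k (Ioi τ)
      ≤ ENNReal.ofReal (Real.exp N) * ∫⁻ τ in Ioi (0 : ℝ),
        ENNReal.ofReal (Real.exp (-(1 * τ))) * ptsLevyMeasure β γ k (Ioi τ) := by
    rw [← lintegral_const_mul _ (by have := measurable_measure_Ioi (ptsLevyMeasure β γ k); fun_prop)]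
    refine le_trans (setLIntegral_mono' measurableSet_Ioo fun τ hτ => ?_)
      (lintegral_mono_set Ioo_subset_Ioi_self)
    rw [← mul_assoc, ← ENNReal.ofReal_mul (Real.exp_pos _).le, ← Real.exp_add]
    refine le_mul_of_one_le_left zero_le ?_
    rw [ENNReal.one_le_ofReal, Real.one_le_exp_iff]
    linarith [hτ.2]
  refine ne_top_of_le_ne_top ?_ hle
  rw [h]
  exact ENNReal.mul_ne_top ENNReal.ofReal_ne_top ENNReal.ofReal_ne_top

section Family

variable {β γ k : ℝ} {μ : ℝ → Measure ℝ} [∀ x, IsProbabilityMeasure (μ x)]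

/-! In this section `μ x` is the law of `X_x`, and `h` denotes `ptsExitDensity`. -/

/-- The Laplace transform of the convolution `h(y, ·)` is `ψ(s) / s * e^(-y ψ(s))`. -/
lemma lintegral_exp_mul_ptsExitDensity (hβ : 0 < β) (hγ0 : 0 < γ) (hγ1 : γ < 1) (hk : 0 < k)
    (hμ : ∀ x, ∀ᵐ u ∂μ x, 0 ≤ u)
    (hL : ∀ x, 0 ≤ x → ∀ z : ℝ, 0 ≤ z → ∫ u, Real.exp (-(z * u)) ∂μ x
      = Real.exp (-(x * laplaceExponent (ptsLevyMeasure β γ k) z)))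
    {y s : ℝ} (hy : 0 < y) (hs : 0 < s) :
    ∫⁻ t, ENNReal.ofReal (Real.exp (-(s * t))) * ptsExitDensity β γ k y t
      = ENNReal.ofReal (laplaceExponent (ptsLevyMeasure β γ k) s / s)
        * ENNReal.ofReal (Real.exp (-(y * laplaceExponent (ptsLevyMeasure β γ k) s))) := by
  have hcont := continuous_ptsDensity hβ hγ0 hγ1 hk hy
  have hm := measurable_measure_Ioi (ptsLevyMeasure β γ k)
  have hmq : Measurable (ptsDensity β γ k y) := hcont.measurable
  have h1 : ∀ t, ENNReal.ofReal (Real.exp (-(s * t))) * ptsExitDensity β γ k y t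
      = ∫⁻ τ in Ioi (0 : ℝ), ENNReal.ofReal (Real.exp (-(s * t))) *
        (ptsLevyMeasure β γ k (Ioi τ) * ENNReal.ofReal (ptsDensity β γ k y (t - τ))) := by
    intro t
    rw [lintegral_const_mul _ (by fun_prop)]
    rfl
  simp_rw [h1]
  rw [lintegral_lintegral_swap]
  swap
  · refine Measurable.aemeasurable (Measurable.mul (by fun_prop) (Measurable.mul ?_ ?_))
    · exact hm.comp measurable_snd
    · exact (hmq.comp (show Measurable fun z : ℝ × ℝ => z.1 - z.2 by fun_prop)).ennreal_ofReal
  have h2 : ∀ τ : ℝ, ∫⁻ t, ENNReal.ofReal (Real.exp (-(s * t))) *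
        (ptsLevyMeasure β γ k (Ioi τ) * ENNReal.ofReal (ptsDensity β γ k y (t - τ)))
      = ENNReal.ofReal (Real.exp (-(s * τ))) * ptsLevyMeasure β γ k (Ioi τ)
        * ENNReal.ofReal (Real.exp (-(y * laplaceExponent (ptsLevyMeasure β γ k) s))) := by
    intro τ
    rw [← lintegral_exp_mul_ptsDensity hβ hγ0 hγ1 hk hy (hμ y) (hL y hy.le) hs.le,
      ← lintegral_const_mul _ (by fun_prop),
      ← lintegral_sub_right_eq_self (fun u => ENNReal.ofReal (Real.exp (-(s * τ))) *
        ptsLevyMeasure β γ k (Ioi τ) * (ENNReal.ofReal (Real.exp (-(s * u))) *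
          ENNReal.ofReal (ptsDensity β γ k y u))) τ]
    refine lintegral_congr fun t => ?_
    have : Real.exp (-(s * t)) = Real.exp (-(s * τ)) * Real.exp (-(s * (t - τ))) := by
      rw [← Real.exp_add]; congr 1; ring
    rw [this, ENNReal.ofReal_mul (Real.exp_pos _).le]
    ring
  simp_rw [h2]
  rw [lintegral_mul_const _ (by fun_prop), lintegral_exp_mul_ptsLevyMeasure_Ioi hβ hγ0 hγ1 hk hs]

lemma setLIntegral_ofReal_exp {a b c : ℝ} (hab : a ≤ b) (hc : 0 < c) :
    ∫⁻ y in Ioc a b, ENNReal.ofReal (Real.exp (-(y * c)))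
      = ENNReal.ofReal ((Real.exp (-(a * c)) - Real.exp (-(b * c))) / c) := by
  rw [← ofReal_integral_eq_lintegral_ofReal
    ((Continuous.integrableOn_Icc (by fun_prop)).mono_set Ioc_subset_Icc_self)
    (Filter.Eventually.of_forall fun x => (Real.exp_pos _).le),
    ← intervalIntegral.integral_of_le hab]
  have h : ∀ v ∈ uIcc a b, HasDerivAt (fun v => -Real.exp (-(v * c)) / c)
      (Real.exp (-(v * c))) v := by
    intro v _
    have := ((((hasDerivAt_id v).mul_const c).neg).exp.neg).div_const c
    convert! this using 1
    simp; field_simp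
  rw [intervalIntegral.integral_eq_sub_of_hasDerivAt h
    (by apply Continuous.intervalIntegrable; fun_prop)]
  congr 1; ring

/-- The Laplace transform of `∫ₐᵇ h(y, ·) dy`: the factor `ψ(s)` cancels on integrating
`e^(-y ψ(s))` over `y`. -/
lemma lintegral_exp_mul_setLIntegral_ptsExitDensity (hβ : 0 < β) (hγ0 : 0 < γ) (hγ1 : γ < 1)
    (hk : 0 < k) (hμ : ∀ x, ∀ᵐ u ∂μ x, 0 ≤ u)
    (hL : ∀ x, 0 ≤ x → ∀ z : ℝ, 0 ≤ z → ∫ u, Real.exp (-(z * u)) ∂μ x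
      = Real.exp (-(x * laplaceExponent (ptsLevyMeasure β γ k) z)))
    {a b s : ℝ} (ha : 0 < a) (hab : a ≤ b) (hs : 0 < s) :
    ∫⁻ t, ENNReal.ofReal (Real.exp (-(s * t))) * ∫⁻ y in Ioc a b, ptsExitDensity β γ k y t
      = ENNReal.ofReal ((Real.exp (-(a * laplaceExponent (ptsLevyMeasure β γ k) s))
        - Real.exp (-(b * laplaceExponent (ptsLevyMeasure β γ k) s))) / s) := by
  have h1 : ∀ t, ENNReal.ofReal (Real.exp (-(s * t))) * ∫⁻ y in Ioc a b, ptsExitDensity β γ k y t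
      = ∫⁻ y in Ioc a b, ENNReal.ofReal (Real.exp (-(s * t))) * ptsExitDensity β γ k y t := by
    intro t
    rw [lintegral_const_mul _ (measurable_ptsExitDensity_left β γ k t)]
  simp_rw [h1]
  rw [lintegral_lintegral_swap]
  swap
  · have hm := measurable_ptsExitDensity_swap β γ k
    exact Measurable.aemeasurable (Measurable.mul (by fun_prop) hm)
  have hψ := laplaceExponent_ptsLevyMeasure_pos hβ hγ0 hγ1 hk hs
  rw [setLIntegral_congr_fun measurableSet_Ioc fun y hy =>
    lintegral_exp_mul_ptsExitDensity hβ hγ0 hγ1 hk hμ hL (ha.trans hy.1) hs,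
    lintegral_const_mul _ (by fun_prop), setLIntegral_ofReal_exp hab hψ,
    ← ENNReal.ofReal_mul (by positivity)]
  congr 1
  field_simp

lemma continuous_setLIntegral_ptsExitDensity (hβ : 0 < β) (hγ0 : 0 < γ) (hγ1 : γ < 1)
    (hk : 0 < k) (hμ : ∀ x, ∀ᵐ u ∂μ x, 0 ≤ u)
    (hL : ∀ x, 0 ≤ x → ∀ z : ℝ, 0 ≤ z → ∫ u, Real.exp (-(z * u)) ∂μ x
      = Real.exp (-(x * laplaceExponent (ptsLevyMeasure β γ k) z)))
    {a b : ℝ} (ha : 0 < a) :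
    Continuous fun t => ∫⁻ y in Ioc a b, ptsExitDensity β γ k y t := by
  have hmπ := measurable_measure_Ioi (ptsLevyMeasure β γ k)
  obtain ⟨C, hC⟩ := exists_abs_ptsDensity_le hβ hγ0 hγ1 hk ha b
  refine continuous_iff_continuousAt.mpr fun t₀ => ?_
  have hev : ∀ᶠ t in nhds t₀, t < t₀ + 1 := gt_mem_nhds (by linarith)
  -- For `t < t₀ + 1` the convolution only involves `τ < t₀ + 1`, since `q(y, ·)` vanishes on the
  -- negative half-line.
  let G : ℝ → ENNReal := (Ioo 0 (t₀ + 1)).indicator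
    fun τ => ptsLevyMeasure β γ k (Ioi τ) * ENNReal.ofReal C
  have hGfin : ∫⁻ τ in Ioi (0 : ℝ), G τ ≠ ⊤ := by
    refine ne_top_of_le_ne_top ?_ (setLIntegral_le_lintegral _ _)
    rw [lintegral_indicator measurableSet_Ioo, lintegral_mul_const _ hmπ]
    exact ENNReal.mul_ne_top (setLIntegral_measure_Ioi_ne_top hβ hγ0 hγ1 hk _)
      ENNReal.ofReal_ne_top
  have hG : ∀ y ∈ Ioc a b, ∀ t < t₀ + 1, ∀ τ ∈ Ioi (0 : ℝ), ptsLevyMeasure β γ k (Ioi τ) *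
      ENNReal.ofReal (ptsDensity β γ k y (t - τ)) ≤ G τ := by
    intro y hy t ht τ hτ
    by_cases hlt : τ < t₀ + 1
    · have : G τ = ptsLevyMeasure β γ k (Ioi τ) * ENNReal.ofReal C :=
        indicator_of_mem (show τ ∈ Ioo 0 (t₀ + 1) from ⟨hτ, hlt⟩) _
      rw [this]
      gcongr
      exact (le_abs_self _).trans (hC y (Ioc_subset_Icc_self hy) _)
    · have hy0 : 0 < y := ha.trans hy.1
      rw [ptsDensity_eq_zero hβ hγ0 hγ1 hk hy0 (hμ y) (hL y hy0.le) (by linarith)]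
      simp
  refine tendsto_lintegral_filter_of_dominated_convergence (fun _ => ∫⁻ τ in Ioi (0 : ℝ), G τ)
    (Filter.Eventually.of_forall fun t => measurable_ptsExitDensity_left β γ k t)
    ?_ ?_ ?_
  · filter_upwards [hev] with t ht
    refine (ae_restrict_iff' measurableSet_Ioc).mpr (Filter.Eventually.of_forall fun y hy => ?_)
    exact setLIntegral_mono' measurableSet_Ioi fun τ hτ => hG y hy t ht τ hτ
  · rw [lintegral_const]
    exact ENNReal.mul_ne_top hGfin (by simp)
  · refine (ae_restrict_iff' measurableSet_Ioc).mpr (Filter.Eventually.of_forall fun y hy => ?_)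
    have hcont := continuous_ptsDensity hβ hγ0 hγ1 hk (ha.trans hy.1)
    have hmq : Measurable (ptsDensity β γ k y) := hcont.measurable
    refine tendsto_lintegral_filter_of_dominated_convergence G
      (Filter.Eventually.of_forall fun t => by fun_prop) ?_ hGfin ?_
    · filter_upwards [hev] with t ht
      exact (ae_restrict_iff' measurableSet_Ioi).mpr (Filter.Eventually.of_forall (hG y hy t ht))
    · refine (ae_restrict_iff' measurableSet_Ioi).mpr (Filter.Eventually.of_forall fun τ hτ => ?_)
      refine ENNReal.Tendsto.const_mul ?_ (Or.inr ?_)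
      · exact ((ENNReal.continuous_ofReal.comp (hcont.comp (continuous_sub_right τ))).tendsto t₀)
      · rw [ptsLevyMeasure_Ioi hβ hγ0 hγ1 hk hτ]; exact ENNReal.ofReal_ne_top

lemma ptsExitDensity_eq_zero (hβ : 0 < β) (hγ0 : 0 < γ) (hγ1 : γ < 1)
    (hk : 0 < k) (hμ : ∀ x, ∀ᵐ u ∂μ x, 0 ≤ u)
    (hL : ∀ x, 0 ≤ x → ∀ z : ℝ, 0 ≤ z → ∫ u, Real.exp (-(z * u)) ∂μ x
      = Real.exp (-(x * laplaceExponent (ptsLevyMeasure β γ k) z)))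
    {y t : ℝ} (hy : 0 < y) (ht : t < 0) : ptsExitDensity β γ k y t = 0 := by
  unfold ptsExitDensity
  rw [setLIntegral_congr_fun (g := fun _ => 0) measurableSet_Ioi fun τ hτ => ?_]
  · simp
  · beta_reduce
    rw [ptsDensity_eq_zero hβ hγ0 hγ1 hk hy (hμ y) (hL y hy.le) (by linarith [mem_Ioi.mp hτ])]
    simp

/-- `∂ₓ P(X_x ≤ t) = -h(x, t)` in integrated form. Both sides have the same Laplace transform in
`t`, and are continuous in `t`. -/
lemma setLIntegral_ptsExitDensity_add (hβ : 0 < β) (hγ0 : 0 < γ) (hγ1 : γ < 1)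
    (hk : 0 < k) (hμ : ∀ x, ∀ᵐ u ∂μ x, 0 ≤ u)
    (hL : ∀ x, 0 ≤ x → ∀ z : ℝ, 0 ≤ z → ∫ u, Real.exp (-(z * u)) ∂μ x
      = Real.exp (-(x * laplaceExponent (ptsLevyMeasure β γ k) z)))
    {a b : ℝ} (ha : 0 < a) (hab : a ≤ b) (t : ℝ) :
    (∫⁻ y in Ioc a b, ptsExitDensity β γ k y t) + μ b (Iic t) = μ a (Iic t) := by
  have hb := ha.trans_le hab
  have hmI : ∀ x, Measurable fun t => μ x (Iic t) := fun x =>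
    Monotone.measurable fun _ _ h => measure_mono (Iic_subset_Iic.mpr h)
  have hmE : Measurable fun t => ∫⁻ y in Ioc a b, ptsExitDensity β γ k y t :=
    (continuous_setLIntegral_ptsExitDensity hβ hγ0 hγ1 hk hμ hL ha).measurable
  have hI0 : ∀ x, ∀ t < 0, μ x (Iic t) = 0 := by
    intro x t ht
    refine measure_mono_null (fun u hu => ?_) (ae_iff.mp (hμ x))
    simpa using lt_of_le_of_lt hu ht
  have hna : ∀ x, 0 < x → NullSingletonClass (μ x) := fun x hx => by
    rw [eq_withDensity_ptsDensity hβ hγ0 hγ1 hk hx (hμ x) (hL x hx.le)]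
    infer_instance
  have hLa : ∀ s : ℝ, 0 < s → ∫⁻ t, ENNReal.ofReal (Real.exp (-(s * t))) * μ a (Iic t)
      = ENNReal.ofReal (Real.exp (-(a * laplaceExponent (ptsLevyMeasure β γ k) s)) / s) :=
    fun s hs => by rw [lintegral_exp_mul_measure_Iic (hμ a) hs, hL a ha.le s hs.le]
  have hLs : ∀ s : ℝ, 0 < s → ∫⁻ t, ENNReal.ofReal (Real.exp (-(s * t))) *
      ((∫⁻ y in Ioc a b, ptsExitDensity β γ k y t) + μ b (Iic t))
      = ENNReal.ofReal (Real.exp (-(a * laplaceExponent (ptsLevyMeasure β γ k) s)) / s) := by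
    intro s hs
    have hψ := laplaceExponent_ptsLevyMeasure_pos hβ hγ0 hγ1 hk hs
    simp_rw [mul_add]
    rw [lintegral_add_left (by fun_prop),
      lintegral_exp_mul_setLIntegral_ptsExitDensity hβ hγ0 hγ1 hk hμ hL ha hab hs,
      lintegral_exp_mul_measure_Iic (hμ b) hs, hL b hb.le s hs.le, ← ENNReal.ofReal_add]
    · congr 1; ring
    · refine div_nonneg (sub_nonneg.mpr (Real.exp_le_exp.mpr ?_)) hs.le
      nlinarith
    · positivity
  have hae := ae_eq_of_lintegral_exp_mul_eq (hmE.add (hmI b)) (hmI a) (fun t ht => by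
      simp only [Pi.add_apply]
      rw [hI0 b t ht, setLIntegral_congr_fun (g := fun _ => 0) measurableSet_Ioc fun y hy =>
        ptsExitDensity_eq_zero hβ hγ0 hγ1 hk hμ hL (ha.trans hy.1) ht]
      simp) (hI0 a)
    (fun s hs => by simp only [Pi.add_apply]; rw [hLs s hs]; exact ENNReal.ofReal_ne_top)
    (fun s hs => by simp only [Pi.add_apply]; rw [hLs s hs, hLa s hs])
  have := hna a ha
  have := hna b hb
  have := (Continuous.ae_eq_iff_eq volume
    ((continuous_setLIntegral_ptsExitDensity hβ hγ0 hγ1 hk hμ hL ha).add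
      (continuous_measure_Iic (μ b))) (continuous_measure_Iic (μ a))).mp hae
  exact congrFun this t

/-- The limit `a → 0` of `setLIntegral_ptsExitDensity_add`: `∫₀ᵇ h(y, t) dy = P(X_b > t)`. -/
lemma setLIntegral_ptsExitDensity_zero (hβ : 0 < β) (hγ0 : 0 < γ) (hγ1 : γ < 1)
    (hk : 0 < k) (hμ : ∀ x, ∀ᵐ u ∂μ x, 0 ≤ u)
    (hL : ∀ x, 0 ≤ x → ∀ z : ℝ, 0 ≤ z → ∫ u, Real.exp (-(z * u)) ∂μ x
      = Real.exp (-(x * laplaceExponent (ptsLevyMeasure β γ k) z)))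
    {b t : ℝ} (hb : 0 < b) (ht : 0 < t) :
    ∫⁻ y in Ioc 0 b, ptsExitDensity β γ k y t = μ b (Ioi t) := by
  -- `X_a → 0` in probability as `a → 0`, by Markov's inequality for `1 - exp(-X_a)`
  let a : ℕ → ℝ := fun n => b * (1 / ((n : ℝ) + 1))
  have ha0 : ∀ n, 0 < a n := fun n => by positivity
  have hab : ∀ n, a n ≤ b := fun n => by
    refine mul_le_of_le_one_right hb.le ?_
    rw [div_le_one (by positivity)]
    linarith [(Nat.cast_nonneg n : (0 : ℝ) ≤ n)]
  have ha : Filter.Tendsto a Filter.atTop (nhds 0) := by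
    simpa only [mul_zero] using (tendsto_one_div_add_atTop_nhds_zero_nat (𝕜 := ℝ)).const_mul b
  set ψ := laplaceExponent (ptsLevyMeasure β γ k) 1 with hψ
  have hlow : ∀ n, (μ (a n)).real (Iic t) ≥ 1 - (1 - Real.exp (-(a n * ψ))) / (1 - Real.exp (-t)) := by
    intro n
    have hE := hL (a n) (ha0 n).le 1 zero_le_one
    simp only [one_mul] at hE
    have hint : Integrable (fun u => Real.exp (-u)) (μ (a n)) := by
      simpa using integrable_exp_neg_mul_of_ae_nonneg (hμ (a n)) (zero_le_one)
    have hpos : 0 < 1 - Real.exp (-t) := by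
      have : Real.exp (-t) < 1 := Real.exp_lt_one_iff.mpr (by linarith)
      linarith
    have hM := mul_meas_ge_le_integral_of_nonneg (μ := μ (a n)) (f := fun u => 1 - Real.exp (-u))
      (by filter_upwards [hμ (a n)] with u hu
          have : Real.exp (-u) ≤ 1 := Real.exp_le_one_iff.mpr (by linarith)
          simpa using this) ((integrable_const 1).sub hint) (1 - Real.exp (-t))
    rw [integral_sub (integrable_const 1) hint, hE] at hM
    simp only [integral_const, probReal_univ, smul_eq_mul, mul_one] at hM
    have hc : (μ (a n)).real (Iic t) = 1 - (μ (a n)).real (Ioi t) := by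
      rw [← compl_Iic, probReal_compl_eq_one_sub measurableSet_Iic]; ring
    have hsub : (μ (a n)).real (Ioi t)
        ≤ (μ (a n)).real {x | 1 - Real.exp (-t) ≤ 1 - Real.exp (-x)} := by
      refine measureReal_mono fun u hu => ?_
      have : Real.exp (-u) ≤ Real.exp (-t) := Real.exp_le_exp.mpr (by linarith [mem_Ioi.mp hu])
      show 1 - Real.exp (-t) ≤ 1 - Real.exp (-u)
      linarith
    rw [hc]
    have : (μ (a n)).real (Ioi t) ≤ (1 - Real.exp (-(a n * ψ))) / (1 - Real.exp (-t)) := by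
      rw [le_div_iff₀ hpos, mul_comm]
      exact (mul_le_mul_of_nonneg_left hsub hpos.le).trans hM
    linarith
  have hlim1 : Filter.Tendsto (fun n => μ (a n) (Iic t)) Filter.atTop (nhds 1) := by
    have h1 : Filter.Tendsto (fun n => 1 - (1 - Real.exp (-(a n * ψ))) / (1 - Real.exp (-t)))
        Filter.atTop (nhds 1) := by
      have h2 : Filter.Tendsto (fun n => Real.exp (-(a n * ψ))) Filter.atTop (nhds 1) := by
        have := (Real.continuous_exp.tendsto _).comp ((ha.mul_const ψ).neg)
        simpa [Function.comp_def] using this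
      simpa using (((h2.const_sub 1).div_const (1 - Real.exp (-t))).const_sub 1)
    have h3 : Filter.Tendsto (fun n => (μ (a n)).real (Iic t)) Filter.atTop (nhds 1) :=
      tendsto_of_tendsto_of_tendsto_of_le_of_le h1 tendsto_const_nhds hlow
        fun n => measureReal_le_one
    have h4 := ENNReal.tendsto_ofReal h3
    simpa [ofReal_measureReal] using h4
  have hlim2 : Filter.Tendsto (fun n => ∫⁻ y in Ioc (a n) b, ptsExitDensity β γ k y t)
      Filter.atTop (nhds (∫⁻ y in Ioc 0 b, ptsExitDensity β γ k y t)) := by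
    have hU : ⋃ n, Ioc (a n) b = Ioc 0 b := by
      ext y
      simp only [mem_iUnion, mem_Ioc]
      constructor
      · rintro ⟨n, h1, h2⟩; exact ⟨(ha0 n).trans h1, h2⟩
      · rintro ⟨h1, h2⟩
        obtain ⟨n, hn⟩ := (ha.eventually_lt_const h1).exists
        exact ⟨n, hn, h2⟩
    have hmono : Monotone fun n => Ioc (a n) b := by
      intro n m hnm
      refine Ioc_subset_Ioc_left (mul_le_mul_of_nonneg_left ?_ hb.le)
      exact one_div_le_one_div_of_le (by positivity) (by gcongr)
    have := tendsto_measure_iUnion_atTop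
      (μ := volume.withDensity fun y => ptsExitDensity β γ k y t) hmono
    rw [hU] at this
    simpa [Function.comp_def, withDensity_apply] using this
  have hsum : Filter.Tendsto (fun n => (∫⁻ y in Ioc (a n) b, ptsExitDensity β γ k y t) + μ b (Iic t))
      Filter.atTop (nhds ((∫⁻ y in Ioc 0 b, ptsExitDensity β γ k y t) + μ b (Iic t))) :=
    hlim2.add tendsto_const_nhds
  simp_rw [setLIntegral_ptsExitDensity_add hβ hγ0 hγ1 hk hμ hL (ha0 _) (hab _)] at hsum
  have heq := tendsto_nhds_unique hsum hlim1
  have h2 : μ b (Ioi t) + μ b (Iic t) = 1 := by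
    rw [← compl_Iic, add_comm, prob_add_prob_compl measurableSet_Iic]
  rw [← h2] at heq
  exact (ENNReal.add_left_inj (measure_ne_top _ _)).mp heq

end Family

/-! ### The law of the first-exit time -/

lemma aemeasurable_ptsP {β γ k : ℝ} (hβ : 0 < β) (hγ0 : 0 < γ) (hγ1 : γ < 1) (hk : 0 < k) :
    AEMeasurable (ptsP β γ k) (volume.restrict (Ioi 0)) := by
  refine ⟨fun τ => (ptsLevyMeasure β γ k (Ioi τ)).toReal, (measurable_measure_Ioi _).ennreal_toReal,
    (ae_restrict_iff' measurableSet_Ioi).mpr (Filter.Eventually.of_forall fun τ hτ => ?_)⟩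
  beta_reduce
  rw [ptsLevyMeasure_Ioi hβ hγ0 hγ1 hk hτ,
    ENNReal.toReal_ofReal (ptsP_nonneg hβ hγ0 hγ1 (le_of_lt hτ))]

lemma integrableOn_ptsP {β γ k : ℝ} (hβ : 0 < β) (hγ0 : 0 < γ) (hγ1 : γ < 1) (hk : 0 < k) (N : ℝ) :
    IntegrableOn (ptsP β γ k) (Ioc 0 N) := by
  rw [integrableOn_Ioc_iff_integrableOn_Ioo]
  refine (lintegral_ofReal_ne_top_iff_integrable
    ((aemeasurable_ptsP hβ hγ0 hγ1 hk).mono_measure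
      (Measure.restrict_mono Ioo_subset_Ioi_self le_rfl)).aestronglyMeasurable
    ((ae_restrict_iff' measurableSet_Ioo).mpr (Filter.Eventually.of_forall fun τ hτ =>
      ptsP_nonneg hβ hγ0 hγ1 hτ.1.le))).mp ?_
  rw [setLIntegral_congr_fun measurableSet_Ioo fun τ hτ =>
    (ptsLevyMeasure_Ioi hβ hγ0 hγ1 hk hτ.1).symm]
  exact setLIntegral_measure_Ioi_ne_top hβ hγ0 hγ1 hk N

lemma intervalIntegrable_ptsP_mul_ptsDensity {β γ k x t : ℝ} (hβ : 0 < β) (hγ0 : 0 < γ)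
    (hγ1 : γ < 1) (hk : 0 < k) (hx : 0 < x) (ht : 0 < t) :
    IntervalIntegrable (fun τ => ptsP β γ k τ * ptsDensity β γ k x (t - τ)) volume 0 t := by
  rw [intervalIntegrable_iff_integrableOn_Ioc_of_le ht.le]
  obtain ⟨C, hC⟩ := exists_abs_ptsDensity_le hβ hγ0 hγ1 hk hx x
  have hcont := continuous_ptsDensity hβ hγ0 hγ1 hk hx
  refine Integrable.mul_bdd (c := C) (integrableOn_ptsP hβ hγ0 hγ1 hk t)
    (Continuous.aestronglyMeasurable (by fun_prop)) (Filter.Eventually.of_forall fun τ => ?_)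
  exact hC x (by simp) _

/-- For `t > 0` the convolution over `(0, t)` is the one over `(0, ∞)`, since `q(x, ·)` vanishes on the
negative half-line. -/
lemma ofReal_laplaceConv_eq_ptsExitDensity {β γ k x t : ℝ} {μ : Measure ℝ} [IsFiniteMeasure μ]
    (hβ : 0 < β) (hγ0 : 0 < γ) (hγ1 : γ < 1) (hk : 0 < k) (hx : 0 < x) (hμ : ∀ᵐ u ∂μ, 0 ≤ u)
    (hL : ∀ z : ℝ, 0 ≤ z → ∫ u, Real.exp (-(z * u)) ∂μ
      = Real.exp (-(x * laplaceExponent (ptsLevyMeasure β γ k) z))) (ht : 0 < t) :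
    ENNReal.ofReal (laplaceConv (ptsP β γ k) (ptsDensity β γ k x) t) = ptsExitDensity β γ k x t := by
  have hnn := ptsDensity_nonneg hβ hγ0 hγ1 hk hx hμ hL
  have hint := intervalIntegrable_ptsP_mul_ptsDensity (t := t) hβ hγ0 hγ1 hk hx ht
  rw [intervalIntegrable_iff_integrableOn_Ioc_of_le ht.le] at hint
  unfold laplaceConv ptsExitDensity
  rw [intervalIntegral.integral_of_le ht.le, ofReal_integral_eq_lintegral_ofReal hint
    ((ae_restrict_iff' measurableSet_Ioc).mpr (Filter.Eventually.of_forall fun τ hτ =>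
      mul_nonneg (ptsP_nonneg hβ hγ0 hγ1 hτ.1.le) (hnn _)))]
  rw [← Ioc_union_Ioi_eq_Ioi ht.le, lintegral_union measurableSet_Ioi (Ioc_disjoint_Ioi le_rfl),
    setLIntegral_congr_fun (g := fun _ => 0) measurableSet_Ioi fun τ hτ => ?_]
  · rw [lintegral_zero, add_zero]
    refine setLIntegral_congr_fun measurableSet_Ioc fun τ hτ => ?_
    rw [ENNReal.ofReal_mul (ptsP_nonneg hβ hγ0 hγ1 hτ.1.le),
      ptsLevyMeasure_Ioi hβ hγ0 hγ1 hk hτ.1]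
  · rw [ptsDensity_eq_zero hβ hγ0 hγ1 hk hx hμ hL (by linarith [mem_Ioi.mp hτ])]
    simp

/-- For a nondecreasing right-continuous path started below the level `t`, the first-exit time is
at most `x` exactly when the path has reached `t` at time `x`. -/
lemma sInf_le_iff_le_of_monotone {f : ℝ≥0 → ℝ} (hm : Monotone f)
    (hc : ∀ s, ContinuousWithinAt f (Ici s) s) {t : ℝ} (h0 : f 0 < t) (hex : ∃ τ : ℝ≥0, t ≤ f τ)
    (x : ℝ≥0) :
    sInf ((fun τ : ℝ≥0 => (τ : ℝ)) '' {τ : ℝ≥0 | 0 < τ ∧ t ≤ f τ}) ≤ x ↔ t ≤ f x := by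
  have hpos : ∀ τ, t ≤ f τ → 0 < τ := fun τ hτ => by
    rcases eq_or_lt_of_le (zero_le (a := τ)) with h | h
    · rw [← h] at hτ; linarith
    · exact h
  have hbdd : BddBelow ((fun τ : ℝ≥0 => (τ : ℝ)) '' {τ : ℝ≥0 | 0 < τ ∧ t ≤ f τ}) :=
    ⟨0, by rintro _ ⟨τ, _, rfl⟩; exact τ.2⟩
  obtain ⟨τ₀, hτ₀⟩ := hex
  have hne : ((fun τ : ℝ≥0 => (τ : ℝ)) '' {τ : ℝ≥0 | 0 < τ ∧ t ≤ f τ}).Nonempty :=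
    ⟨_, τ₀, ⟨hpos _ hτ₀, hτ₀⟩, rfl⟩
  constructor
  · intro hle
    have hlim : Filter.Tendsto f (nhdsWithin x (Ioi x)) (nhds (f x)) :=
      (hc x).mono Ioi_subset_Ici_self
    refine ge_of_tendsto hlim ?_
    filter_upwards [self_mem_nhdsWithin] with y hy
    obtain ⟨_, ⟨τ, hτ, rfl⟩, hlt⟩ := exists_lt_of_csInf_lt hne
      (lt_of_le_of_lt hle (NNReal.coe_lt_coe.mpr (mem_Ioi.mp hy)))
    exact hτ.2.trans (hm (NNReal.coe_lt_coe.mp hlt).le)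
  · intro hle
    exact csInf_le hbdd ⟨x, ⟨hpos _ hle, hle⟩, rfl⟩

section FirstExit

variable {Ω : Type*} [MeasurableSpace Ω] {P : Measure Ω}
  {β γ k : ℝ} {X : ℝ≥0 → Ω → ℝ}

lemma IsSubordinator.ae_map_nonneg (hX : IsSubordinator X P) (s : ℝ≥0) :
    ∀ᵐ u ∂(P.map (X s)), 0 ≤ u := by
  rw [ae_map_iff (hX.aemeasurable s) measurableSet_Ici]
  filter_upwards [hX.paths, hX.start_zero] with ω h1 h2
  rw [← h2]; exact h1.1 zero_le

lemma HasLevyMeasure.integral_exp_map (hX : IsSubordinator X P)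
    (hXL : HasLevyMeasure X P (ptsLevyMeasure β γ k)) {x : ℝ} (hx : 0 ≤ x) {z : ℝ} (hz : 0 ≤ z) :
    ∫ u, Real.exp (-(z * u)) ∂(P.map (X x.toNNReal))
      = Real.exp (-(x * laplaceExponent (ptsLevyMeasure β γ k) z)) := by
  rw [integral_map (hX.aemeasurable _) (by fun_prop), hXL.2.2 _ z hz, Real.coe_toNNReal x hx]

variable [IsProbabilityMeasure P]

/-- Almost every path exceeds every level, since `P(X_n < t) ≤ e^t E[e^(-X_n)] = e^(t - n ψ(1))`. -/
lemma ae_exists_le_of_hasLevyMeasure (hβ : 0 < β) (hγ0 : 0 < γ) (hγ1 : γ < 1) (hk : 0 < k)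
    (hX : IsSubordinator X P) (hXL : HasLevyMeasure X P (ptsLevyMeasure β γ k)) (t : ℝ) :
    ∀ᵐ ω ∂P, ∃ τ : ℝ≥0, t ≤ X τ ω := by
  set ψ := laplaceExponent (ptsLevyMeasure β γ k) 1 with hψdef
  have hψ : 0 < ψ := laplaceExponent_ptsLevyMeasure_pos hβ hγ0 hγ1 hk one_pos
  have hb : ∀ n : ℕ, P.real {ω | ¬ ∃ τ : ℝ≥0, t ≤ X τ ω} ≤ Real.exp t * Real.exp (-(n * ψ)) := by
    intro n
    have hE := hXL.2.2 n 1 zero_le_one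
    simp only [one_mul, NNReal.coe_natCast] at hE
    have hint : Integrable (fun ω => Real.exp (-X n ω)) P := by
      have hm := hX.aemeasurable n
      refine Integrable.of_bound (Real.measurable_exp.comp_aemeasurable hm.neg).aestronglyMeasurable
        1 ?_
      filter_upwards [hX.paths, hX.start_zero] with ω h1 h2
      rw [Real.norm_of_nonneg (Real.exp_pos _).le, Real.exp_le_one_iff]
      have := h1.1 (zero_le (a := (n : ℝ≥0)))
      simp only [h2] at this
      linarith
    have hM := mul_meas_ge_le_integral_of_nonneg (μ := P)
      (Filter.Eventually.of_forall fun ω => (Real.exp_pos (-X n ω)).le) hint (Real.exp (-t))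
    rw [hE] at hM
    have hsub : P.real {ω | ¬ ∃ τ : ℝ≥0, t ≤ X τ ω}
        ≤ P.real {ω | Real.exp (-t) ≤ Real.exp (-X n ω)} := by
      refine measureReal_mono fun ω hω => ?_
      have h : X n ω < t := by
        by_contra! h
        exact hω ⟨n, h⟩
      exact Real.exp_le_exp.mpr (by linarith)
    have h2 := (mul_le_mul_of_nonneg_left hsub (Real.exp_pos (-t)).le).trans hM
    calc _ = Real.exp t * (Real.exp (-t) * P.real {ω | ¬ ∃ τ : ℝ≥0, t ≤ X τ ω}) := by
            rw [← mul_assoc, ← Real.exp_add]; simp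
      _ ≤ _ := mul_le_mul_of_nonneg_left h2 (Real.exp_pos t).le
  have hlim : Filter.Tendsto (fun n : ℕ => Real.exp t * Real.exp (-(n * ψ))) Filter.atTop (nhds 0) := by
    have h1 : Filter.Tendsto (fun n : ℕ => -((n : ℝ) * ψ)) Filter.atTop Filter.atBot :=
      Filter.tendsto_neg_atTop_atBot.comp (tendsto_natCast_atTop_atTop.atTop_mul_const hψ)
    have h2 := (Real.tendsto_exp_atBot.comp h1).const_mul (Real.exp t)
    simpa [Function.comp_def] using h2
  have h0 : P.real {ω | ¬ ∃ τ : ℝ≥0, t ≤ X τ ω} ≤ 0 := ge_of_tendsto' hlim hb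
  rw [ae_iff, ← measureReal_eq_zero_iff]
  exact le_antisymm h0 measureReal_nonneg

lemma ae_firstExitTime_le_iff (hβ : 0 < β) (hγ0 : 0 < γ) (hγ1 : γ < 1) (hk : 0 < k)
    (hX : IsSubordinator X P) (hXL : HasLevyMeasure X P (ptsLevyMeasure β γ k)) {t : ℝ}
    (ht : 0 < t) :
    ∀ᵐ ω ∂P, ∀ x : ℝ≥0, firstExitTime X t ω ≤ x ↔ t ≤ X x ω := by
  filter_upwards [hX.paths, hX.start_zero, ae_exists_le_of_hasLevyMeasure hβ hγ0 hγ1 hk hX hXL t]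
    with ω h1 h2 h3
  exact sInf_le_iff_le_of_monotone h1.1 h1.2 (by rw [h2]; exact ht) h3

/-- Right-continuity at `0` keeps the path below the level `t > 0` for some time. -/
lemma ae_firstExitTime_pos (hβ : 0 < β) (hγ0 : 0 < γ) (hγ1 : γ < 1) (hk : 0 < k)
    (hX : IsSubordinator X P) (hXL : HasLevyMeasure X P (ptsLevyMeasure β γ k)) {t : ℝ}
    (ht : 0 < t) : ∀ᵐ ω ∂P, 0 < firstExitTime X t ω := by
  filter_upwards [ae_firstExitTime_le_iff hβ hγ0 hγ1 hk hX hXL ht, hX.start_zero] with ω h1 h2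
  have := h1 0
  rw [h2, NNReal.coe_zero] at this
  by_contra! h
  linarith [this.mp h]

/-- Up to null sets, `{T_t ≤ x}` is the event `{X_x ≥ t}` for `x > 0` and empty for `x ≤ 0`. -/
lemma firstExitTime_preimage_Iic_ae_eq (hβ : 0 < β) (hγ0 : 0 < γ) (hγ1 : γ < 1) (hk : 0 < k)
    (hX : IsSubordinator X P) (hXL : HasLevyMeasure X P (ptsLevyMeasure β γ k)) {t : ℝ}
    (ht : 0 < t) (x : ℝ) :
    firstExitTime X t ⁻¹' Iic x =ᵐ[P] (if 0 < x then X x.toNNReal ⁻¹' Ici t else ∅ : Set Ω) := by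
  filter_upwards [ae_firstExitTime_le_iff hβ hγ0 hγ1 hk hX hXL ht,
    ae_firstExitTime_pos hβ hγ0 hγ1 hk hX hXL ht] with ω h1 h2
  refine propext ?_
  show firstExitTime X t ω ≤ x ↔ ω ∈ (if 0 < x then X x.toNNReal ⁻¹' Ici t else ∅)
  split_ifs with hx
  · have := h1 x.toNNReal
    rwa [Real.coe_toNNReal x hx.le] at this
  · simp only [mem_empty_iff_false, iff_false, not_le]
    exact (not_lt.mp hx).trans_lt h2

/-- Measurability is not clear from the definition as an uncountable infimum, but the preimages of
half-lines are events up to null sets. -/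
lemma aemeasurable_firstExitTime (hβ : 0 < β) (hγ0 : 0 < γ) (hγ1 : γ < 1) (hk : 0 < k)
    (hX : IsSubordinator X P) (hXL : HasLevyMeasure X P (ptsLevyMeasure β γ k)) {t : ℝ}
    (ht : 0 < t) : AEMeasurable (firstExitTime X t) P := by
  have h : ∀ x : ℝ, NullMeasurableSet (firstExitTime X t ⁻¹' Iic x) P := by
    intro x
    refine NullMeasurableSet.congr ?_ (firstExitTime_preimage_Iic_ae_eq hβ hγ0 hγ1 hk hX hXL ht x).symm
    split_ifs
    · exact (hX.aemeasurable _).nullMeasurableSet_preimage measurableSet_Ici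
    · exact MeasurableSet.empty.nullMeasurableSet
  have hm : NullMeasurable (firstExitTime X t) P := by
    have : Measurable (show NullMeasurableSpace Ω P → ℝ from firstExitTime X t) :=
      measurable_of_Iic h
    exact fun s hs => this hs
  exact hm.aemeasurable

/-- The law of the first-exit time, by comparison of distribution functions. -/
lemma hasDensityOnPos_firstExitTime (hβ : 0 < β) (hγ0 : 0 < γ) (hγ1 : γ < 1) (hk : 0 < k)
    (hX : IsSubordinator X P) (hXL : HasLevyMeasure X P (ptsLevyMeasure β γ k)) {t : ℝ}
    (ht : 0 < t) :
    HasDensityOnPos (firstExitTime X t) P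
      fun x => laplaceConv (ptsP β γ k) (ptsDensity β γ k x) t := by
  have hprob : ∀ x : ℝ, IsProbabilityMeasure (P.map (X x.toNNReal)) := fun x =>
    Measure.isProbabilityMeasure_map (hX.aemeasurable _)
  have hμ : ∀ x : ℝ, ∀ᵐ u ∂(P.map (X x.toNNReal)), 0 ≤ u := fun x => hX.ae_map_nonneg _
  have hL : ∀ x : ℝ, 0 ≤ x → ∀ z : ℝ, 0 ≤ z → ∫ u, Real.exp (-(z * u)) ∂(P.map (X x.toNNReal))
      = Real.exp (-(x * laplaceExponent (ptsLevyMeasure β γ k) z)) :=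
    fun x hx z hz => hXL.integral_exp_map hX hx hz
  have hnn : ∀ x : ℝ, 0 < x → 0 ≤ laplaceConv (ptsP β γ k) (ptsDensity β γ k x) t := fun x hx =>
    intervalIntegral.integral_nonneg ht.le fun τ hτ => mul_nonneg (ptsP_nonneg hβ hγ0 hγ1 hτ.1)
      (ptsDensity_nonneg hβ hγ0 hγ1 hk hx (hμ x) (hL x hx.le) _)
  have hE : ∀ x : ℝ, 0 < x → ENNReal.ofReal (laplaceConv (ptsP β γ k) (ptsDensity β γ k x) t)
      = ptsExitDensity β γ k x t := fun x hx =>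
    ofReal_laplaceConv_eq_ptsExitDensity hβ hγ0 hγ1 hk hx (hμ x) (hL x hx.le) ht
  have hTm := aemeasurable_firstExitTime hβ hγ0 hγ1 hk hX hXL ht
  refine ⟨?_, hnn, hTm, ?_⟩
  · refine ⟨fun x => (ptsExitDensity β γ k x t).toReal,
      (measurable_ptsExitDensity_left β γ k t).ennreal_toReal,
      (ae_restrict_iff' measurableSet_Ioi).mpr (Filter.Eventually.of_forall fun x hx => ?_)⟩
    beta_reduce
    rw [← hE x hx, ENNReal.toReal_ofReal (hnn x hx)]
  · have := Measure.isProbabilityMeasure_map hTm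
    refine Measure.ext_of_Iic _ _ fun x => ?_
    rw [Measure.map_apply_of_aemeasurable hTm measurableSet_Iic,
      measure_congr (firstExitTime_preimage_Iic_ae_eq hβ hγ0 hγ1 hk hX hXL ht x),
      withDensity_apply _ measurableSet_Iic, Measure.restrict_restrict measurableSet_Iic,
      Iic_inter_Ioi]
    split_ifs with hx
    · rw [← Measure.map_apply_of_aemeasurable (hX.aemeasurable _) measurableSet_Ici,
        setLIntegral_congr_fun measurableSet_Ioc fun y hy => hE y hy.1,
        setLIntegral_ptsExitDensity_zero hβ hγ0 hγ1 hk hμ hL hx ht]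
      have : NullSingletonClass (P.map (X x.toNNReal)) := by
        rw [eq_withDensity_ptsDensity hβ hγ0 hγ1 hk hx (hμ x) (hL x hx.le)]
        infer_instance
      exact (measure_congr Ioi_ae_eq_Ici).symm
    · rw [Ioc_eq_empty (by simpa using hx)]
      simp

end FirstExit

/-! ### Deforming the inversion contour onto the negative half-line -/

/-- The integrand `exp(t z - l z^γ)` of the inversion integral. -/
noncomputable def stableKernel (γ l t : ℝ) (z : ℂ) : ℂ := Complex.exp (t * z - l * z ^ (γ : ℂ))

/-- On the closed upper half-plane the principal branch of `z^γ` is continuous, since the argument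
takes the value `π` on the negative half-line. -/
lemma continuousOn_cpow_const_upperHalfPlane {γ : ℝ} (hγ0 : 0 < γ) :
    ContinuousOn (fun z : ℂ => z ^ (γ : ℂ)) {z : ℂ | 0 ≤ z.im} := by
  intro z hz
  by_cases h : 0 ≤ z.re ∨ z.im ≠ 0
  · exact (Complex.continuousAt_cpow_const_of_re_pos h (by simpa using hγ0)).continuousWithinAt
  · push Not at h
    have hz0 : z ≠ 0 := by rintro rfl; simp at h
    have hlog := Complex.continuousWithinAt_log_of_re_neg_of_im_zero h.1 h.2
    have h2 : ContinuousWithinAt (fun z => Complex.exp (Complex.log z * γ)) {z : ℂ | 0 ≤ z.im} z :=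
      (hlog.mul_const _).cexp
    refine h2.congr_of_eventuallyEq ?_ (Complex.cpow_def_of_ne_zero hz0 _)
    filter_upwards [mem_nhdsWithin_of_mem_nhds (isOpen_ne.mem_nhds hz0)] with w hw
    exact Complex.cpow_def_of_ne_zero hw _

/-- For `γ ≤ 1/2` the power `z^γ` maps the closed upper half-plane into the closed right half-plane. -/
lemma re_cpow_nonneg_of_im_nonneg {γ : ℝ} (hγ0 : 0 ≤ γ) (hγ : γ ≤ 1 / 2) {z : ℂ} (hz : 0 ≤ z.im) :
    0 ≤ (z ^ (γ : ℂ)).re := by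
  rw [Complex.cpow_ofReal_re]
  have h1 := Complex.arg_nonneg_iff.mpr hz
  have h2 := Complex.arg_le_pi z
  refine mul_nonneg (by positivity) (Real.cos_nonneg_of_neg_pi_div_two_le_of_le ?_ ?_)
  · nlinarith [Real.pi_pos]
  · nlinarith [Real.pi_pos]

lemma continuousOn_stableKernel {γ l t : ℝ} (hγ0 : 0 < γ) :
    ContinuousOn (stableKernel γ l t) {z : ℂ | 0 ≤ z.im} := by
  have := continuousOn_cpow_const_upperHalfPlane hγ0
  unfold stableKernel
  fun_prop

/-- The factor `exp(-l z^γ)` is at most `1` in modulus. -/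
lemma norm_stableKernel_le {γ l t : ℝ} (hγ0 : 0 ≤ γ) (hγ : γ ≤ 1 / 2) (hl : 0 ≤ l) {z : ℂ}
    (hz : 0 ≤ z.im) : ‖stableKernel γ l t z‖ ≤ Real.exp (t * z.re) := by
  unfold stableKernel
  rw [Complex.norm_exp, Real.exp_le_exp, Complex.sub_re, Complex.re_ofReal_mul,
    Complex.re_ofReal_mul]
  have := mul_nonneg hl (re_cpow_nonneg_of_im_nonneg hγ0 hγ hz)
  linarith

open Filter Topology in
/-- `Re z^γ = |z|^γ cos(γ arg z)`, where `arg z → π / 2` along a vertical half-line. -/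
lemma tendsto_re_cpow_atTop {γ : ℝ} (hγ0 : 0 < γ) (hγ : γ ≤ 1 / 2) (x : ℝ) :
    Tendsto (fun R : ℝ => (((x : ℂ) + R * Complex.I) ^ (γ : ℂ)).re) atTop atTop := by
  have hlim : Tendsto (fun R : ℝ => Real.cos (((x / R : ℝ) + Complex.I : ℂ).arg * γ)) atTop
      (𝓝 (Real.cos (Real.pi / 2 * γ))) := by
    have h1 : Tendsto (fun R : ℝ => ((x / R : ℝ) + Complex.I : ℂ)) atTop (𝓝 Complex.I) := by
      have : Tendsto (fun R : ℝ => x / R) atTop (𝓝 0) := tendsto_const_nhds.div_atTop tendsto_id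
      have h2 := ((Complex.continuous_ofReal.tendsto _).comp this).add_const Complex.I
      simpa [Function.comp_def] using h2
    have h2 : ContinuousAt Complex.arg Complex.I :=
      Complex.continuousAt_arg (by simp [Complex.mem_slitPlane_iff])
    have h3 := h2.tendsto.comp h1
    rw [Complex.arg_I] at h3
    exact (Real.continuous_cos.tendsto _).comp (h3.mul_const γ)
  have hcos : 0 < Real.cos (Real.pi / 2 * γ) := by
    apply Real.cos_pos_of_mem_Ioo
    constructor <;> nlinarith [Real.pi_pos]
  have hprod := (tendsto_rpow_atTop hγ0).atTop_mul_pos hcos hlim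
  refine tendsto_atTop_mono' _ ?_ hprod
  filter_upwards [eventually_gt_atTop 0, hlim.eventually_const_lt hcos] with R hR hc
  have harg : ((x : ℂ) + R * Complex.I).arg = ((x / R : ℝ) + Complex.I : ℂ).arg := by
    rw [← Complex.arg_real_mul (((x / R : ℝ) : ℂ) + Complex.I) hR]
    congr 1
    have : (R : ℂ) ≠ 0 := by exact_mod_cast hR.ne'
    push_cast; field_simp
  rw [Complex.cpow_ofReal_re, harg]
  refine mul_le_mul_of_nonneg_right (Real.rpow_le_rpow hR.le ?_ hγ0.le) hc.le
  have := Complex.abs_im_le_norm ((x : ℂ) + R * Complex.I)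
  simp only [Complex.add_im, Complex.ofReal_im, Complex.mul_im, Complex.ofReal_re, Complex.I_im,
    mul_one, Complex.I_re, mul_zero, add_zero, zero_add] at this
  exact (le_abs_self R).trans this

lemma integrableOn_stableKernel_horizontal {γ l t c R : ℝ} (hγ0 : 0 < γ) (hγ : γ ≤ 1 / 2)
    (hl : 0 ≤ l) (ht : 0 < t) (hR : 0 ≤ R) :
    IntegrableOn (fun x : ℝ => stableKernel γ l t (x + R * Complex.I)) (Iic c) := by
  refine Integrable.mono' (integrableOn_exp_mul_Iic ht c) ?_
    (Filter.Eventually.of_forall fun x => ?_)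
  · refine Continuous.aestronglyMeasurable ?_
    refine (continuousOn_stableKernel hγ0).comp_continuous (by fun_prop) fun x => ?_
    simpa using hR
  · refine (norm_stableKernel_le hγ0.le hγ hl (by simpa using hR)).trans (le_of_eq ?_)
    simp

open Filter Topology in
/-- Cauchy's theorem on the half-strip `{Re z ≤ c, 0 ≤ Im z ≤ R}`. -/
lemma integral_stableKernel_halfStrip {γ l t c R : ℝ} (hγ0 : 0 < γ) (hγ : γ ≤ 1 / 2)
    (hl : 0 ≤ l) (ht : 0 < t) (hR : 0 ≤ R) :
    (∫ x in Iic c, stableKernel γ l t x) - (∫ x in Iic c, stableKernel γ l t (x + R * Complex.I))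
      + Complex.I * ∫ y in (0 : ℝ)..R, stableKernel γ l t (c + y * Complex.I) = 0 := by
  have hrect : ∀ A : ℝ, c ≤ A + c → -A ≤ c →
      (∫ x in (-A)..c, stableKernel γ l t x)
      - (∫ x in (-A)..c, stableKernel γ l t (x + R * Complex.I))
      + Complex.I * (∫ y in (0 : ℝ)..R, stableKernel γ l t (c + y * Complex.I))
      - Complex.I * (∫ y in (0 : ℝ)..R, stableKernel γ l t (((-A : ℝ) : ℂ) + y * Complex.I)) = 0 := by
    intro A hA hA'
    have h := Complex.integral_boundary_rect_eq_zero_of_continuousOn_of_differentiableOn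
      (stableKernel γ l t) ((-A : ℝ) : ℂ) (c + R * Complex.I) ?_ ?_
    · simpa using h
    · refine (continuousOn_stableKernel hγ0).mono fun z hz => ?_
      have h2 := hz.2
      simp only [mem_preimage, Complex.ofReal_im, Complex.add_im, Complex.mul_im, Complex.ofReal_re,
        Complex.I_im, mul_one, Complex.I_re, mul_zero, add_zero, zero_add, uIcc_of_le hR] at h2
      exact h2.1
    · intro z hz
      have h2 := hz.2
      simp only [mem_preimage, Complex.ofReal_im, Complex.add_im, Complex.mul_im, Complex.ofReal_re,
        Complex.I_im, mul_one, Complex.I_re, mul_zero, add_zero, zero_add, min_eq_left hR] at h2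
      have hz' : z ∈ Complex.slitPlane := Or.inr h2.1.ne'
      unfold stableKernel
      have h3 : DifferentiableAt ℂ (fun z : ℂ => z ^ (γ : ℂ)) z :=
        differentiableAt_id.cpow_const hz'
      have : DifferentiableAt ℂ (fun z : ℂ => Complex.exp (t * z - l * z ^ (γ : ℂ))) z := by
        fun_prop
      exact this.differentiableWithinAt
  have hl1 : Tendsto (fun A : ℝ => ∫ x in (-A)..c, stableKernel γ l t x) atTop
      (𝓝 (∫ x in Iic c, stableKernel γ l t x)) := by
    refine intervalIntegral_tendsto_integral_Iic _ ?_ tendsto_neg_atTop_atBot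
    simpa using integrableOn_stableKernel_horizontal (c := c) (R := 0) hγ0 hγ hl ht le_rfl
  have hl2 : Tendsto (fun A : ℝ => ∫ x in (-A)..c, stableKernel γ l t (x + R * Complex.I)) atTop
      (𝓝 (∫ x in Iic c, stableKernel γ l t (x + R * Complex.I))) :=
    intervalIntegral_tendsto_integral_Iic _
      (integrableOn_stableKernel_horizontal hγ0 hγ hl ht hR) tendsto_neg_atTop_atBot
  -- the left edge of the rectangle contributes at most `R e^(-t A)`
  have hl3 : Tendsto (fun A : ℝ => ∫ y in (0 : ℝ)..R,
      stableKernel γ l t (((-A : ℝ) : ℂ) + y * Complex.I)) atTop (𝓝 0) := by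
    have hb : ∀ A : ℝ, ‖∫ y in (0 : ℝ)..R, stableKernel γ l t (((-A : ℝ) : ℂ) + y * Complex.I)‖
        ≤ Real.exp (-(t * A)) * |R - 0| := by
      intro A
      refine intervalIntegral.norm_integral_le_of_norm_le_const fun y hy => ?_
      rw [uIoc_of_le hR] at hy
      refine (norm_stableKernel_le hγ0.le hγ hl (by simpa using hy.1.le)).trans (le_of_eq ?_)
      simp
    refine squeeze_zero_norm hb ?_
    have h1 : Tendsto (fun A : ℝ => -(t * A)) atTop atBot :=
      tendsto_neg_atTop_atBot.comp (tendsto_id.const_mul_atTop ht)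
    simpa [Function.comp_def] using (Real.tendsto_exp_atBot.comp h1).mul_const |R - 0|
  have hlim := ((hl1.sub hl2).add_const
    (Complex.I * ∫ y in (0 : ℝ)..R, stableKernel γ l t (c + y * Complex.I))).sub
    (hl3.const_mul Complex.I)
  have h0 : Tendsto (fun A : ℝ => (∫ x in (-A)..c, stableKernel γ l t x)
      - (∫ x in (-A)..c, stableKernel γ l t (x + R * Complex.I))
      + Complex.I * (∫ y in (0 : ℝ)..R, stableKernel γ l t (c + y * Complex.I))
      - Complex.I * (∫ y in (0 : ℝ)..R, stableKernel γ l t (((-A : ℝ) : ℂ) + y * Complex.I)))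
      atTop (𝓝 0) := by
    refine tendsto_const_nhds.congr' ?_
    filter_upwards [eventually_ge_atTop |c|, eventually_ge_atTop 0] with A hA hA0
    exact (hrect A (by linarith) (by linarith [neg_abs_le c])).symm
  have := tendsto_nhds_unique hlim h0
  simpa using this

open Filter Topology in
/-- The vertical inversion contour may be moved to the upper edge of the half-line `(-∞, c]`. The
upper edge `Im z = R` of the half-strip contributes nothing in the limit, because `Re z^γ → ∞` there. -/
lemma integral_stableKernel_vertical {γ l t c : ℝ} (hγ0 : 0 < γ) (hγ : γ ≤ 1 / 2)
    (hl : 0 < l) (ht : 0 < t)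
    (hint : IntegrableOn (fun y : ℝ => stableKernel γ l t (c + y * Complex.I)) (Ioi 0)) :
    Complex.I * ∫ y in Ioi (0 : ℝ), stableKernel γ l t (c + y * Complex.I)
      = -∫ x in Iic c, stableKernel γ l t x := by
  have h1 : Tendsto (fun R : ℝ => ∫ y in (0 : ℝ)..R, stableKernel γ l t (c + y * Complex.I)) atTop
      (𝓝 (∫ y in Ioi (0 : ℝ), stableKernel γ l t (c + y * Complex.I))) :=
    intervalIntegral_tendsto_integral_Ioi _ hint tendsto_id
  have h2 : Tendsto (fun R : ℝ => ∫ x in Iic c, stableKernel γ l t (x + R * Complex.I)) atTop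
      (𝓝 0) := by
    have h0 : (∫ x in Iic c, (0 : ℂ)) = 0 := by simp
    rw [← h0]
    refine tendsto_integral_filter_of_dominated_convergence (fun x => Real.exp (t * x)) ?_ ?_
      (integrableOn_exp_mul_Iic ht c) (Eventually.of_forall fun x => ?_)
    · filter_upwards [eventually_ge_atTop 0] with R hR
      exact (integrableOn_stableKernel_horizontal hγ0 hγ hl.le ht hR).aestronglyMeasurable
    · filter_upwards [eventually_ge_atTop 0] with R hR
      refine Eventually.of_forall fun x => ?_
      refine (norm_stableKernel_le hγ0.le hγ hl.le (by simpa using hR)).trans (le_of_eq ?_)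
      simp
    · rw [tendsto_zero_iff_norm_tendsto_zero]
      have h3 := tendsto_re_cpow_atTop hγ0 hγ x
      have h4 : Tendsto (fun R : ℝ => t * x - l * (((x : ℂ) + R * Complex.I) ^ (γ : ℂ)).re)
          atTop atBot := by
        have := tendsto_neg_atTop_atBot.comp (h3.const_mul_atTop hl)
        exact tendsto_atBot_add_const_left _ (t * x) this
      refine (Real.tendsto_exp_atBot.comp h4).congr fun R => ?_
      unfold stableKernel
      rw [Complex.norm_exp, Complex.sub_re, Complex.re_ofReal_mul, Complex.re_ofReal_mul]
      simp
  have h3 := (h2.const_sub (∫ x in Iic c, stableKernel γ l t x)).add (h1.const_mul Complex.I)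
  have h4 := tendsto_nhds_unique h3 (tendsto_const_nhds.congr' (by
    filter_upwards [eventually_ge_atTop 0] with R hR
    exact (integral_stableKernel_halfStrip hγ0 hγ hl.le ht hR).symm))
  rw [sub_zero] at h4
  exact eq_neg_of_add_eq_zero_right h4

/-- The values of the kernel on `(0, c)` are real, so that only the negative half-line contributes
to the density. -/
lemma re_integral_stableKernel_vertical {γ l t c : ℝ} (hγ0 : 0 < γ) (hγ : γ ≤ 1 / 2)
    (hl : 0 < l) (ht : 0 < t) (hc : 0 ≤ c)
    (hint : IntegrableOn (fun y : ℝ => stableKernel γ l t (c + y * Complex.I)) (Ioi 0)) :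
    (∫ y in Ioi (0 : ℝ), stableKernel γ l t (c + y * Complex.I)).re
      = -(∫ r in Ioi (0 : ℝ), Complex.exp (-(t * r)) *
          Complex.exp (-l * Complex.exp (Real.pi * γ * Complex.I) * (r ^ γ : ℝ))).im := by
  have h1 := congrArg Complex.im (integral_stableKernel_vertical (c := c) hγ0 hγ hl ht hint)
  rw [Complex.I_mul_im, Complex.neg_im] at h1
  rw [h1]
  congr 1
  have hi : IntegrableOn (fun x : ℝ => stableKernel γ l t x) (Iic c) := by
    simpa using integrableOn_stableKernel_horizontal (c := c) (R := 0) hγ0 hγ hl.le ht le_rfl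
  have hsplit : ∫ x in Iic c, stableKernel γ l t x
      = (∫ x in Iic (0 : ℝ), stableKernel γ l t x) + ∫ x in Ioc 0 c, stableKernel γ l t x := by
    rw [← setIntegral_union (Iic_disjoint_Ioc le_rfl) measurableSet_Ioc
      (hi.mono_set (Iic_subset_Iic.mpr hc)) (hi.mono_set Ioc_subset_Iic_self), Iic_union_Ioc_eq_Iic hc]
  have hreal : (∫ x in Ioc 0 c, stableKernel γ l t x).im = 0 := by
    have : ∫ x in Ioc 0 c, stableKernel γ l t x
        = ∫ x in Ioc 0 c, ((Real.exp (t * x - l * x ^ γ) : ℝ) : ℂ) := by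
      refine setIntegral_congr_fun measurableSet_Ioc fun x hx => ?_
      unfold stableKernel
      rw [← Complex.ofReal_cpow hx.1.le]
      push_cast
      rfl
    rw [this, integral_complex_ofReal, Complex.ofReal_im]
  rw [hsplit, Complex.add_im, hreal, add_zero]
  have hneg := integral_comp_neg_Ioi 0 (fun x : ℝ => stableKernel γ l t x)
  rw [neg_zero] at hneg
  rw [← hneg]
  congr 1
  refine setIntegral_congr_fun measurableSet_Ioi fun r hr => ?_
  have hr' : (0 : ℝ) < r := hr
  unfold stableKernel
  rw [← Complex.exp_add]
  congr 1
  have hpow : ((-r : ℝ) : ℂ) ^ (γ : ℂ) = Complex.exp (Real.pi * γ * Complex.I) * (r ^ γ : ℝ) := by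
    rw [Complex.ofReal_cpow_of_nonpos (by linarith), Complex.ofReal_neg, neg_neg,
      ← Complex.ofReal_cpow hr'.le, mul_comm]
    congr 2; ring
  rw [hpow]
  push_cast
  ring

/-! ### The series of the density for `γ ≤ 1/2` -/

/-- The scale `l` for which `Q(x, s)` is a multiple of `exp(-l (k² / 2 + s)^γ)`. -/
noncomputable def ptsScale (β γ k x : ℝ) : ℝ :=
  -(x * ptsA β γ * Real.Gamma (-γ)) * (k ^ 2 / 2) ^ (-γ)

lemma ptsScale_pos {β γ k x : ℝ} (hβ : 0 < β) (hγ0 : 0 < γ) (hγ1 : γ < 1) (hk : 0 < k)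
    (hx : 0 < x) : 0 < ptsScale β γ k x := by
  have := neg_ptsA_mul_gamma_pos hβ hγ0 hγ1
  have h2 : 0 < -(x * ptsA β γ * Real.Gamma (-γ)) := by nlinarith
  unfold ptsScale
  positivity

lemma ptsLaplaceQ_eq_exp_mul {β γ k x : ℝ} (hk : 0 < k) {s : ℂ} (hs : 0 ≤ s.re) :
    ptsLaplaceQ β γ k x s = Complex.exp ((-(x * ptsA β γ * Real.Gamma (-γ)) : ℝ))
      * Complex.exp (-(ptsScale β γ k x) * (((k ^ 2 / 2 : ℝ) : ℂ) + s) ^ (γ : ℂ)) := by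
  have hc : 0 < k ^ 2 / 2 := by positivity
  have hw : 1 + 2 * s / (k : ℂ) ^ 2 ≠ 0 := by
    intro h
    have := congrArg Complex.re h
    rw [← Complex.ofReal_pow, Complex.add_re, Complex.div_ofReal_re] at this
    simp at this
    have h2 : 0 ≤ 2 * s.re / k ^ 2 := by positivity
    linarith
  have hkc : (k : ℂ) ≠ 0 := by exact_mod_cast hk.ne'
  have h1 : ((k ^ 2 / 2 : ℝ) : ℂ) + s = ((k ^ 2 / 2 : ℝ) : ℂ) * (1 + 2 * s / (k : ℂ) ^ 2) := by
    push_cast; field_simp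
  have h2 : (((k ^ 2 / 2 : ℝ) : ℂ) + s) ^ (γ : ℂ)
      = (((k ^ 2 / 2) ^ γ : ℝ) : ℂ) * (1 + 2 * s / (k : ℂ) ^ 2) ^ (γ : ℂ) := by
    rw [h1, Complex.cpow_def_of_ne_zero (mul_ne_zero (by exact_mod_cast hc.ne') hw),
      Complex.log_ofReal_mul hc hw, add_mul, Complex.exp_add, ← Complex.cpow_def_of_ne_zero hw,
      Complex.ofReal_log hc.le, ← Complex.cpow_def_of_ne_zero (by exact_mod_cast hc.ne'),
      Complex.ofReal_cpow hc.le]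
  have h3 : ((ptsScale β γ k x : ℝ) : ℂ) * (((k ^ 2 / 2) ^ γ : ℝ) : ℂ)
      = ((-(x * ptsA β γ * Real.Gamma (-γ)) : ℝ) : ℂ) := by
    rw [← Complex.ofReal_mul]
    congr 1
    unfold ptsScale
    rw [mul_assoc, ← Real.rpow_add hc]; simp
  rw [h2, ← Complex.exp_add, neg_mul, ← mul_assoc, h3]
  unfold ptsLaplaceQ
  congr 1
  push_cast; ring

lemma conj_ptsLaplaceQ {β γ k x : ℝ} {s : ℂ} (hs : 0 ≤ s.re) :
    (starRingEnd ℂ) (ptsLaplaceQ β γ k x s) = ptsLaplaceQ β γ k x ((starRingEnd ℂ) s) := by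
  unfold ptsLaplaceQ
  have h : (1 + 2 * s / (k : ℂ) ^ 2).arg ≠ Real.pi := by
    intro h
    have := (Complex.arg_eq_pi_iff.mp h).1
    rw [← Complex.ofReal_pow, Complex.add_re, Complex.div_ofReal_re] at this
    simp at this
    have h2 : 0 ≤ 2 * s.re / k ^ 2 := by positivity
    linarith
  have h1 := Complex.conj_cpow (1 + 2 * s / (k : ℂ) ^ 2) γ h
  rw [Complex.conj_ofReal] at h1
  rw [← Complex.exp_conj]
  simp only [map_mul, map_neg, map_sub, map_one, Complex.conj_ofReal]
  rw [← h1]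
  have h2 : (starRingEnd ℂ) 2 = 2 := Complex.conj_ofNat 2
  simp [map_div₀, map_mul, map_pow, h2]

/-- Fourier inversion over the positive half of the imaginary axis. -/
lemma ptsDensity_eq_integral_Ioi {β γ k x : ℝ} (hβ : 0 < β) (hγ0 : 0 < γ) (hγ1 : γ < 1)
    (hk : 0 < k) (hx : 0 < x) (t : ℝ) :
    ptsDensity β γ k x t = 1 / Real.pi * ∫ y in Ioi (0 : ℝ),
      (Complex.exp (y * t * Complex.I) * ptsLaplaceQ β γ k x (y * Complex.I)).re := by
  let G : ℝ → ℝ := fun y =>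
    (Complex.exp (y * t * Complex.I) * ptsLaplaceQ β γ k x (y * Complex.I)).re
  have hint : Integrable (fun ξ : ℝ => Complex.exp (((-2 * Real.pi * ξ * t : ℝ) : ℂ) * Complex.I) *
      ptsLaplaceQ β γ k x (-(((2 * Real.pi * ξ : ℝ) : ℂ) * Complex.I))) := by
    have h1 := (integrable_ptsLaplaceQ_neg_I_mul hβ hγ0 hγ1 hk hx).comp_mul_left'
      (R := 2 * Real.pi) (by positivity)
    refine h1.bdd_mul (c := 1) (by fun_prop) (Filter.Eventually.of_forall fun ξ => ?_)
    rw [Complex.norm_exp_ofReal_mul_I]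
  have hq : ptsDensity β γ k x t = ∫ ξ : ℝ, G (-(2 * Real.pi) * ξ) := by
    unfold ptsDensity invFourierDensity
    rw [Real.fourier_real_eq_integral_exp_smul]
    simp only [smul_eq_mul]
    have := integral_re hint
    simp only [RCLike.re_eq_complex_re] at this
    rw [← this]
    congr 1; ext ξ
    simp only [G]
    congr 3
    · push_cast; ring
    · push_cast; ring
  have heven : ∀ y, G |y| = G y := by
    intro y
    rcases abs_choice y with h | h
    · rw [h]
    · rw [h]
      have h1 := conj_ptsLaplaceQ (β := β) (γ := γ) (k := k) (x := x) (s := y * Complex.I) (by simp)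
      simp only [G]
      rw [← Complex.conj_re (Complex.exp (y * t * Complex.I) * _), map_mul, h1, ← Complex.exp_conj]
      simp
  rw [hq, Measure.integral_comp_mul_left]
  have h2 : ∫ y, G y = 2 * ∫ y in Ioi (0 : ℝ), G y := by
    rw [← integral_comp_abs]
    simp_rw [heven]
  rw [h2, smul_eq_mul, abs_inv, abs_neg, abs_of_pos (by positivity)]
  have := Real.pi_pos
  field_simp
  rfl

/-- The substitution `z = k² / 2 + i y` in the inversion integral. -/
lemma exp_mul_ptsLaplaceQ_eq_stableKernel {β γ k x : ℝ} (hk : 0 < k) (t y : ℝ) :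
    Complex.exp (y * t * Complex.I) * ptsLaplaceQ β γ k x (y * Complex.I)
      = ((Real.exp (-(x * ptsA β γ * Real.Gamma (-γ))) * Real.exp (-(k ^ 2 / 2 * t)) : ℝ) : ℂ) *
        stableKernel γ (ptsScale β γ k x) t (((k ^ 2 / 2 : ℝ) : ℂ) + y * Complex.I) := by
  rw [ptsLaplaceQ_eq_exp_mul hk (by simp)]
  unfold stableKernel
  rw [Complex.ofReal_mul, Complex.ofReal_exp, Complex.ofReal_exp, ← Complex.exp_add,
    ← Complex.exp_add, ← Complex.exp_add, ← Complex.exp_add]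
  congr 1
  push_cast
  ring

/-- For `γ ≤ 1/2` the density is the imaginary part of a Laplace integral over the branch cut. -/
lemma ptsDensity_eq_integral_branchCut {β γ k x : ℝ} (hβ : 0 < β) (hγ0 : 0 < γ) (hγ : γ ≤ 1 / 2)
    (hk : 0 < k) (hx : 0 < x) {t : ℝ} (ht : 0 < t) :
    ptsDensity β γ k x t
      = Real.exp (-(x * ptsA β γ * Real.Gamma (-γ))) * Real.exp (-(k ^ 2 / 2 * t)) *
        (-(1 / Real.pi) * (∫ r in Ioi (0 : ℝ), Complex.exp (-(t * r)) *
          Complex.exp (-(ptsScale β γ k x) * Complex.exp (Real.pi * γ * Complex.I)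
            * (r ^ γ : ℝ))).im) := by
  have hγ1 : γ < 1 := by linarith
  set K := Real.exp (-(x * ptsA β γ * Real.Gamma (-γ))) * Real.exp (-(k ^ 2 / 2 * t)) with hK
  have hK0 : (K : ℂ) ≠ 0 := by
    have : 0 < K := by positivity
    exact_mod_cast this.ne'
  have hint : Integrable (fun y : ℝ =>
      stableKernel γ (ptsScale β γ k x) t (((k ^ 2 / 2 : ℝ) : ℂ) + y * Complex.I)) := by
    have h1 := (integrable_ptsLaplaceQ_neg_I_mul hβ hγ0 hγ1 hk hx).comp_neg
    have h2 : Integrable (fun y : ℝ => Complex.exp (((y * t : ℝ) : ℂ) * Complex.I) *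
        ptsLaplaceQ β γ k x (-(((-y : ℝ) : ℂ) * Complex.I))) := by
      refine h1.bdd_mul (c := 1) (by fun_prop) (Filter.Eventually.of_forall fun ξ => ?_)
      rw [Complex.norm_exp_ofReal_mul_I]
    refine (h2.const_mul (K : ℂ)⁻¹).congr (Filter.Eventually.of_forall fun y => ?_)
    beta_reduce
    have h3 := exp_mul_ptsLaplaceQ_eq_stableKernel (β := β) (γ := γ) (x := x) hk t y
    rw [← hK] at h3
    rw [inv_mul_eq_iff_eq_mul₀ hK0, ← h3]
    push_cast
    congr 2; ring
  rw [ptsDensity_eq_integral_Ioi hβ hγ0 hγ1 hk hx]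
  simp_rw [exp_mul_ptsLaplaceQ_eq_stableKernel hk t, ← hK, Complex.re_ofReal_mul]
  rw [integral_const_mul]
  have h4 := integral_re hint.integrableOn (μ := volume.restrict (Ioi (0 : ℝ)))
  simp only [RCLike.re_eq_complex_re] at h4
  rw [h4, re_integral_stableKernel_vertical hγ0 hγ (ptsScale_pos hβ hγ0 hγ1 hk hx) ht
    (by positivity) hint.integrableOn]
  ring

open Filter Topology in
/-- The linear term dominates `r^γ` in the exponent. -/
lemma integrableOn_exp_neg_mul_mul_exp_rpow {γ t : ℝ} (hγ0 : 0 < γ) (hγ1 : γ < 1) (ht : 0 < t)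
    (b : ℝ) : IntegrableOn (fun r : ℝ => Real.exp (-(t * r)) * Real.exp (b * r ^ γ)) (Ioi 0) := by
  refine integrable_of_isBigO_exp_neg (b := t / 2) (by positivity) ?_ ?_
  · have : ContinuousOn (fun r : ℝ => r ^ γ) (Ici 0) :=
      continuousOn_id.rpow_const fun x _ => Or.inr hγ0.le
    fun_prop
  · refine Asymptotics.IsBigO.of_bound 1 ?_
    have h1 : Tendsto (fun r : ℝ => b * r ^ (-(1 - γ))) atTop (𝓝 0) := by
      simpa using (tendsto_rpow_neg_atTop (by linarith : 0 < 1 - γ)).const_mul b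
    filter_upwards [h1.eventually_lt_const (by positivity : 0 < t / 2), eventually_gt_atTop 0]
      with r hr hr0
    rw [← Real.exp_add, Real.norm_of_nonneg (Real.exp_pos _).le,
      Real.norm_of_nonneg (Real.exp_pos _).le, one_mul, Real.exp_le_exp]
    have h2 : r ^ γ = r ^ (-(1 - γ)) * r := by
      rw [← Real.rpow_add_one hr0.ne']; congr 1; ring
    rw [h2]
    nlinarith

/-- Termwise integration of the exponential series of `exp(w r^γ)` against `exp(-t r)`. -/
lemma hasSum_integral_exp_neg_mul_mul_exp_rpow {γ t : ℝ} (hγ0 : 0 < γ) (hγ1 : γ < 1) (ht : 0 < t)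
    (w : ℂ) :
    HasSum (fun n : ℕ => w ^ n / n.factorial *
        ((Real.Gamma (n * γ + 1) * t ^ (-(n * γ + 1)) : ℝ) : ℂ))
      (∫ r in Ioi (0 : ℝ), Complex.exp (-(t * r)) * Complex.exp (w * (r ^ γ : ℝ))) := by
  have hterm : ∀ n : ℕ, ∫ r in Ioi (0 : ℝ), Complex.exp (-(t * r)) *
      ((w * (r ^ γ : ℝ)) ^ n / n.factorial)
      = w ^ n / n.factorial * ((Real.Gamma (n * γ + 1) * t ^ (-(n * γ + 1)) : ℝ) : ℂ) := by
    intro n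
    have h := Real.integral_rpow_mul_exp_neg_mul_Ioi (a := n * γ + 1) (r := t) (by positivity) ht
    rw [one_div, Real.inv_rpow ht.le, ← Real.rpow_neg ht.le,
      mul_comm (t ^ _)] at h
    rw [← h, ← integral_complex_ofReal, ← integral_const_mul]
    refine setIntegral_congr_fun measurableSet_Ioi fun r hr => ?_
    have hr0 : (0 : ℝ) ≤ r := le_of_lt hr
    rw [add_sub_cancel_right, mul_comm (n : ℝ) γ, Real.rpow_mul hr0, Real.rpow_natCast]
    push_cast
    ring
  have key := hasSum_integral_of_dominated_convergence (μ := volume.restrict (Ioi (0 : ℝ)))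
    (F := fun (n : ℕ) (r : ℝ) => Complex.exp (-(t * r)) * ((w * (r ^ γ : ℝ)) ^ n / n.factorial))
    (f := fun r : ℝ => Complex.exp (-(t * r)) * Complex.exp (w * (r ^ γ : ℝ)))
    (fun n r => Real.exp (-(t * r)) * ((‖w‖ * r ^ γ) ^ n / n.factorial)) ?_ ?_ ?_ ?_ ?_
  · simpa only [hterm] using key
  · intro n
    exact Measurable.aestronglyMeasurable (by fun_prop)
  · refine fun n => (ae_restrict_iff' measurableSet_Ioi).mpr (Filter.Eventually.of_forall fun r hr => ?_)
    have hr0 : (0 : ℝ) ≤ r := le_of_lt hr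
    rw [norm_mul, Complex.norm_exp, norm_div, norm_pow, norm_mul, Complex.norm_real,
      Real.norm_of_nonneg (by positivity : 0 ≤ r ^ γ)]
    simp
  · refine Filter.Eventually.of_forall fun r => ?_
    exact (Real.summable_pow_div_factorial _).mul_left _
  · have := integrableOn_exp_neg_mul_mul_exp_rpow hγ0 hγ1 ht ‖w‖
    refine Integrable.congr this (Filter.Eventually.of_forall fun r => ?_)
    beta_reduce
    rw [tsum_mul_left, Real.exp_eq_exp_ℝ, NormedSpace.exp_eq_tsum_div]
  · refine Filter.Eventually.of_forall fun r => ?_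
    have h := NormedSpace.expSeries_div_hasSum_exp (w * ((r ^ γ : ℝ) : ℂ))
    rw [← Complex.exp_eq_exp_ℂ] at h
    exact h.mul_left _

/-- The series of the density in powers of `t^(-γ)`: the imaginary part of the termwise integrals over
the branch cut. -/
lemma hasSum_ptsDensity {β γ k x : ℝ} (hβ : 0 < β) (hγ0 : 0 < γ) (hγ : γ ≤ 1 / 2)
    (hk : 0 < k) (hx : 0 < x) {t : ℝ} (ht : 0 < t) :
    HasSum (fun n : ℕ => Real.exp (-(x * ptsA β γ * Real.Gamma (-γ))) * Real.exp (-(k ^ 2 / 2 * t)) *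
        (-(1 / Real.pi) * ((-ptsScale β γ k x) ^ n / n.factorial * Real.sin (Real.pi * (n * γ))
          * (Real.Gamma (n * γ + 1) * t ^ (-(n * γ + 1))))))
      (ptsDensity β γ k x t) := by
  rw [ptsDensity_eq_integral_branchCut hβ hγ0 hγ hk hx ht]
  refine HasSum.mul_left _ (HasSum.mul_left _ ?_)
  have h := Complex.hasSum_im (hasSum_integral_exp_neg_mul_mul_exp_rpow hγ0 (by linarith) ht
    (-(ptsScale β γ k x) * Complex.exp (Real.pi * γ * Complex.I)))
  convert! h using 1
  ext n
  have h1 : (-(ptsScale β γ k x : ℂ) * Complex.exp (Real.pi * γ * Complex.I)) ^ n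
      = (((-ptsScale β γ k x) ^ n : ℝ) : ℂ) * Complex.exp ((Real.pi * (n * γ) : ℝ) * Complex.I) := by
    rw [mul_pow, ← Complex.exp_nat_mul]
    push_cast
    congr 2; ring
  rw [h1, mul_div_right_comm, ← Complex.ofReal_natCast, ← Complex.ofReal_div,
    Complex.im_mul_ofReal, Complex.im_ofReal_mul, Complex.exp_ofReal_mul_I_im]

/-! ### Products of Gamma values and factorials -/

/-- The moduli of the factors of `∏ (1 - ζ^s) = m + 1`, for `ζ` a primitive root of unity of order
`m + 1`. -/
lemma prod_two_mul_sin (m : ℕ) :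
    ∏ s ∈ Finset.range m, (2 * Real.sin (Real.pi * ((s + 1) / (m + 1)))) = m + 1 := by
  have hprim := Complex.isPrimitiveRoot_exp (m + 1) (by omega)
  have h := congrArg (fun z : ℂ => ‖z‖) hprim.prod_one_sub_pow_eq_order
  simp only [norm_prod] at h
  have h2 : ‖((m : ℂ) + 1)‖ = m + 1 := by
    rw [← Nat.cast_succ, Complex.norm_natCast]; push_cast; rfl
  rw [h2] at h
  refine Eq.trans (Finset.prod_congr rfl fun s hs => ?_) h
  have hs' : s < m := Finset.mem_range.mp hs
  set θ : ℝ := Real.pi * ((s + 1) / (m + 1)) with hθ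
  have hsin : 0 ≤ Real.sin θ := by
    refine Real.sin_nonneg_of_nonneg_of_le_pi (by positivity) ?_
    rw [hθ]
    refine mul_le_of_le_one_right Real.pi_pos.le ?_
    rw [div_le_one (by positivity)]
    have : (s : ℝ) ≤ m := by exact_mod_cast hs'.le
    linarith
  have h3 : (1 : ℂ) - Complex.exp (2 * Real.pi * Complex.I / ((m + 1 : ℕ) : ℂ)) ^ (s + 1)
      = Complex.exp (θ * Complex.I) * (-(2 * Complex.I) * (Real.sin θ : ℝ)) := by
    rw [← Complex.exp_nat_mul, Complex.ofReal_sin, Complex.sin, hθ]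
    have e1 : Complex.exp (((s + 1 : ℕ) : ℂ) * (2 * Real.pi * Complex.I / ((m + 1 : ℕ) : ℂ)))
        = Complex.exp (θ * Complex.I) * Complex.exp (θ * Complex.I) := by
      rw [← Complex.exp_add]; congr 1; rw [hθ]; push_cast; ring
    have e2 : Complex.exp (-(θ : ℂ) * Complex.I) = (Complex.exp (θ * Complex.I))⁻¹ := by
      rw [neg_mul, Complex.exp_neg]
    rw [e1, ← hθ, e2]
    have : Complex.exp (θ * Complex.I) ≠ 0 := Complex.exp_ne_zero _
    field_simp
    rw [Complex.I_sq]
    ring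
  rw [h3, norm_mul, Complex.norm_exp_ofReal_mul_I, one_mul, norm_mul, Complex.norm_real,
    Real.norm_of_nonneg hsin]
  simp

/-- Gauss: the product of the values of `Γ` at `1/(m+1), …, m/(m+1)`. Its square is evaluated by the
reflection formula. -/
lemma prod_Gamma_div (m : ℕ) :
    ∏ s ∈ Finset.range m, Real.Gamma ((s + 1) / (m + 1))
      = (2 * Real.pi) ^ ((m : ℝ) / 2) * ((m : ℝ) + 1) ^ (-(1 / 2) : ℝ) := by
  set p := ∏ s ∈ Finset.range m, Real.Gamma ((s + 1) / (m + 1)) with hp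
  have hp0 : 0 < p := Finset.prod_pos fun s _ => Real.Gamma_pos_of_pos (by positivity)
  have hsq : p * p = (2 * Real.pi) ^ m / (m + 1) := by
    have h1 : p = ∏ s ∈ Finset.range m, Real.Gamma (1 - (s + 1) / (m + 1)) := by
      rw [hp, ← Finset.prod_range_reflect]
      refine Finset.prod_congr rfl fun s hs => ?_
      have hs' : s < m := Finset.mem_range.mp hs
      congr 1
      rw [show m - 1 - s = m - (s + 1) by omega, Nat.cast_sub (by omega)]
      push_cast
      field_simp
      ring
    have h3 : p * p = (∏ s ∈ Finset.range m, Real.Gamma (1 - (s + 1) / (m + 1)))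
        * ∏ s ∈ Finset.range m, Real.Gamma ((s + 1) / (m + 1)) := by
      rw [← h1]
    rw [h3, ← Finset.prod_mul_distrib]
    have h2 : ∀ s ∈ Finset.range m, Real.Gamma (1 - (s + 1) / (m + 1)) * Real.Gamma ((s + 1) / (m + 1))
        = (2 * Real.pi) / (2 * Real.sin (Real.pi * ((s + 1) / (m + 1)))) := by
      intro s _
      rw [mul_comm, Real.Gamma_mul_Gamma_one_sub, mul_div_mul_left _ _ two_ne_zero]
    rw [Finset.prod_congr rfl h2, Finset.prod_div_distrib, prod_two_mul_sin]
    simp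
  have hpi := Real.pi_pos
  set r := (2 * Real.pi) ^ ((m : ℝ) / 2) * ((m : ℝ) + 1) ^ (-(1 / 2) : ℝ) with hr
  have hr0 : 0 < r := by positivity
  have hrsq : r * r = (2 * Real.pi) ^ m / (m + 1) := by
    rw [hr, mul_mul_mul_comm, ← Real.rpow_add (by positivity), ← Real.rpow_add (by positivity),
      add_halves, Real.rpow_natCast, show (-(1 / 2) + -(1 / 2) : ℝ) = -1 by norm_num,
      Real.rpow_neg_one]
    rfl
  exact (mul_self_inj hp0.le hr0.le).mp (hsq.trans hrsq.symm)

/-- The product of the values `Γ((j - i) / (m + 1))` over `j ≠ i`, `0 ≤ j ≤ m`, by `i` applications of the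
functional equation to Gauss' product. -/
lemma prod_Gamma_mul_prod_Gamma_neg (m i : ℕ) (hi : i ≤ m) :
    (∏ s ∈ Finset.range (m - i), Real.Gamma ((s + 1) / (m + 1)))
        * ∏ s ∈ Finset.range i, Real.Gamma (-((s + 1) / (m + 1)))
      = (-1) ^ i * ((m : ℝ) + 1) ^ i / i.factorial *
        ((2 * Real.pi) ^ ((m : ℝ) / 2) * ((m : ℝ) + 1) ^ (-(1 / 2) : ℝ)) := by
  induction i with
  | zero => simp [prod_Gamma_div]
  | succ i ih =>
    have ih' := ih (by omega)
    rw [show m - i = (m - (i + 1)) + 1 by omega, Finset.prod_range_succ] at ih'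
    rw [Finset.prod_range_succ]
    have hG := Real.Gamma_add_one (s := -(((i : ℝ) + 1) / (m + 1))) (by
      have : 0 < ((i : ℝ) + 1) / (m + 1) := by positivity
      linarith)
    have harg : -(((i : ℝ) + 1) / (m + 1)) + 1 = (((m - (i + 1) : ℕ) : ℝ) + 1) / (m + 1) := by
      rw [Nat.cast_sub hi]; push_cast; field_simp; ring
    rw [← harg, hG] at ih'
    rw [Nat.factorial_succ]
    have h2 : ∀ A B C R : ℝ, A * (-(((i : ℝ) + 1) / (m + 1)) * C) * B = R →
        A * (B * C) = -(((m : ℝ) + 1) / (i + 1)) * R := by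
      intro A B C R h
      rw [← h]; field_simp
    rw [h2 _ _ _ _ ih']
    push_cast
    field_simp
    ring

/-- The coefficients of the MacRobert function with parameters `1 + j / (m + 1)`. -/
lemma prod_erase_Gamma_sub_div (m : ℕ) (i : Fin (m + 1)) :
    ∏ j ∈ Finset.univ.erase i, Real.Gamma (((j : ℝ) - i) / (m + 1))
      = (-1) ^ (i : ℕ) * ((m : ℝ) + 1) ^ (i : ℕ) / (i : ℕ).factorial *
        ((2 * Real.pi) ^ ((m : ℝ) / 2) * ((m : ℝ) + 1) ^ (-(1 / 2) : ℝ)) := by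
  obtain ⟨i, hi⟩ := i
  have him : i ≤ m := by omega
  rw [← prod_Gamma_mul_prod_Gamma_neg m i him]
  let g : ℕ → ℝ := fun j => if j = i then 1 else Real.Gamma (((j : ℝ) - i) / (m + 1))
  have h1 : ∏ j ∈ Finset.univ.erase (⟨i, hi⟩ : Fin (m + 1)), Real.Gamma (((j : ℝ) - i) / (m + 1))
      = ∏ j : Fin (m + 1), g j := by
    rw [← Finset.prod_erase (s := Finset.univ) (a := (⟨i, hi⟩ : Fin (m + 1))) (f := fun j : Fin (m + 1) => g j)
      (by simp [g])]
    refine Finset.prod_congr rfl fun j hj => ?_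
    have : (j : ℕ) ≠ i := fun h => (Finset.mem_erase.mp hj).1 (Fin.ext h)
    simp [g, this]
  rw [show (((⟨i, hi⟩ : Fin (m + 1)) : ℕ) : ℝ) = (i : ℝ) from rfl, h1, Fin.prod_univ_eq_prod_range g,
    show m + 1 = (i + 1) + (m - i) by omega, Finset.prod_range_add, Finset.prod_range_succ]
  have h2 : g i = 1 := by simp [g]
  rw [h2, mul_one, mul_comm]
  congr 1
  · refine Finset.prod_congr rfl fun s _ => ?_
    have : i + 1 + s ≠ i := by omega
    simp only [g, this, if_false]
    congr 2
    push_cast; ring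
  · rw [← Finset.prod_range_reflect]
    refine Finset.prod_congr rfl fun s hs => ?_
    have hs' := Finset.mem_range.mp hs
    have : i - 1 - s ≠ i := by omega
    simp only [g, this, if_false]
    congr 1
    rw [show i - 1 - s = i - (s + 1) by omega, Nat.cast_sub (by omega)]
    push_cast; ring

/-- The multiplication formula for factorials: `(j (m + 1) + i)!` in terms of `m + 1` Pochhammer
symbols. -/
lemma factorial_mul_add_eq_prod_ascPochhammer (m : ℕ) (i : Fin (m + 1)) (j : ℕ) :
    (((j * (m + 1) + i).factorial : ℕ) : ℂ)
      = (i : ℕ).factorial * ((m : ℂ) + 1) ^ ((m + 1) * j) *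
        ∏ i' : Fin (m + 1), (ascPochhammer ℂ j).eval (1 + ((i : ℂ) - i') / (m + 1)) := by
  induction j with
  | zero => simp
  | succ j ih =>
    have hm : ((m : ℂ) + 1) ≠ 0 := by exact_mod_cast Nat.succ_ne_zero m
    have h1 : (j + 1) * (m + 1) + (i : ℕ) = (j * (m + 1) + i) + (m + 1) := by ring
    rw [h1, ← Nat.factorial_mul_ascFactorial, Nat.cast_mul, ih, Nat.ascFactorial_eq_prod_range,
      Nat.cast_prod]
    simp_rw [ascPochhammer_succ_eval]
    rw [Finset.prod_mul_distrib]
    have h2 : ∏ s ∈ Finset.range (m + 1), (((j * (m + 1) + i + 1 + s : ℕ)) : ℂ)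
        = ((m : ℂ) + 1) ^ (m + 1) * ∏ i' : Fin (m + 1), (1 + ((i : ℂ) - i') / (m + 1) + j) := by
      have h3 : ((m : ℂ) + 1) ^ (m + 1) = ∏ _i' : Fin (m + 1), ((m : ℂ) + 1) := by simp
      rw [h3, ← Finset.prod_mul_distrib,
        Fin.prod_univ_eq_prod_range (fun i' => ((m : ℂ) + 1) * (1 + ((i : ℂ) - i') / (m + 1) + j)),
        ← Finset.prod_range_reflect]
      refine Finset.prod_congr rfl fun s hs => ?_
      have hs' := Finset.mem_range.mp hs
      rw [show m + 1 - 1 - s = m - s by omega]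
      push_cast [Nat.cast_sub (show s ≤ m by omega)]
      field_simp
      ring
    rw [h2]
    ring

/-! ### The density as a combination of MacRobert functions -/

/-- The factor with `i' = i` is `(1)_j = j!`. -/
lemma prod_ascPochhammer_eq_factorial_mul {m : ℕ} (i : Fin m) (c : ℂ) (j : ℕ) :
    ∏ i' : Fin m, (ascPochhammer ℂ j).eval (1 + ((i : ℂ) - i') / c)
      = j.factorial * ∏ i' : {i' : Fin m // i' ≠ i},
          (ascPochhammer ℂ j).eval (1 + ((i : ℂ) - (i' : Fin m)) / c) := by
  rw [← Finset.mul_prod_erase Finset.univ _ (Finset.mem_univ i), sub_self, zero_div, add_zero,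
    ascPochhammer_eval_one]
  congr 1
  exact Finset.prod_subtype _ (by simp) _

/-- The value of the MacRobert function without lower parameters at the parameters
`1, 1 + 1/(m+1), …, 1 + m/(m+1)`. The factor `j!` of the hypergeometric series is absorbed into the
product of Pochhammer symbols. -/
lemma macRobertE_one_add_div {m : ℕ} (hm : 1 ≤ m) (w : ℂ) :
    macRobertE (fun j : Fin (m + 1) => 1 + (j : ℂ) * ((1 / ((m : ℝ) + 1) : ℝ) : ℂ))
        (Fin.elim0 : Fin 0 → ℂ) w
      = ∑ i : Fin (m + 1), ((∏ j ∈ Finset.univ.erase i, Real.Gamma (((j : ℝ) - i) / (m + 1)) : ℝ) : ℂ)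
        * Complex.Gamma (1 + i / (m + 1)) * Complex.exp ((1 + i / (m + 1)) * w)
        * ∑' j : ℕ, (ascPochhammer ℂ j).eval (1 + (i : ℂ) / (m + 1))
          / (∏ i' : Fin (m + 1), (ascPochhammer ℂ j).eval (1 + ((i : ℂ) - i') / (m + 1)))
          * ((-1) ^ (m + 1) * Complex.exp w) ^ j := by
  rw [macRobertE, if_pos (Or.inl (by omega))]
  refine Finset.sum_congr rfl fun i _ => ?_
  have h1 : ∀ i' : Fin (m + 1), (1 : ℂ) + (i' : ℂ) * ((1 / ((m : ℝ) + 1) : ℝ) : ℂ)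
      = 1 + (i' : ℂ) / (m + 1) := by
    intro i'; push_cast; ring
  simp only [h1]
  have h2 : ∏ j ∈ Finset.univ.erase i, Complex.Gamma (1 + (j : ℂ) / (m + 1) - (1 + (i : ℂ) / (m + 1)))
      = ((∏ j ∈ Finset.univ.erase i, Real.Gamma (((j : ℝ) - i) / (m + 1)) : ℝ) : ℂ) := by
    push_cast
    refine Finset.prod_congr rfl fun j _ => ?_
    rw [← Complex.Gamma_ofReal]
    congr 1
    push_cast; ring
  rw [h2, Finset.univ_eq_empty (α := Fin 0), Finset.prod_empty, div_one, genHypergeometric]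
  congr 1
  refine tsum_congr fun j => ?_
  rw [prod_ascPochhammer_eq_factorial_mul]
  have h3 : ∀ i' : {i' : Fin (m + 1) // i' ≠ i},
      1 + (i : ℂ) / (m + 1) - (1 + ((i' : Fin (m + 1)) : ℂ) / (m + 1)) + 1
        = 1 + ((i : ℂ) - (i' : Fin (m + 1))) / (m + 1) := by
    intro i'; ring
  simp only [h3, Fin.prod_univ_succ, Fin.cons_zero, Finset.univ_eq_empty, Finset.prod_empty, mul_one,
    add_zero]
  have hj : (j.factorial : ℂ) ≠ 0 := by exact_mod_cast j.factorial_ne_zero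
  rw [div_mul_eq_mul_div, div_div, div_mul_eq_mul_div, mul_comm (j.factorial : ℂ)]

/-- The terms of the series along a residue class modulo `m + 1` form a hypergeometric series. The sign
of `sin(π (j + i / (m + 1)))` is the `(-1)^j` of the argument `-r`. -/
lemma stableSeries_term_eq (m : ℕ) (i : Fin (m + 1)) (j : ℕ) {l t : ℝ} (ht : 0 < t) :
    (((-l) ^ (j * (m + 1) + (i : ℕ)) / (j * (m + 1) + (i : ℕ)).factorial
        * Real.sin (Real.pi * ((j * (m + 1) + (i : ℕ) : ℕ) * (1 / ((m : ℝ) + 1))))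
        * (Real.Gamma ((j * (m + 1) + (i : ℕ) : ℕ) * (1 / ((m : ℝ) + 1)) + 1)
          * t ^ (-((j * (m + 1) + (i : ℕ) : ℕ) * (1 / ((m : ℝ) + 1)) + 1))) : ℝ) : ℂ)
      = (((-l) ^ (i : ℕ) / (i : ℕ).factorial * Real.sin (Real.pi * (i / (m + 1)))
            * t ^ (-(1 + (i : ℝ) / (m + 1))) : ℝ) : ℂ) * Complex.Gamma (1 + i / (m + 1))
        * ((ascPochhammer ℂ j).eval (1 + (i : ℂ) / (m + 1))
          / (∏ i' : Fin (m + 1), (ascPochhammer ℂ j).eval (1 + ((i : ℂ) - i') / (m + 1)))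
          * ((-1) ^ (m + 1) * -((l ^ (m + 1) / (((m : ℝ) + 1) ^ (m + 1) * t) : ℝ) : ℂ)) ^ j) := by
  have hm : ((m : ℝ) + 1) ≠ 0 := by positivity
  have hmc : ((m : ℂ) + 1) ≠ 0 := by exact_mod_cast Nat.succ_ne_zero m
  have h1 : ((j * (m + 1) + (i : ℕ) : ℕ) : ℝ) * (1 / ((m : ℝ) + 1)) = j + i / (m + 1) := by
    push_cast; field_simp
  rw [h1]
  have hsin : Real.sin (Real.pi * (j + i / (m + 1))) = (-1) ^ j * Real.sin (Real.pi * (i / (m + 1))) := by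
    rw [mul_add, add_comm, mul_comm Real.pi (j : ℝ), Real.sin_add_nat_mul_pi]
  have hpow : t ^ (-((j : ℝ) + i / (m + 1) + 1)) = t ^ (-(1 + (i : ℝ) / (m + 1))) / t ^ j := by
    rw [← Real.rpow_natCast t j, ← Real.rpow_sub ht]
    congr 1; ring
  have hne : ∀ n : ℕ, (1 : ℂ) + i / (m + 1) ≠ -n := by
    intro n h
    have h' := congrArg Complex.re h
    have h2 : (1 + (i : ℂ) / (m + 1)).re = 1 + (i : ℝ) / (m + 1) := by
      rw [show (1 + (i : ℂ) / (m + 1)) = ((1 + (i : ℝ) / (m + 1) : ℝ) : ℂ) by push_cast; rfl,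
        Complex.ofReal_re]
    rw [h2] at h'
    simp at h'
    have h3 : 0 ≤ (i : ℝ) / (m + 1) := by positivity
    have h4 : (0 : ℝ) ≤ n := by positivity
    linarith
  have hG : ((Real.Gamma ((j : ℝ) + i / (m + 1) + 1) : ℝ) : ℂ)
      = Complex.Gamma (1 + i / (m + 1)) * (ascPochhammer ℂ j).eval (1 + (i : ℂ) / (m + 1)) := by
    rw [← Complex.Gamma_add_nat_div_Gamma_eq _ hne, mul_div_cancel₀ _ (Complex.Gamma_ne_zero hne),
      ← Complex.Gamma_ofReal]
    congr 1
    push_cast; ring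
  have hfac := factorial_mul_add_eq_prod_ascPochhammer m i j
  rw [hsin, hpow]
  simp only [Complex.ofReal_mul, Complex.ofReal_div, Complex.ofReal_natCast, hG, hfac]
  have hprod : ∏ i' : Fin (m + 1), (ascPochhammer ℂ j).eval (1 + ((i : ℂ) - i') / (m + 1)) ≠ 0 := by
    intro h
    rw [h, mul_zero] at hfac
    exact Nat.factorial_ne_zero _ (by exact_mod_cast hfac)
  have hi : ((i : ℕ).factorial : ℂ) ≠ 0 := by exact_mod_cast Nat.factorial_ne_zero _
  have htc : (t : ℂ) ≠ 0 := by exact_mod_cast ht.ne'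
  generalize ∏ i' : Fin (m + 1), (ascPochhammer ℂ j).eval (1 + ((i : ℂ) - i') / (m + 1)) = p at *
  generalize (ascPochhammer ℂ j).eval (1 + (i : ℂ) / (m + 1)) = q at *
  generalize Complex.Gamma (1 + i / (m + 1)) = g at *
  generalize Real.sin (Real.pi * (i / (m + 1))) = s at *
  generalize t ^ (-(1 + (i : ℝ) / (m + 1))) = v at *
  push_cast
  rw [mul_pow, neg_pow ((l : ℂ) ^ (m + 1) / _) j, div_pow, mul_pow, ← pow_mul, ← pow_mul, ← pow_mul,
    pow_add, mul_comm j (m + 1), neg_pow (l : ℂ) ((m + 1) * j)]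
  field_simp

/-- The stable series, split into residue classes modulo `m + 1`, in terms of MacRobert functions at
the two points `r e^(±iπ)`. -/
lemma sum_macRobertE_eq {m : ℕ} (hm : 1 ≤ m) {l t S : ℝ} (hl : 0 < l) (ht : 0 < t)
    (hS : HasSum (fun n : ℕ => (-l) ^ n / n.factorial
        * Real.sin (Real.pi * (n * (1 / ((m : ℝ) + 1))))
        * (Real.Gamma (n * (1 / ((m : ℝ) + 1)) + 1) * t ^ (-(n * (1 / ((m : ℝ) + 1)) + 1)))) S)
    {r : ℝ} (hr : r = l ^ (m + 1) / (((m : ℝ) + 1) ^ (m + 1) * t)) :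
    1 / Complex.I * macRobertE (fun j : Fin (m + 1) => 1 + (j : ℂ) * ((1 / ((m : ℝ) + 1) : ℝ) : ℂ))
        (Fin.elim0 : Fin 0 → ℂ) ((Real.log r : ℂ) + Complex.I * (Real.pi : ℂ))
      + 1 / (-Complex.I) * macRobertE
        (fun j : Fin (m + 1) => 1 + (j : ℂ) * ((1 / ((m : ℝ) + 1) : ℝ) : ℂ))
        (Fin.elim0 : Fin 0 → ℂ) ((Real.log r : ℂ) + (-Complex.I) * (Real.pi : ℂ))
      = ((-2 * ((2 * Real.pi) ^ ((m : ℝ) / 2) * ((m : ℝ) + 1) ^ (-(1 / 2) : ℝ))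
          * (l / (m + 1)) ^ (m + 1) * S : ℝ) : ℂ) := by
  have hr0 : 0 < r := by rw [hr]; positivity
  have hlogr : Complex.exp (Real.log r) = r := by rw [← Complex.ofReal_exp, Real.exp_log hr0]
  have hw1 : Complex.exp ((Real.log r : ℂ) + Complex.I * (Real.pi : ℂ)) = -r := by
    rw [Complex.exp_add, hlogr, mul_comm Complex.I, Complex.exp_pi_mul_I]; ring
  have hw2 : Complex.exp ((Real.log r : ℂ) + (-Complex.I) * (Real.pi : ℂ)) = -r := by
    rw [Complex.exp_add, hlogr, neg_mul, Complex.exp_neg, mul_comm Complex.I,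
      Complex.exp_pi_mul_I]; norm_num
  -- splitting the series according to `n = j (m + 1) + i`
  have hsplit : (S : ℂ) = ∑ i : Fin (m + 1),
      (((-l) ^ (i : ℕ) / (i : ℕ).factorial * Real.sin (Real.pi * (i / (m + 1)))
            * t ^ (-(1 + (i : ℝ) / (m + 1))) : ℝ) : ℂ) * Complex.Gamma (1 + i / (m + 1))
        * ∑' j : ℕ, ((ascPochhammer ℂ j).eval (1 + (i : ℂ) / (m + 1))
          / (∏ i' : Fin (m + 1), (ascPochhammer ℂ j).eval (1 + ((i : ℂ) - i') / (m + 1)))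
          * ((-1) ^ (m + 1) * -(r : ℂ)) ^ j) := by
    have hSc := Complex.hasSum_ofReal.mpr hS
    let e : Fin (m + 1) × ℕ ≃ ℕ := (Equiv.prodComm _ _).trans (Nat.divModEquiv (m + 1)).symm
    have h2 := e.hasSum_iff.mpr hSc
    rw [← h2.tsum_eq, h2.summable.tsum_prod, tsum_fintype]
    refine Finset.sum_congr rfl fun i _ => ?_
    rw [← tsum_mul_left]
    refine tsum_congr fun j => ?_
    rw [hr, ← stableSeries_term_eq m i j ht]
    rfl
  rw [macRobertE_one_add_div hm, macRobertE_one_add_div hm, hw1, hw2]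
  simp only [Complex.ofReal_mul _ S]
  rw [hsplit, Finset.mul_sum, Finset.mul_sum, Finset.mul_sum, ← Finset.sum_add_distrib]
  refine Finset.sum_congr rfl fun i _ => ?_
  generalize (∑' j : ℕ, (ascPochhammer ℂ j).eval (1 + (i : ℂ) / (m + 1))
          / (∏ i' : Fin (m + 1), (ascPochhammer ℂ j).eval (1 + ((i : ℂ) - i') / (m + 1)))
          * ((-1) ^ (m + 1) * -(r : ℂ)) ^ j) = F
  generalize Complex.Gamma (1 + (i : ℂ) / (m + 1)) = g
  -- the two points `r e^(±iπ)` have the same hypergeometric series, and their powers combine into a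
  -- sine
  have hexp : 1 / Complex.I * Complex.exp ((1 + (i : ℂ) / (m + 1))
        * ((Real.log r : ℂ) + Complex.I * (Real.pi : ℂ)))
      + 1 / (-Complex.I) * Complex.exp ((1 + (i : ℂ) / (m + 1))
        * ((Real.log r : ℂ) + (-Complex.I) * (Real.pi : ℂ)))
      = ((r ^ (1 + (i : ℝ) / (m + 1)) * (-2 * Real.sin (Real.pi * (i / (m + 1)))) : ℝ) : ℂ) := by
    have hs : -2 * Real.sin (Real.pi * (i / (m + 1)))
        = 2 * Real.sin (Real.pi * (1 + (i : ℝ) / (m + 1))) := by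
      rw [mul_add, mul_one, add_comm Real.pi, Real.sin_add_pi]; ring
    rw [hs, Real.rpow_def_of_pos hr0]
    push_cast [Complex.sin]
    have e1 : (1 + (i : ℂ) / (m + 1)) * ((Real.log r : ℂ) + Complex.I * (Real.pi : ℂ))
        = Real.log r * (1 + (i : ℂ) / (m + 1)) + Real.pi * (1 + (i : ℂ) / (m + 1)) * Complex.I := by
      ring
    have e2 : (1 + (i : ℂ) / (m + 1)) * ((Real.log r : ℂ) + (-Complex.I) * (Real.pi : ℂ))
        = Real.log r * (1 + (i : ℂ) / (m + 1)) + -(Real.pi * (1 + (i : ℂ) / (m + 1))) * Complex.I := by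
      ring
    rw [e1, e2, Complex.exp_add, Complex.exp_add, one_div, one_div, inv_neg, Complex.inv_I]
    ring
  have hrpow : r ^ (1 + (i : ℝ) / (m + 1))
      = (l / (m + 1)) ^ (m + 1) * (l / (m + 1)) ^ (i : ℕ) * t ^ (-(1 + (i : ℝ) / (m + 1))) := by
    have hm0 : ((m : ℝ) + 1) ≠ 0 := by positivity
    rw [hr, ← div_div, ← div_pow, Real.div_rpow (by positivity) ht.le, Real.rpow_neg ht.le,
      ← div_eq_mul_inv, ← Real.rpow_natCast (l / (m + 1)) (m + 1), ← Real.rpow_mul (by positivity),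
      ← Real.rpow_natCast (l / (m + 1)) i, ← Real.rpow_add (by positivity)]
    congr 2
    push_cast
    field_simp
  rw [prod_erase_Gamma_sub_div]
  have hfin : ∀ A B C : ℂ, 1 / Complex.I * (A * g * B * F) + 1 / (-Complex.I) * (A * g * C * F)
      = (1 / Complex.I * B + 1 / (-Complex.I) * C) * A * (g * F) := by intros; ring
  rw [hfin, hexp, hrpow]
  have hfin2 : ∀ A D : ℂ, A * (D * g * F) = A * D * (g * F) := by intros; ring
  rw [hfin2, ← Complex.ofReal_mul, ← Complex.ofReal_mul]
  congr 2
  rw [neg_pow l, div_pow l _ (i : ℕ)]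
  have hm0 : ((m : ℝ) + 1) ≠ 0 := by positivity
  field_simp

lemma ptsModulus_eq {β k x t : ℝ} {m : ℕ} (hk : 0 < k) :
    ptsModulus β (1 / ((m : ℝ) + 1)) k x t
      = ptsScale β (1 / ((m : ℝ) + 1)) k x ^ (m + 1) / (((m : ℝ) + 1) ^ (m + 1) * t) := by
  have hm0 : (0 : ℝ) < (m : ℝ) + 1 := by positivity
  unfold ptsModulus
  have h1 : (2 / k ^ 2) ^ (1 / ((m : ℝ) + 1)) * (-(x * ptsA β (1 / ((m : ℝ) + 1))))
      * Real.Gamma (-(1 / ((m : ℝ) + 1))) = ptsScale β (1 / ((m : ℝ) + 1)) k x := by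
    rw [ptsScale, Real.rpow_neg (by positivity), ← Real.inv_rpow (by positivity), inv_div]; ring
  have h2 : (1 / ((m : ℝ) + 1)) ^ (-1 / (1 / ((m : ℝ) + 1))) = ((m : ℝ) + 1) ^ (m + 1) := by
    rw [← Real.rpow_natCast, one_div, Real.inv_rpow hm0.le, ← Real.rpow_neg hm0.le]
    congr 1
    push_cast; field_simp
  rw [h1, h2, one_div_one_div]
  congr 1
  exact_mod_cast Real.rpow_natCast _ (m + 1)

lemma ptsDensity_eq_ptsMacRobertQ {β k x t : ℝ} {m : ℕ} (hβ : 0 < β) (hm : 1 ≤ m) (hk : 0 < k)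
    (hx : 0 < x) (ht : 0 < t) :
    (ptsDensity β (1 / ((m : ℝ) + 1)) k x t : ℂ)
      = ptsMacRobertQ β (1 / ((m : ℝ) + 1)) k (m + 1) x t := by
  have hm0 : (0 : ℝ) < (m : ℝ) + 1 := by positivity
  have hm1 : (1 : ℝ) ≤ m := by exact_mod_cast hm
  have hγ : 1 / ((m : ℝ) + 1) ≤ 1 / 2 := by
    rw [div_le_div_iff₀ hm0 two_pos]; linarith
  have hl : 0 < ptsScale β (1 / ((m : ℝ) + 1)) k x :=
    ptsScale_pos hβ (by positivity) (by linarith) hk hx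
  have hsum := hasSum_ptsDensity hβ (γ := 1 / ((m : ℝ) + 1)) (by positivity) hγ hk hx ht
  have hC : Real.exp (-(x * ptsA β (1 / ((m : ℝ) + 1)) * Real.Gamma (-(1 / ((m : ℝ) + 1)))))
      * Real.exp (-(k ^ 2 / 2 * t)) ≠ 0 := by positivity
  have hpi : -(1 / Real.pi) ≠ 0 := by simp [Real.pi_ne_zero]
  have hS := (hsum.mul_left (Real.exp (-(x * ptsA β (1 / ((m : ℝ) + 1))
      * Real.Gamma (-(1 / ((m : ℝ) + 1))))) * Real.exp (-(k ^ 2 / 2 * t)))⁻¹).mul_left (-(1 / Real.pi))⁻¹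
  simp only [inv_mul_cancel_left₀ hC, inv_mul_cancel_left₀ hpi] at hS
  have key := sum_macRobertE_eq hm hl ht hS rfl
  rw [ptsMacRobertQ, ptsModulus_eq hk]
  refine Eq.symm ((congrArg (_ * ·) key).trans ?_)
  rw [← Complex.ofReal_mul]
  congr 1
  have h1 : -(x * ptsA β (1 / ((m : ℝ) + 1))) * (2 / k ^ 2) ^ (1 / ((m : ℝ) + 1))
      * Real.Gamma (-(1 / ((m : ℝ) + 1))) = ptsScale β (1 / ((m : ℝ) + 1)) k x := by
    rw [ptsScale, Real.rpow_neg (by positivity), ← Real.inv_rpow (by positivity), inv_div]; ring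
  have h2 : ptsScale β (1 / ((m : ℝ) + 1)) k x ^ (1 / (1 / ((m : ℝ) + 1)))
      = ptsScale β (1 / ((m : ℝ) + 1)) k x ^ (m + 1) := by
    rw [one_div_one_div]; exact_mod_cast Real.rpow_natCast _ (m + 1)
  have h3 : (1 / (1 / ((m : ℝ) + 1))) ^ ((1 / ((m : ℝ) + 1) + 2) / (2 * (1 / ((m : ℝ) + 1))))
      = ((m : ℝ) + 1) ^ (m + 1) * ((m : ℝ) + 1) ^ (1 / 2 : ℝ) := by
    rw [one_div_one_div, ← Real.rpow_natCast, ← Real.rpow_add hm0]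
    congr 1
    push_cast; field_simp; ring
  have h4 : (2 * Real.pi) ^ ((1 / ((m : ℝ) + 1) + 1) / (2 * (1 / ((m : ℝ) + 1))))
      = (2 * Real.pi) ^ ((m : ℝ) / 2) * (2 * Real.pi) := by
    conv_rhs => rw [← Real.rpow_add_one (by positivity)]
    congr 1
    field_simp; ring
  have h5 : Real.exp (-(k ^ 2) * t / 2) = Real.exp (-(k ^ 2 / 2 * t)) := by congr 1; ring
  rw [h1, h2, h3, h4, h5, Real.rpow_neg hm0.le, div_pow]
  have hq : ((m : ℝ) + 1) ^ (1 / 2 : ℝ) ≠ 0 := by positivity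
  have hp : (2 * Real.pi) ^ ((m : ℝ) / 2) ≠ 0 := by positivity
  generalize ((m : ℝ) + 1) ^ (1 / 2 : ℝ) = q at *
  generalize (2 * Real.pi) ^ ((m : ℝ) / 2) = p at *
  field_simp

theorem mainTheorem7 {Ω : Type*} [MeasurableSpace Ω] (P : Measure Ω) [IsProbabilityMeasure P]
    (β γ k : ℝ) (hβ : 0 < β) (hγ0 : 0 < γ) (hγ1 : γ < 1) (hk : 0 < k)
    (X : ℝ≥0 → Ω → ℝ) (hX : IsSubordinator X P) (hXL : HasLevyMeasure X P (ptsLevyMeasure β γ k)) :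
    ∃ q : ℝ → ℝ → ℝ,
      (∀ x, 0 < x → IsInverseLaplace (q x) (ptsLaplaceQ β γ k x)) ∧
      (∀ m : ℕ, 2 ≤ m → γ = 1 / (m : ℝ) →
        ∀ x t : ℝ, 0 < x → 0 < t → (q x t : ℂ) = ptsMacRobertQ β γ k m x t) ∧
      ∀ t, 0 < t →
        (∀ᵐ ω ∂P, ∃ τ : ℝ≥0, 0 < τ ∧ t ≤ X τ ω) ∧
        (∀ x, 0 < x → IntervalIntegrable (fun τ => ptsP β γ k τ * q x (t - τ)) volume 0 t) ∧
        HasDensityOnPos (firstExitTime X t) P (fun x => laplaceConv (ptsP β γ k) (q x) t) := by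
  refine ⟨ptsDensity β γ k, fun x hx => ?_, fun m hm hγ x t hx ht => ?_, fun t ht => ⟨?_, ?_, ?_⟩⟩
  · have := Measure.isFiniteMeasure_map P (X x.toNNReal)
    exact isInverseLaplace_ptsDensity hβ hγ0 hγ1 hk hx (hX.ae_map_nonneg _)
      fun z hz => hXL.integral_exp_map hX hx.le hz
  · obtain ⟨m, rfl⟩ : ∃ n, m = n + 1 := ⟨m - 1, by omega⟩
    rw [Nat.cast_succ] at hγ
    subst hγ
    exact ptsDensity_eq_ptsMacRobertQ hβ (by omega) hk hx ht
  · filter_upwards [ae_exists_le_of_hasLevyMeasure hβ hγ0 hγ1 hk hX hXL t, hX.start_zero] with ω hω h0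
    obtain ⟨τ, hτ⟩ := hω
    refine ⟨τ, pos_iff_ne_zero.mpr fun h => ?_, hτ⟩
    rw [h, h0] at hτ
    linarith
  · exact fun x hx => intervalIntegrable_ptsP_mul_ptsDensity hβ hγ0 hγ1 hk hx ht
  · exact hasDensityOnPos_firstExitTime hβ hγ0 hγ1 hk hX hXL ht
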